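/- **Setting.** Let $\mathcal A$ be the Hopf $*$-algebra of polynomial functions on a compact matrix quantum group $G$ (it is generated as an algebra by the matrix elements of one finite-dimensional unitary representation), with coproduct $\phi(a)=a^{(1)}\otimes a^{(2)}$, counit $\epsilon$, antipode $\kappa$ and adjoint action $\mathrm{ad}(a)=a^{(2)}\otimes\kappa(a^{(1)})a^{(3)}$. Let $\Gamma$ be a bicovariant first-order $*$-calculus over $G$, determined by a right ideal $\mathcal R\subseteq\ker\epsilon$ with $\mathrm{ad}(\mathcal R)\subseteq\mathcal R\otimes\mathcal A$ and $\kappa(\mathcal R)^*\subseteq\mathcal R$. Let $\Gamma_{inv}$ be its space of left-invariant elements and $\pi\colon\mathcal A\to\Gamma_{inv}$, $\pi(a)=\kappa(a^{(1)})\,da^{(2)}$, the canonical projection map, which is onto with kernel $\mathbb C1\oplus\mathcal R$. Put $\pi(a)\circ b=\pi(ab)-\epsilon(a)\pi(b)$ and $\varpi\pi=(\pi\otimes\mathrm{id})\mathrm{ad}$. Let $\Gamma^\wedge$ be the universal differential envelope of $\Gamma$, and let $\Gamma_{inv}^\wedge$ be its left-invariant part: the quotient of the tensor algebra of $\Gamma_{inv}$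 by the ideal generated by the elements $\pi(a^{(1)})\otimes\pi(a^{(2)})$, $a\in\mathcal R$, with the differential given by $d\pi(a)=-\pi(a^{(1)})\pi(a^{(2)})$ and the graded Leibniz rule, and with the right $\mathcal A$-module structure $\circ$ extended by $1\circ a=\epsilon(a)1$ and $(\vartheta\eta)\circ a=(\vartheta\circ a^{(1)})(\eta\circ a^{(2)})$. Let $P=(\mathcal B,i,F)$ be a quantum principal $G$-bundle over a quantum space $M$ with unital $*$-algebra $\mathcal V$: $\mathcal B$ is a unital $*$-algebra, $F\colon\mathcal B\to\mathcal B\otimes\mathcal A$ is a $*$-homomorphism which is a coaction, $i\colon\mathcal V\to\mathcal B$ is an injective $*$-homomorphism onto $\{b\in\mathcal B: F(b)=b\otimes1\}$, and for every $a\in\mathcal A$ the element $1\otimes a$ has the form $\sum_k (q_k\otimes 1)F(b_k)$ with $q_k,b_k\in\mathcal B$. Let $\Omega(P)$ be a differential calculus on $P$: a graded-differential $*$-algebra with $\Omega^0(P)=\mathcal B$, generated as a differential algebra by $\mathcal B$, such that $F$ extends to a homomorphism $\widehat F\colon\Omega(P)\to\Omega(P)\mathbin{\widehat\otimes}\Gamma^\wedge$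 of graded-differential algebras (graded tensor product). Let $F^\wedge=(\mathrm{id}\otimes p_*)\widehat F\colon\Omega(P)\to\Omega(P)\otimes\mathcal A$, where $p_*\colon\Gamma^\wedge\to\mathcal A$ is the projection onto degree $0$; let $\mathrm{hor}(P)=\widehat F^{-1}(\Omega(P)\otimes\mathcal A)$ be the ($F^\wedge$-invariant) algebra of horizontal forms, and let $\mathrm{vh}(P)=\mathrm{hor}(P)\otimes\Gamma_{inv}^\wedge$, with the linear map $d_{vh}$ given on homogeneous $\varphi$, with $F^\wedge(\varphi)=\sum_k\varphi_k\otimes c_k$, by $$d_{vh}(\varphi\otimes\vartheta)=(-1)^{\partial\varphi}\sum_k\varphi_k\otimes\pi(c_k)\vartheta+(-1)^{\partial\varphi}\varphi\otimes d\vartheta .$$ A *tensorial form* of degree $\partial\lambda=p$ is a linear map $\lambda\colon\Gamma_{inv}\to\Omega(P)$ with values in the horizontal forms of degree $p$ such that $F^\wedge\lambda=(\lambda\otimes\mathrm{id})\varpi$. For $\varphi\in\mathrm{hor}(P)$ homogeneous and $\vartheta_1,\dots,\vartheta_n\in\Gamma_{inv}$ with $\varpi(\vartheta_i)=\sum_l\vartheta_{il}\otimes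 c_{il}$, put $$S_\lambda(\varphi\otimes\vartheta_1\cdots\vartheta_n)=\sum_k\varphi_k\,\lambda\pi(c_k)\otimes\vartheta_1\cdots\vartheta_n,$$ $$T_\lambda(\varphi\otimes\vartheta_1\cdots\vartheta_n)=(-1)^{\partial\varphi}\sum_{i=1}^n\sum_l(-1)^{i-1}\varphi\,\lambda(\vartheta_{il})\otimes\bigl(\{\vartheta_1\cdots\vartheta_{i-1}\}\circ c_{il}\bigr)\{\vartheta_{i+1}\cdots\vartheta_n\}.$$ For an irreducible unitary representation $u=(u_{ij})$ of $G$ on $H_u=\mathbb C^n$, $u(e_i)=\sum_j e_j\otimes u_{ji}$, let $\Lambda_u=H_u\otimes\Gamma_{inv}^\wedge$ with $$d_u(e_i\otimes\eta)=e_i\otimes d\eta+\sum_j e_j\otimes\pi(u_{ji})\eta .$$ **Statement.** 1. For every bundle $P$ with calculus $\Omega(P)$ and every tensorial form $\lambda$, the formula for $T_\lambda$ gives a well-defined linear map $T_\lambda\colon\mathrm{vh}(P)\to\mathrm{vh}(P)$, and $S_\lambda$ is chain-homotopic to zero: $$S_\lambda=T_\lambda d_{vh}+(-1)^{\partial\lambda}d_{vh}T_\lambda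 .$$ 2. The $\Lambda_u$ are, up to a sign in the differential, subcomplexes of $\mathrm{vh}(P)$: if $u$ is an irreducible unitary representation and $f\colon H_u\to\mathrm{hor}(P)$ is a nonzero linear map, with values in the forms of one degree $m$, that intertwines $u$ and $F^\wedge$, then $f\otimes\mathrm{id}\colon\Lambda_u\to\mathrm{vh}(P)$ is injective and $d_{vh}(f\otimes\mathrm{id})=(-1)^m(f\otimes\mathrm{id})d_u$. 3. If $u$ is an irreducible unitary representation of $G$ with $\pi(u)\neq0$, that is, $\pi(u_{ij})\neq0$ for some $i,j$, then the complex $\Lambda_u$ is acyclic: $\ker d_u=\operatorname{im}d_u$. -/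

import Mathlib

open scoped TensorProduct

namespace QPB

noncomputable section

/-! ## Compact matrix quantum groups -/

/-- Hopf `*`-algebras: the coproduct is a `*`-homomorphism. -/
class HopfStarAlgebra (A : Type*) [Ring A] [HopfAlgebra ℂ A] [StarRing A] [StarModule ℂ A] :
    Prop where
  comul_star : ∀ a : A, Coalgebra.comul (R := ℂ) (star a) = star (Coalgebra.comul (R := ℂ) a)

/-- An `n`-dimensional unitary representation `u` of the quantum group, i.e. a unitary matrix over
`A` with `φ(u i j) = ∑ k, u i k ⊗ u k j` and `ε(u i j) = δ i j`. -/
structure UnitaryRep (A : Type*) [Ring A] [HopfAlgebra ℂ A] [StarRing A] (n : ℕ) where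
  mat : Matrix (Fin n) (Fin n) A
  comul_mat : ∀ i j, Coalgebra.comul (R := ℂ) (mat i j) = ∑ k, mat i k ⊗ₜ[ℂ] mat k j
  counit_mat : ∀ i j, Coalgebra.counit (R := ℂ) (mat i j) = if i = j then 1 else 0
  mem_unitary : mat ∈ unitary (Matrix (Fin n) (Fin n) A)

/-- `A` is the Hopf `*`-algebra of polynomial functions on a compact matrix quantum group: it is
generated as an algebra by the entries of one finite-dimensional unitary representation. -/
class CompactMatrixQuantumGroup (A : Type*) [Ring A] [HopfAlgebra ℂ A] [StarRing A]
    [StarModule ℂ A] : Prop extends HopfStarAlgebra A where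
  exists_fundamental : ∃ (n : ℕ) (u : UnitaryRep A n),
    Algebra.adjoin ℂ (Set.range fun p : Fin n × Fin n => u.mat p.1 p.2) = ⊤

namespace UnitaryRep

variable {A : Type*} [Ring A] [HopfAlgebra ℂ A] [StarRing A] {n : ℕ}

/-- The coaction `H_u → H_u ⊗ A` on `H_u = ℂⁿ`, `e i ↦ ∑ j, e j ⊗ u j i`. -/
def coaction (u : UnitaryRep A n) : (Fin n → ℂ) →ₗ[ℂ] (Fin n → ℂ) ⊗[ℂ] A :=
  (Pi.basisFun ℂ (Fin n)).constr ℂ fun i => ∑ j, (Pi.single j (1 : ℂ)) ⊗ₜ[ℂ] u.mat j i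

/-- `u` is irreducible: `H_u ≠ 0`, and the only subspaces `W` with `u(W) ⊆ W ⊗ A` are trivial. -/
def IsIrreducible (u : UnitaryRep A n) : Prop :=
  0 < n ∧ ∀ W : Submodule ℂ (Fin n → ℂ),
    (∀ x ∈ W, u.coaction x ∈ LinearMap.range (W.subtype.rTensor A)) → W = ⊥ ∨ W = ⊤

end UnitaryRep

/-! ## Bicovariant first-order `*`-calculi -/

section Adjoint

variable (A : Type*) [Ring A] [HopfAlgebra ℂ A]

/-- The adjoint action `ad(a) = a₂ ⊗ κ(a₁) a₃`. -/
def ad : A →ₗ[ℂ] A ⊗[ℂ] A :=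
  (LinearMap.mul' ℂ A ∘ₗ (HopfAlgebra.antipode ℂ (A := A)).rTensor A).lTensor A
    ∘ₗ (TensorProduct.leftComm ℂ A A A).toLinearMap
    ∘ₗ (Coalgebra.comul (R := ℂ) (A := A)).lTensor A ∘ₗ Coalgebra.comul

end Adjoint

section AdjointIdentities

variable {A : Type*} [Ring A] [HopfAlgebra ℂ A]

lemma ad_eq (b : A) : ad A b = TensorProduct.lift (LinearMap.mk₂ ℂ
    (fun p y : A => (1 ⊗ₜ[ℂ] HopfAlgebra.antipode ℂ p) * Coalgebra.comul (R := ℂ) y)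
    (by intros; simp [TensorProduct.tmul_add, add_mul]) (by intros; simp)
    (by intros; simp [mul_add]) (by intros; simp)) (Coalgebra.comul (R := ℂ) b) := by
  simp only [ad, LinearMap.comp_apply]
  generalize Coalgebra.comul (R := ℂ) b = t
  induction t with
  | zero => simp
  | add x y hx hy => simp only [map_add, hx, hy]
  | tmul p y =>
    simp only [LinearMap.lTensor_tmul, TensorProduct.lift.tmul, LinearMap.mk₂_apply]
    generalize Coalgebra.comul (R := ℂ) y = s
    induction s with
    | zero => simp
    | add x y hx hy => simp only [map_add, hx, hy, TensorProduct.tmul_add, mul_add]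
    | tmul q r => simp

/-- The map `x ⊗ y ↦ y₂ ⊗ x κ(y₁) y₃`. -/
def adTwist : A ⊗[ℂ] A →ₗ[ℂ] A ⊗[ℂ] A :=
  TensorProduct.lift (LinearMap.mk₂ ℂ
    (fun x y : A => (1 ⊗ₜ[ℂ] x) * ad A y)
    (by intros; simp [TensorProduct.tmul_add, add_mul]) (by intros; simp)
    (by intros; simp [mul_add]) (by intros; simp))

/-- `b₃ ⊗ b₁ κ(b₂) b₄ = b₁ ⊗ b₂`. -/
lemma adTwist_comul (b : A) : adTwist (Coalgebra.comul (R := ℂ) b)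
    = Coalgebra.comul (R := ℂ) b := by
  let K : A ⊗[ℂ] (A ⊗[ℂ] A) →ₗ[ℂ] A ⊗[ℂ] A :=
    TensorProduct.lift (LinearMap.mk₂ ℂ
      (fun (x : A) (t : A ⊗[ℂ] A) => (1 ⊗ₜ[ℂ] x) * TensorProduct.lift (LinearMap.mk₂ ℂ
        (fun p y : A => (1 ⊗ₜ[ℂ] HopfAlgebra.antipode ℂ p) * Coalgebra.comul (R := ℂ) y)
        (by intros; simp [TensorProduct.tmul_add, add_mul]) (by intros; simp)
        (by intros; simp [mul_add]) (by intros; simp)) t)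
      (by intros; simp [TensorProduct.tmul_add, add_mul]) (by intros; simp)
      (by intros; simp [mul_add]) (by intros; simp))
  have h1 : ∀ t : A ⊗[ℂ] A, adTwist t
      = K ((Coalgebra.comul (R := ℂ)).lTensor A t) := by
    intro t
    induction t with
    | zero => simp
    | add x y hx hy => simp only [map_add, hx, hy]
    | tmul x y => simp [K, adTwist, ad_eq]
  have h2 : ∀ t : A ⊗[ℂ] A, K (TensorProduct.assoc ℂ A A A
      ((Coalgebra.comul (R := ℂ)).rTensor A t)) =
      Coalgebra.comul (R := ℂ) (TensorProduct.lid ℂ A ((Coalgebra.counit (R := ℂ)).rTensor A t)) := by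
    intro t
    induction t with
    | zero => simp
    | add x y hx hy => simp only [map_add, hx, hy]
    | tmul x y =>
      have e : ∀ s : A ⊗[ℂ] A, K (TensorProduct.assoc ℂ A A A (s ⊗ₜ y)) =
          (1 ⊗ₜ LinearMap.mul' ℂ A ((HopfAlgebra.antipode ℂ (A := A)).lTensor A s))
            * Coalgebra.comul (R := ℂ) y := by
        intro s
        induction s with
        | zero => simp
        | add x y hx hy =>
          simp only [map_add, TensorProduct.add_tmul, hx, hy, TensorProduct.tmul_add, add_mul]
        | tmul p q => simp [K, ← mul_assoc]
      rw [LinearMap.rTensor_tmul, e, HopfAlgebra.mul_antipode_lTensor_comul_apply,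
        LinearMap.rTensor_tmul, TensorProduct.lid_tmul, map_smul, Algebra.algebraMap_eq_smul_one,
        TensorProduct.tmul_smul, smul_mul_assoc, ← Algebra.TensorProduct.one_def, one_mul]
  rw [h1, ← Coalgebra.coassoc_apply, h2, Coalgebra.rTensor_counit_comul, TensorProduct.lid_tmul,
    one_smul]

/-- The diagonal coaction `a ⊗ b ↦ (a₁ ⊗ b₁) ⊗ a₂ b₂`. -/
def codiag : A ⊗[ℂ] A →ₗ[ℂ] (A ⊗[ℂ] A) ⊗[ℂ] A :=
  (LinearMap.mul' ℂ A).lTensor (A ⊗[ℂ] A)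
    ∘ₗ (TensorProduct.tensorTensorTensorComm ℂ A A A A).toLinearMap
    ∘ₗ TensorProduct.map Coalgebra.comul Coalgebra.comul

end AdjointIdentities

/-- A bicovariant first-order `*`-calculus over the quantum group, given by the right ideal
`ℛ ⊆ ker ε` that determines it: `ad(ℛ) ⊆ ℛ ⊗ A` (bicovariance), `κ(ℛ)* ⊆ ℛ` (`*`-covariance). -/
structure BicovariantCalculus (A : Type*) [Ring A] [HopfAlgebra ℂ A] [StarRing A] where
  ideal : Submodule ℂ A
  ideal_mul_mem : ∀ r ∈ ideal, ∀ a : A, r * a ∈ ideal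
  counit_eq_zero : ∀ r ∈ ideal, Coalgebra.counit (R := ℂ) r = 0
  ad_mem : ∀ r ∈ ideal, ad A r ∈ LinearMap.range (ideal.subtype.rTensor A)
  star_antipode_mem : ∀ r ∈ ideal, star (HopfAlgebra.antipode ℂ r) ∈ ideal

section Calculus

variable {A : Type*} [Ring A] [HopfAlgebra ℂ A] [StarRing A] (Γ : BicovariantCalculus A)

namespace BicovariantCalculus

/-- The kernel `ℂ ⊕ ℛ` of `π`. -/
def kerPi : Submodule ℂ A := Submodule.span ℂ {1} ⊔ Γ.ideal

/-- The space `Γ_inv` of left-invariant one-forms, `A / (ℂ ⊕ ℛ) ≅ ker ε / ℛ`. -/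
abbrev Inv : Type _ := A ⧸ Γ.kerPi

/-- The canonical surjection `π : A → Γ_inv`, `π(a) = κ(a₁) d a₂`. -/
def pi : A →ₗ[ℂ] Γ.Inv := Γ.kerPi.mkQ

lemma pi_surjective : Function.Surjective Γ.pi := Submodule.mkQ_surjective _

lemma pi_one : Γ.pi 1 = 0 := by
  refine (Submodule.Quotient.mk_eq_zero _).2 ?_
  exact Submodule.mem_sup_left (Submodule.mem_span_singleton_self _)

lemma pi_eq_zero {r : A} (hr : r ∈ Γ.ideal) : Γ.pi r = 0 :=
  (Submodule.Quotient.mk_eq_zero _).2 (Submodule.mem_sup_right hr)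

lemma kerPi_le_ker {M : Type*} [AddCommGroup M] [Module ℂ M] (f : A →ₗ[ℂ] M) (h1 : f 1 = 0)
    (hR : ∀ r ∈ Γ.ideal, f r = 0) : Γ.kerPi ≤ LinearMap.ker f := by
  refine sup_le ?_ hR
  rw [Submodule.span_le]
  rintro x rfl
  exact h1

/-- The linear map on `Γ_inv` induced by a linear map on `A` that vanishes on `1` and on `ℛ`. -/
def invLift {M : Type*} [AddCommGroup M] [Module ℂ M] (f : A →ₗ[ℂ] M) (h1 : f 1 = 0)
    (hR : ∀ r ∈ Γ.ideal, f r = 0) : Γ.Inv →ₗ[ℂ] M :=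
  Γ.kerPi.liftQ f (Γ.kerPi_le_ker f h1 hR)

@[simp] lemma invLift_pi {M : Type*} [AddCommGroup M] [Module ℂ M] (f : A →ₗ[ℂ] M) (h1 : f 1 = 0)
    (hR : ∀ r ∈ Γ.ideal, f r = 0) (a : A) : Γ.invLift f h1 hR (Γ.pi a) = f a :=
  Submodule.liftQ_apply _ _ _

/-- The right `A`-module structure on `Γ_inv`, `π(a) ∘ b = π(ab - ε(a) b)`. -/
def circ : Γ.Inv →ₗ[ℂ] A →ₗ[ℂ] Γ.Inv :=
  Γ.invLift ((LinearMap.mul ℂ A).compr₂ Γ.pi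
      - (LinearMap.toSpanSingleton ℂ (A →ₗ[ℂ] Γ.Inv) Γ.pi) ∘ₗ Coalgebra.counit)
    (by ext b; simp)
    (fun r hr => by
      ext b
      simp [Γ.counit_eq_zero r hr, Γ.pi_eq_zero (Γ.ideal_mul_mem r hr b)])

lemma circ_pi (a b : A) :
    Γ.circ (Γ.pi a) b = Γ.pi (a * b - Coalgebra.counit (R := ℂ) a • b) := by
  simp [circ]

/-- The adjoint action `ϖ : Γ_inv → Γ_inv ⊗ A`, `ϖ π = (π ⊗ id) ad`. -/
def varpi : Γ.Inv →ₗ[ℂ] Γ.Inv ⊗[ℂ] A :=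
  Γ.invLift (Γ.pi.rTensor A ∘ₗ ad A)
    (by simp [ad, Bialgebra.comul_one, Algebra.TensorProduct.one_def, Γ.pi_one])
    (fun r hr => by
      obtain ⟨t, ht⟩ := Γ.ad_mem r hr
      rw [LinearMap.comp_apply, ← ht, ← LinearMap.rTensor_comp_apply]
      have : Γ.pi ∘ₗ Γ.ideal.subtype = 0 := by
        ext x; exact Γ.pi_eq_zero x.2
      rw [this, LinearMap.rTensor_zero, LinearMap.zero_apply])

lemma varpi_pi (a : A) : Γ.varpi (Γ.pi a) = Γ.pi.rTensor A (ad A a) := by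
  simp [varpi]

/-! ### The algebra `Γ_inv^∧` -/

/-- The quadratic element `π(a₁) ⊗ π(a₂)` of the tensor algebra of `Γ_inv`. -/
def quad : A →ₗ[ℂ] TensorAlgebra ℂ Γ.Inv :=
  LinearMap.mul' ℂ _ ∘ₗ TensorProduct.map (TensorAlgebra.ι ℂ ∘ₗ Γ.pi) (TensorAlgebra.ι ℂ ∘ₗ Γ.pi)
    ∘ₗ Coalgebra.comul

/-- The defining relations of `Γ_inv^∧`. -/
inductive InvRel : TensorAlgebra ℂ Γ.Inv → TensorAlgebra ℂ Γ.Inv → Prop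
  | quad (r : A) (hr : r ∈ Γ.ideal) : InvRel (Γ.quad r) 0

/-- The left-invariant part `Γ_inv^∧` of the universal envelope: the tensor algebra of `Γ_inv`
modulo the ideal generated by `π(a₁) ⊗ π(a₂)`, `a ∈ ℛ`. -/
def InvExt : Type _ := RingQuot Γ.InvRel

instance : Ring Γ.InvExt := inferInstanceAs (Ring (RingQuot Γ.InvRel))

instance : Algebra ℂ Γ.InvExt := inferInstanceAs (Algebra ℂ (RingQuot Γ.InvRel))

/-- The factorization map `Γ_inv^⊗ → Γ_inv^∧`. -/
def invMk : TensorAlgebra ℂ Γ.Inv →ₐ[ℂ] Γ.InvExt := RingQuot.mkAlgHom ℂ Γ.InvRel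

lemma invMk_quad {r : A} (hr : r ∈ Γ.ideal) : Γ.invMk (Γ.quad r) = 0 :=
  (RingQuot.mkAlgHom_rel ℂ (InvRel.quad r hr)).trans (map_zero _)

lemma invMk_surjective : Function.Surjective Γ.invMk :=
  RingQuot.mkAlgHom_surjective ℂ Γ.InvRel

/-- The inclusion of `Γ_inv` into `Γ_inv^∧`. -/
def inc : Γ.Inv →ₗ[ℂ] Γ.InvExt :=
  Γ.invMk.toLinearMap ∘ₗ TensorAlgebra.ι ℂ

/-- The product `ϑ₁ ⋯ ϑₙ` in `Γ_inv^∧`. -/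
def word (l : List Γ.Inv) : Γ.InvExt := (l.map Γ.inc).prod

/-- `x ⊗ y ↦ π(x) π(y)`. -/
def quadExt : A ⊗[ℂ] A →ₗ[ℂ] Γ.InvExt :=
  LinearMap.mul' ℂ Γ.InvExt ∘ₗ TensorProduct.map (Γ.inc ∘ₗ Γ.pi) (Γ.inc ∘ₗ Γ.pi)

lemma mk_quad (a : A) : Γ.invMk (Γ.quad a)
    = LinearMap.mul' ℂ _ (TensorProduct.map (Γ.inc ∘ₗ Γ.pi) (Γ.inc ∘ₗ Γ.pi)
        (Coalgebra.comul (R := ℂ) a)) := by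
  simp only [quad, LinearMap.comp_apply]
  generalize Coalgebra.comul (R := ℂ) a = t
  induction t with
  | zero => simp
  | add x y hx hy => simp only [map_add, hx, hy]
  | tmul x y => simp [inc]

lemma inc_quad {r : A} (hr : r ∈ Γ.ideal) :
    LinearMap.mul' ℂ Γ.InvExt (TensorProduct.map (Γ.inc ∘ₗ Γ.pi) (Γ.inc ∘ₗ Γ.pi)
        (Coalgebra.comul (R := ℂ) r)) = 0 := by
  rw [← mk_quad, Γ.invMk_quad hr]

/-- Algebra homomorphisms out of `Γ_inv^∧`. -/
def extLift {B : Type*} [Semiring B] [Algebra ℂ B] (f : Γ.Inv →ₗ[ℂ] B)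
    (hf : ∀ r ∈ Γ.ideal, LinearMap.mul' ℂ B (TensorProduct.map (f ∘ₗ Γ.pi) (f ∘ₗ Γ.pi)
        (Coalgebra.comul (R := ℂ) r)) = 0) : Γ.InvExt →ₐ[ℂ] B :=
  RingQuot.liftAlgHom ℂ ⟨TensorAlgebra.lift ℂ f, by
    rintro _ _ ⟨r, hr⟩
    rw [map_zero, ← hf r hr]
    simp only [quad, LinearMap.comp_apply]
    generalize Coalgebra.comul (R := ℂ) r = t
    induction t with
    | zero => simp
    | add x y hx hy => simp only [map_add, hx, hy]
    | tmul x y => simp⟩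

@[simp] lemma extLift_inc {B : Type*} [Semiring B] [Algebra ℂ B] (f : Γ.Inv →ₗ[ℂ] B)
    (hf : ∀ r ∈ Γ.ideal, LinearMap.mul' ℂ B (TensorProduct.map (f ∘ₗ Γ.pi) (f ∘ₗ Γ.pi)
        (Coalgebra.comul (R := ℂ) r)) = 0) (x : Γ.Inv) : Γ.extLift f hf (Γ.inc x) = f x := by
  refine (RingQuot.liftAlgHom_mkAlgHom_apply ℂ _ _ _).trans ?_
  simp

/-- The map `Γ_inv → Γ_inv^∧`, `d π(a) = - π(a₁) π(a₂)`. -/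
def dGen : Γ.Inv →ₗ[ℂ] Γ.InvExt :=
  Γ.invLift (-(LinearMap.mul' ℂ _ ∘ₗ TensorProduct.map (Γ.inc ∘ₗ Γ.pi) (Γ.inc ∘ₗ Γ.pi)
      ∘ₗ Coalgebra.comul))
    (by simp [Bialgebra.comul_one, Algebra.TensorProduct.one_def, Γ.pi_one])
    (fun r hr => by
      rw [LinearMap.neg_apply, LinearMap.comp_apply, LinearMap.comp_apply, Γ.inc_quad hr, neg_zero])

lemma dGen_pi (a : A) : Γ.dGen (Γ.pi a) = - LinearMap.mul' ℂ _
    (TensorProduct.map (Γ.inc ∘ₗ Γ.pi) (Γ.inc ∘ₗ Γ.pi) (Coalgebra.comul (R := ℂ) a)) := by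
  simp [dGen]

/-- Auxiliary homomorphism `x ↦ [[(-1)^∂x x, d x], [0, x]]`, which encodes the graded Leibniz
rule. -/
def dMatrixGen : Γ.Inv →ₗ[ℂ] Matrix (Fin 2) (Fin 2) Γ.InvExt where
  toFun x := !![-Γ.inc x, Γ.dGen x; 0, Γ.inc x]
  map_add' x y := by
    ext i j; fin_cases i <;> fin_cases j <;> simp [add_comm]
  map_smul' c x := by
    ext i j; fin_cases i <;> fin_cases j <;> simp

lemma dMatrix_aux (a : A) :
    LinearMap.mul' ℂ _ (TensorProduct.map (Γ.dMatrixGen ∘ₗ Γ.pi) (Γ.dMatrixGen ∘ₗ Γ.pi)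
        (Coalgebra.comul (R := ℂ) a)) =
    !![LinearMap.mul' ℂ Γ.InvExt (TensorProduct.map (Γ.inc ∘ₗ Γ.pi) (Γ.inc ∘ₗ Γ.pi)
        (Coalgebra.comul (R := ℂ) a)), 0; 0,
      LinearMap.mul' ℂ Γ.InvExt (TensorProduct.map (Γ.inc ∘ₗ Γ.pi) (Γ.inc ∘ₗ Γ.pi)
        (Coalgebra.comul (R := ℂ) a))] := by
  have key : ∀ t : A ⊗[ℂ] A,
      LinearMap.mul' ℂ _ (TensorProduct.map (Γ.dMatrixGen ∘ₗ Γ.pi) (Γ.dMatrixGen ∘ₗ Γ.pi) t) =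
      !![LinearMap.mul' ℂ Γ.InvExt (TensorProduct.map (Γ.inc ∘ₗ Γ.pi) (Γ.inc ∘ₗ Γ.pi) t),
        LinearMap.mul' ℂ Γ.InvExt (TensorProduct.map (Γ.dGen ∘ₗ Γ.pi) (Γ.inc ∘ₗ Γ.pi) t)
        - LinearMap.mul' ℂ Γ.InvExt (TensorProduct.map (Γ.inc ∘ₗ Γ.pi) (Γ.dGen ∘ₗ Γ.pi) t); 0,
      LinearMap.mul' ℂ Γ.InvExt (TensorProduct.map (Γ.inc ∘ₗ Γ.pi) (Γ.inc ∘ₗ Γ.pi) t)] := by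
    intro t
    induction t with
    | zero => ext i j; fin_cases i <;> fin_cases j <;> simp
    | add x y hx hy =>
      simp only [map_add, hx, hy]
      ext i j; fin_cases i <;> fin_cases j <;> simp [sub_eq_add_neg] ; abel
    | tmul x y =>
      ext i j; fin_cases i <;> fin_cases j <;>
        simp [dMatrixGen, Matrix.mul_apply, Fin.sum_univ_two, sub_eq_add_neg, add_comm]
  rw [key]
  congr 1
  have hd : Γ.dGen ∘ₗ Γ.pi = -(LinearMap.mul' ℂ _ ∘ₗ
      TensorProduct.map (Γ.inc ∘ₗ Γ.pi) (Γ.inc ∘ₗ Γ.pi) ∘ₗ Coalgebra.comul) := by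
    ext a; simp [dGen_pi]
  have h1 : ∀ t : A ⊗[ℂ] A, LinearMap.mul' ℂ Γ.InvExt
      (TensorProduct.map (Γ.dGen ∘ₗ Γ.pi) (Γ.inc ∘ₗ Γ.pi) t) =
      - LinearMap.mul' ℂ Γ.InvExt (TensorProduct.map (Γ.inc ∘ₗ Γ.pi)
        (LinearMap.mul' ℂ Γ.InvExt ∘ₗ TensorProduct.map (Γ.inc ∘ₗ Γ.pi) (Γ.inc ∘ₗ Γ.pi))
        (TensorProduct.assoc ℂ A A A ((Coalgebra.comul (R := ℂ)).rTensor A t))) := by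
    intro t
    induction t with
    | zero => simp
    | add x y hx hy => simp only [map_add, hx, hy]; abel
    | tmul x y =>
      simp only [hd, TensorProduct.map_tmul, LinearMap.neg_apply, LinearMap.rTensor_tmul,
        LinearMap.comp_apply, LinearMap.mul'_apply]
      generalize Coalgebra.comul (R := ℂ) x = s
      induction s with
      | zero => simp
      | add x y hx hy => simp only [map_add, TensorProduct.add_tmul, neg_add, add_mul, hx, hy]
      | tmul x y => simp [mul_assoc]
  have h2 : ∀ t : A ⊗[ℂ] A, LinearMap.mul' ℂ Γ.InvExt
      (TensorProduct.map (Γ.inc ∘ₗ Γ.pi) (Γ.dGen ∘ₗ Γ.pi) t) =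
      - LinearMap.mul' ℂ Γ.InvExt (TensorProduct.map (Γ.inc ∘ₗ Γ.pi)
        (LinearMap.mul' ℂ Γ.InvExt ∘ₗ TensorProduct.map (Γ.inc ∘ₗ Γ.pi) (Γ.inc ∘ₗ Γ.pi))
        ((Coalgebra.comul (R := ℂ)).lTensor A t)) := by
    intro t
    induction t with
    | zero => simp
    | add x y hx hy => simp only [map_add, hx, hy]; abel
    | tmul x y => simp [hd]
  rw [h1, h2, Coalgebra.coassoc_apply, sub_self]

def dMatrix : Γ.InvExt →ₐ[ℂ] Matrix (Fin 2) (Fin 2) Γ.InvExt :=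
  Γ.extLift Γ.dMatrixGen fun r hr => by
    rw [dMatrix_aux, Γ.inc_quad hr]
    ext i j; fin_cases i <;> fin_cases j <;> simp

/-- The differential of `Γ_inv^∧`: the graded derivation with `d π(a) = - π(a₁) π(a₂)`. -/
def dInv : Γ.InvExt →ₗ[ℂ] Γ.InvExt where
  toFun x := Γ.dMatrix x 0 1
  map_add' x y := by simp
  map_smul' c x := by simp

/-- The map `Γ_inv → Hom(A, Γ_inv^∧)`, `ϑ ↦ (a ↦ ϑ ∘ a)`. -/
def actGen : Γ.Inv →ₗ[ℂ] WithConv (A →ₗ[ℂ] Γ.InvExt) :=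
  (WithConv.linearEquiv ℂ (A →ₗ[ℂ] Γ.InvExt)).symm.toLinearMap ∘ₗ Γ.circ.compr₂ Γ.inc

/-- The right action `∘` of `A` on `Γ_inv^∧`: `1 ∘ a = ε(a) 1`,
`(ϑ η) ∘ a = (ϑ ∘ a₁) (η ∘ a₂)`; the two rules say that `ϑ ↦ (a ↦ ϑ ∘ a)` is a unital
homomorphism into the convolution algebra of linear maps from `A` to `Γ_inv^∧`. -/
def actHom : Γ.InvExt →ₐ[ℂ] WithConv (A →ₗ[ℂ] Γ.InvExt) :=
  Γ.extLift Γ.actGen (by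
    intro r hr
    have key : ∀ t s : A ⊗[ℂ] A, ∀ a : A, Coalgebra.comul (R := ℂ) a = s →
        (LinearMap.mul' ℂ _ (TensorProduct.map (Γ.actGen ∘ₗ Γ.pi) (Γ.actGen ∘ₗ Γ.pi) t)).ofConv a
        = Γ.quadExt (t * s)
          - Γ.quadExt ((1 ⊗ₜ TensorProduct.lid ℂ A (Coalgebra.counit.rTensor A t)) * s)
          - Γ.quadExt ((TensorProduct.rid ℂ A (Coalgebra.counit.lTensor A t) ⊗ₜ 1) * s)
          + Coalgebra.counit (R := ℂ) (TensorProduct.lid ℂ A (Coalgebra.counit.rTensor A t))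
            • Γ.quadExt s := by
      intro t s a ha
      induction t with
      | zero => simp
      | add x y hx hy =>
        simp only [map_add, WithConv.ofConv_add, LinearMap.add_apply, hx, hy, add_mul,
          TensorProduct.tmul_add, TensorProduct.add_tmul, add_smul]
        abel
      | tmul x y =>
        simp only [TensorProduct.map_tmul, LinearMap.mul'_apply, LinearMap.comp_apply]
        rw [LinearMap.convMul_def, WithConv.ofConv_toConv, LinearMap.comp_apply,
          LinearMap.comp_apply, ha]
        clear ha
        induction s with
        | zero => simp
        | add x y hx hy => simp only [map_add, hx, hy, mul_add, smul_add]; abel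
        | tmul b c =>
          simp [actGen, quadExt, circ_pi, sub_mul, mul_sub]
          module
    have hz : ∀ b : A, Γ.inc (Γ.pi (r * b)) = 0 := fun b => by
      rw [Γ.pi_eq_zero (Γ.ideal_mul_mem r hr b), map_zero]
    apply WithConv.ofConv_injective
    ext a
    rw [key _ _ a rfl, Coalgebra.rTensor_counit_comul, Coalgebra.lTensor_counit_comul]
    have e1 : Γ.quadExt (Coalgebra.comul (R := ℂ) r * Coalgebra.comul (R := ℂ) a) = 0 := by
      rw [← Bialgebra.comul_mul]
      exact Γ.inc_quad (Γ.ideal_mul_mem r hr a)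
    have e2 : ∀ s : A ⊗[ℂ] A, Γ.quadExt ((1 ⊗ₜ r) * s) = 0 := by
      intro s
      induction s with
      | zero => simp
      | add x y hx hy => simp only [mul_add, map_add, hx, hy, add_zero]
      | tmul x y => simp [quadExt, hz]
    have e3 : ∀ s : A ⊗[ℂ] A, Γ.quadExt ((r ⊗ₜ 1) * s) = 0 := by
      intro s
      induction s with
      | zero => simp
      | add x y hx hy => simp only [mul_add, map_add, hx, hy, add_zero]
      | tmul x y => simp [quadExt, hz]
    simp [e1, e2, e3, Γ.counit_eq_zero r hr])

/-- `ϑ ∘ a`. -/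
def act (x : Γ.InvExt) : A →ₗ[ℂ] Γ.InvExt := (Γ.actHom x).ofConv

/-! ### The universal envelope `Γ^∧` -/

/-- The map `A ⊗ A → Γ = A ⊗ Γ_inv`, `a ⊗ b ↦ a db = a b₁ π(b₂)`. -/
def formMap : A ⊗[ℂ] A →ₗ[ℂ] A ⊗[ℂ] Γ.Inv :=
  TensorProduct.map (LinearMap.mul' ℂ A) Γ.pi ∘ₗ (TensorProduct.assoc ℂ A A A).symm.toLinearMap
    ∘ₗ (Coalgebra.comul (R := ℂ) (A := A)).lTensor A

/-- The generators `a` of the envelope, in the tensor algebra of `A × A`; the pair `(a, b)` stands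
for `a + db`. -/
def gen : A →ₗ[ℂ] TensorAlgebra ℂ (A × A) := TensorAlgebra.ι ℂ ∘ₗ LinearMap.inl ℂ A A

/-- The generators `da` of the envelope. -/
def dgen : A →ₗ[ℂ] TensorAlgebra ℂ (A × A) := TensorAlgebra.ι ℂ ∘ₗ LinearMap.inr ℂ A A

/-- The defining relations of `Γ^∧`: `A` is a unital subalgebra, `d` satisfies the Leibniz rule,
and `∑ aₖ dbₖ = 0` in `Γ` implies `∑ aₖ dbₖ = 0` and `∑ daₖ dbₖ = 0`. -/
inductive EnvRel : TensorAlgebra ℂ (A × A) → TensorAlgebra ℂ (A × A) → Prop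
  | one : EnvRel (gen 1) 1
  | mul (a b : A) : EnvRel (gen (a * b)) (gen a * gen b)
  | leibniz (a b : A) : EnvRel (dgen (a * b)) (dgen a * gen b + gen a * dgen b)
  | form (t : A ⊗[ℂ] A) (ht : Γ.formMap t = 0) :
      EnvRel (LinearMap.mul' ℂ _ (TensorProduct.map gen dgen t)) 0
  | dform (t : A ⊗[ℂ] A) (ht : Γ.formMap t = 0) :
      EnvRel (LinearMap.mul' ℂ _ (TensorProduct.map dgen dgen t)) 0

/-- The universal differential envelope `Γ^∧` of the first-order calculus. -/
def Env : Type _ := RingQuot Γ.EnvRel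

instance : Ring Γ.Env := inferInstanceAs (Ring (RingQuot Γ.EnvRel))

instance : Algebra ℂ Γ.Env := inferInstanceAs (Algebra ℂ (RingQuot Γ.EnvRel))

def envMk : TensorAlgebra ℂ (A × A) →ₐ[ℂ] Γ.Env := RingQuot.mkAlgHom ℂ Γ.EnvRel

lemma envMk_surjective : Function.Surjective Γ.envMk := RingQuot.mkAlgHom_surjective ℂ Γ.EnvRel

lemma envMk_rel {x y : TensorAlgebra ℂ (A × A)} (h : Γ.EnvRel x y) : Γ.envMk x = Γ.envMk y :=
  RingQuot.mkAlgHom_rel ℂ h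

/-- The inclusion `A → Γ^∧`. -/
def incA : A →ₐ[ℂ] Γ.Env :=
  AlgHom.ofLinearMap (Γ.envMk.toLinearMap ∘ₗ gen)
    ((Γ.envMk_rel EnvRel.one).trans (map_one _))
    (fun a b => (Γ.envMk_rel (EnvRel.mul a b)).trans (map_mul _ _ _))

/-- The differential `A → Γ ⊆ Γ^∧`. -/
def dA : A →ₗ[ℂ] Γ.Env := Γ.envMk.toLinearMap ∘ₗ dgen

lemma dA_mul (a b : A) : Γ.dA (a * b) = Γ.dA a * Γ.incA b + Γ.incA a * Γ.dA b :=
  (Γ.envMk_rel (EnvRel.leibniz a b)).trans (by rw [map_add, map_mul, map_mul]; rfl)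

lemma dA_one : Γ.dA 1 = 0 := by
  have h := Γ.dA_mul 1 1
  simpa using h

lemma envMk_map (f g : A →ₗ[ℂ] TensorAlgebra ℂ (A × A)) (t : A ⊗[ℂ] A) :
    Γ.envMk (LinearMap.mul' ℂ _ (TensorProduct.map f g t)) =
      LinearMap.mul' ℂ _ (TensorProduct.map (Γ.envMk.toLinearMap ∘ₗ f)
        (Γ.envMk.toLinearMap ∘ₗ g) t) := by
  induction t with
  | zero => simp
  | add x y hx hy => simp only [map_add, hx, hy]
  | tmul x y => simp

lemma env_form {t : A ⊗[ℂ] A} (ht : Γ.formMap t = 0) :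
    LinearMap.mul' ℂ _ (TensorProduct.map Γ.incA.toLinearMap Γ.dA t) = 0 := by
  have := Γ.envMk_rel (EnvRel.form t ht)
  rwa [envMk_map, map_zero] at this

lemma env_dform {t : A ⊗[ℂ] A} (ht : Γ.formMap t = 0) :
    LinearMap.mul' ℂ _ (TensorProduct.map Γ.dA Γ.dA t) = 0 := by
  have := Γ.envMk_rel (EnvRel.dform t ht)
  rwa [envMk_map, map_zero] at this

/-- Algebra homomorphisms out of `Γ^∧`. -/
def envLift {B : Type*} [Semiring B] [Algebra ℂ B] (f : A →ₐ[ℂ] B) (g : A →ₗ[ℂ] B)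
    (hL : ∀ a b, g (a * b) = g a * f b + f a * g b)
    (h1 : ∀ t, Γ.formMap t = 0 →
      LinearMap.mul' ℂ B (TensorProduct.map f.toLinearMap g t) = 0)
    (h2 : ∀ t, Γ.formMap t = 0 → LinearMap.mul' ℂ B (TensorProduct.map g g t) = 0) :
    Γ.Env →ₐ[ℂ] B :=
  RingQuot.liftAlgHom ℂ ⟨TensorAlgebra.lift ℂ (f.toLinearMap.coprod g), by
    have key : ∀ (p q : A →ₗ[ℂ] TensorAlgebra ℂ (A × A)) (t : A ⊗[ℂ] A),
        TensorAlgebra.lift ℂ (f.toLinearMap.coprod g)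
          (LinearMap.mul' ℂ _ (TensorProduct.map p q t)) =
        LinearMap.mul' ℂ B (TensorProduct.map
          ((TensorAlgebra.lift ℂ (f.toLinearMap.coprod g)).toLinearMap ∘ₗ p)
          ((TensorAlgebra.lift ℂ (f.toLinearMap.coprod g)).toLinearMap ∘ₗ q) t) := by
      intro p q t
      induction t with
      | zero => simp
      | add x y hx hy => simp only [map_add, hx, hy]
      | tmul x y => simp
    have e1 : (TensorAlgebra.lift ℂ (f.toLinearMap.coprod g)).toLinearMap ∘ₗ gen
        = f.toLinearMap := by ext a; simp [gen]
    have e2 : (TensorAlgebra.lift ℂ (f.toLinearMap.coprod g)).toLinearMap ∘ₗ dgen = g := by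
      ext a; simp [dgen]
    rintro _ _ (_ | ⟨a, b⟩ | ⟨a, b⟩ | ⟨t, ht⟩ | ⟨t, ht⟩)
    · simp [gen]
    · simp [gen]
    · simp [gen, dgen, hL]
    · rw [key, e1, e2, h1 t ht, map_zero]
    · rw [key, e2, h2 t ht, map_zero]⟩

section envLift

variable {B : Type*} [Semiring B] [Algebra ℂ B] (f : A →ₐ[ℂ] B) (g : A →ₗ[ℂ] B)
    (hL : ∀ a b, g (a * b) = g a * f b + f a * g b)
    (h1 : ∀ t, Γ.formMap t = 0 →
      LinearMap.mul' ℂ B (TensorProduct.map f.toLinearMap g t) = 0)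
    (h2 : ∀ t, Γ.formMap t = 0 → LinearMap.mul' ℂ B (TensorProduct.map g g t) = 0)

@[simp] lemma envLift_incA (a : A) : Γ.envLift f g hL h1 h2 (Γ.incA a) = f a := by
  refine (RingQuot.liftAlgHom_mkAlgHom_apply ℂ _ _ _).trans ?_
  simp [gen]

@[simp] lemma envLift_dA (a : A) : Γ.envLift f g hL h1 h2 (Γ.dA a) = g a := by
  refine (RingQuot.liftAlgHom_mkAlgHom_apply ℂ _ _ _).trans ?_
  simp [dgen]

end envLift

lemma env_adjoin :
    Algebra.adjoin ℂ (Set.range Γ.incA ∪ Set.range Γ.dA) = ⊤ := by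
  rw [eq_top_iff]
  rintro x -
  obtain ⟨y, rfl⟩ := Γ.envMk_surjective x
  induction y using TensorAlgebra.induction with
  | algebraMap r => rw [AlgHom.commutes]; exact Subalgebra.algebraMap_mem _ r
  | ι p =>
    have : Γ.envMk (TensorAlgebra.ι ℂ p) = Γ.incA p.1 + Γ.dA p.2 := by
      have e : TensorAlgebra.ι ℂ p = gen p.1 + dgen p.2 := by
        simp [gen, dgen, ← map_add]
      rw [e, map_add]; rfl
    rw [this]
    exact add_mem (Algebra.subset_adjoin (Or.inl ⟨_, rfl⟩))
      (Algebra.subset_adjoin (Or.inr ⟨_, rfl⟩))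
  | mul a b ha hb => rw [map_mul]; exact mul_mem ha hb
  | add a b ha hb => rw [map_add]; exact add_mem ha hb

/-- The projection `p_* : Γ^∧ → A` onto the degree zero part. -/
def pStar : Γ.Env →ₐ[ℂ] A :=
  Γ.envLift (AlgHom.id ℂ A) 0 (by simp) (by simp) (by simp)

lemma pStar_incA (a : A) : Γ.pStar (Γ.incA a) = a := by simp [pStar]

lemma pStar_dA (a : A) : Γ.pStar (Γ.dA a) = 0 := by simp [pStar]

lemma incA_injective : Function.Injective Γ.incA :=
  Function.LeftInverse.injective Γ.pStar_incA

/-- Auxiliary homomorphism `A → M₂(Γ^∧)`, `a ↦ [[a, da], [0, a]]`. -/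
def envMatA : A →ₐ[ℂ] Matrix (Fin 2) (Fin 2) Γ.Env :=
  AlgHom.ofLinearMap
    { toFun := fun a => !![Γ.incA a, Γ.dA a; 0, Γ.incA a]
      map_add' := fun x y => by ext i j; fin_cases i <;> fin_cases j <;> simp
      map_smul' := fun c x => by ext i j; fin_cases i <;> fin_cases j <;> simp }
    (by ext i j; fin_cases i <;> fin_cases j <;> simp [dA_one])
    (fun a b => by
      ext i j; fin_cases i <;> fin_cases j <;> simp [dA_mul, add_comm])

/-- Auxiliary map `A → M₂(Γ^∧)`, `a ↦ [[-da, 0], [0, da]]`. -/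
def envMatD : A →ₗ[ℂ] Matrix (Fin 2) (Fin 2) Γ.Env where
  toFun := fun a => !![-Γ.dA a, 0; 0, Γ.dA a]
  map_add' := fun x y => by ext i j; fin_cases i <;> fin_cases j <;> simp [add_comm]
  map_smul' := fun c x => by ext i j; fin_cases i <;> fin_cases j <;> simp

lemma envMat_form (t : A ⊗[ℂ] A) :
    LinearMap.mul' ℂ _ (TensorProduct.map Γ.envMatA.toLinearMap Γ.envMatD t) =
      !![-LinearMap.mul' ℂ _ (TensorProduct.map Γ.incA.toLinearMap Γ.dA t),
        LinearMap.mul' ℂ _ (TensorProduct.map Γ.dA Γ.dA t); 0,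
        LinearMap.mul' ℂ _ (TensorProduct.map Γ.incA.toLinearMap Γ.dA t)] := by
  induction t with
  | zero => ext i j; fin_cases i <;> fin_cases j <;> simp
  | add x y hx hy =>
    simp only [map_add, hx, hy]
    ext i j; fin_cases i <;> fin_cases j <;> simp [add_comm]
  | tmul x y =>
    ext i j; fin_cases i <;> fin_cases j <;> simp [envMatA, envMatD]

lemma envMat_dform (t : A ⊗[ℂ] A) :
    LinearMap.mul' ℂ _ (TensorProduct.map Γ.envMatD Γ.envMatD t) =
      !![LinearMap.mul' ℂ _ (TensorProduct.map Γ.dA Γ.dA t), 0; 0,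
        LinearMap.mul' ℂ _ (TensorProduct.map Γ.dA Γ.dA t)] := by
  induction t with
  | zero => ext i j; fin_cases i <;> fin_cases j <;> simp
  | add x y hx hy =>
    simp only [map_add, hx, hy]
    ext i j; fin_cases i <;> fin_cases j <;> simp
  | tmul x y =>
    ext i j; fin_cases i <;> fin_cases j <;> simp [envMatD]

/-- Auxiliary homomorphism `x ↦ [[(-1)^∂x x, d x], [0, x]]`, which encodes the graded Leibniz
rule. -/
def envDMatrix : Γ.Env →ₐ[ℂ] Matrix (Fin 2) (Fin 2) Γ.Env :=
  Γ.envLift Γ.envMatA Γ.envMatD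
    (fun a b => by
      ext i j; fin_cases i <;> fin_cases j <;> simp [envMatA, envMatD, dA_mul, add_comm])
    (fun t ht => by
      rw [envMat_form, Γ.env_form ht, Γ.env_dform ht]
      ext i j; fin_cases i <;> fin_cases j <;> simp)
    (fun t ht => by
      rw [envMat_dform, Γ.env_dform ht]
      ext i j; fin_cases i <;> fin_cases j <;> simp)

/-- The differential of `Γ^∧`: the graded derivation of degree one and square zero that extends
`A → Γ`. -/
def dEnv : Γ.Env →ₗ[ℂ] Γ.Env where
  toFun x := Γ.envDMatrix x 0 1
  map_add' x y := by simp
  map_smul' c x := by simp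

lemma dEnv_incA (a : A) : Γ.dEnv (Γ.incA a) = Γ.dA a := by
  simp [dEnv, envDMatrix, envMatA]

lemma dEnv_dA (a : A) : Γ.dEnv (Γ.dA a) = 0 := by
  simp [dEnv, envDMatrix, envMatD]

/-! ### The grading of `Γ^∧` -/

/-- The homomorphism `Γ^∧ → Γ^∧[X]` that multiplies elements of degree `n` by `X ^ n`. -/
def degHom : Γ.Env →ₐ[ℂ] Polynomial Γ.Env :=
  Γ.envLift (Polynomial.CAlgHom.comp Γ.incA)
    ((Polynomial.monomial 1).restrictScalars ℂ ∘ₗ Γ.dA)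
    (fun a b => by
      simp [dA_mul, ← Polynomial.C_mul_X_pow_eq_monomial, add_mul, mul_assoc])
    (fun t ht => by
      have : ∀ t : A ⊗[ℂ] A, LinearMap.mul' ℂ _ (TensorProduct.map
          (Polynomial.CAlgHom.comp Γ.incA).toLinearMap
          ((Polynomial.monomial 1).restrictScalars ℂ ∘ₗ Γ.dA) t) =
          Polynomial.monomial 1 (LinearMap.mul' ℂ _
            (TensorProduct.map Γ.incA.toLinearMap Γ.dA t)) := by
        intro t
        induction t with
        | zero => simp
        | add x y hx hy => simp only [map_add, hx, hy]
        | tmul x y => simp [Polynomial.C_mul_monomial]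
      rw [this, Γ.env_form ht, map_zero])
    (fun t ht => by
      have : ∀ t : A ⊗[ℂ] A, LinearMap.mul' ℂ _ (TensorProduct.map
          ((Polynomial.monomial 1).restrictScalars ℂ ∘ₗ Γ.dA)
          ((Polynomial.monomial 1).restrictScalars ℂ ∘ₗ Γ.dA) t) =
          Polynomial.monomial 2 (LinearMap.mul' ℂ _ (TensorProduct.map Γ.dA Γ.dA t)) := by
        intro t
        induction t with
        | zero => simp
        | add x y hx hy => simp only [map_add, hx, hy]
        | tmul x y => simp [Polynomial.monomial_mul_monomial]
      rw [this, Γ.env_dform ht, map_zero])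

/-- The homogeneous part of degree `n` of `Γ^∧`. -/
def envGrading (n : ℕ) : Submodule ℂ Γ.Env :=
  LinearMap.ker (Γ.degHom.toLinearMap - (Polynomial.monomial n).restrictScalars ℂ)

lemma mem_envGrading {n : ℕ} {x : Γ.Env} :
    x ∈ Γ.envGrading n ↔ Γ.degHom x = Polynomial.monomial n x := by
  simp [envGrading, sub_eq_zero]

lemma incA_mem (a : A) : Γ.incA a ∈ Γ.envGrading 0 := by
  simp [mem_envGrading, degHom]

lemma dA_mem (a : A) : Γ.dA a ∈ Γ.envGrading 1 := by
  simp [mem_envGrading, degHom]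

instance : SetLike.GradedMonoid Γ.envGrading where
  one_mem := by simpa using Γ.incA_mem 1
  mul_mem i j x y hx hy := by
    rw [mem_envGrading] at *
    rw [map_mul, hx, hy, Polynomial.monomial_mul_monomial]

lemma coeff_degHom_mem (x : Γ.Env) :
    (∀ n, (Γ.degHom x).coeff n ∈ Γ.envGrading n) ∧ (Γ.degHom x).eval 1 = x := by
  have hx : x ∈ Algebra.adjoin ℂ (Set.range Γ.incA ∪ Set.range Γ.dA) := by
    rw [env_adjoin]; trivial
  have hom : ∀ (m : ℕ) (y : Γ.Env), y ∈ Γ.envGrading m →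
      (∀ n, (Γ.degHom y).coeff n ∈ Γ.envGrading n) ∧ (Γ.degHom y).eval 1 = y := by
    intro m y hy
    rw [Γ.mem_envGrading.1 hy]
    refine ⟨fun n => ?_, by simp⟩
    rw [Polynomial.coeff_monomial]
    split_ifs with h
    · exact h ▸ hy
    · exact zero_mem _
  induction hx using Algebra.adjoin_induction with
  | mem y hy =>
    rcases hy with ⟨a, rfl⟩ | ⟨a, rfl⟩
    · exact hom 0 _ (Γ.incA_mem a)
    · exact hom 1 _ (Γ.dA_mem a)
  | algebraMap r =>
    refine hom 0 _ ?_
    rw [← Γ.incA.commutes r]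
    exact Γ.incA_mem _
  | add y z _ _ hy hz =>
    rw [map_add]
    refine ⟨fun n => ?_, by rw [Polynomial.eval_add, hy.2, hz.2]⟩
    rw [Polynomial.coeff_add]
    exact add_mem (hy.1 n) (hz.1 n)
  | mul y z _ _ hy hz =>
    rw [map_mul]
    refine ⟨fun n => ?_, ?_⟩
    · rw [Polynomial.coeff_mul]
      refine sum_mem fun p hp => ?_
      rw [← (Finset.HasAntidiagonal.mem_antidiagonal.1 hp : p.1 + p.2 = n)]
      exact SetLike.mul_mem_graded (hy.1 _) (hz.1 _)
    · rw [Polynomial.eval, Polynomial.eval₂_mul_noncomm _ _ fun k => Commute.one_right _]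
      exact congrArg₂ (· * ·) hy.2 hz.2

/-- The homogeneous components of an element of `Γ^∧`. -/
def envDecompose (x : Γ.Env) : DirectSum ℕ fun n => Γ.envGrading n :=
  ∑ n ∈ (Γ.degHom x).support,
    DirectSum.of (fun n => Γ.envGrading n) n ⟨(Γ.degHom x).coeff n, (Γ.coeff_degHom_mem x).1 n⟩

lemma envDecompose_apply (x : Γ.Env) (n : ℕ) :
    (Γ.envDecompose x n : Γ.Env) = (Γ.degHom x).coeff n := by
  rw [envDecompose, DFinsupp.finsetSum_apply, AddSubmonoidClass.coe_finsetSum,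
    Finset.sum_eq_single n]
  · rw [DirectSum.of_eq_same]
  · intro m _ hm
    rw [DirectSum.of_eq_of_ne _ _ _ hm.symm]; rfl
  · intro h
    rw [DirectSum.of_eq_same]
    exact Polynomial.notMem_support_iff.1 h

instance : DirectSum.Decomposition Γ.envGrading where
  decompose' := Γ.envDecompose
  left_inv x := by
    conv_rhs => rw [← (Γ.coeff_degHom_mem x).2]
    rw [envDecompose, map_sum, Polynomial.eval_eq_sum, Polynomial.sum]
    refine Finset.sum_congr rfl fun n _ => ?_
    rw [DirectSum.coeAddMonoidHom_of, one_pow, mul_one]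
  right_inv x := by
    refine DFinsupp.ext fun n => Subtype.ext ?_
    rw [envDecompose_apply]
    induction x using DirectSum.induction_on with
    | zero => simp
    | of i y =>
      rw [DirectSum.coeAddMonoidHom_of, Γ.mem_envGrading.1 y.2, Polynomial.coeff_monomial]
      split_ifs with h
      · subst h; rw [DirectSum.of_eq_same]
      · rw [DirectSum.of_eq_of_ne _ _ _ (Ne.symm h)]; rfl
    | add y z hy hz =>
      rw [map_add, map_add, Polynomial.coeff_add, hy, hz]; rfl

instance : GradedAlgebra Γ.envGrading where

/-! ### The right action of the quantum group on `Γ^∧` -/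

/-! ### The right action of the quantum group on `Γ^∧` -/

/-- The right coaction on `Γ = A ⊗ Γ_inv`. -/
def formCoaction : A ⊗[ℂ] Γ.Inv →ₗ[ℂ] (A ⊗[ℂ] Γ.Inv) ⊗[ℂ] A :=
  (LinearMap.mul' ℂ A).lTensor (A ⊗[ℂ] Γ.Inv)
    ∘ₗ (TensorProduct.tensorTensorTensorComm ℂ A A Γ.Inv A).toLinearMap
    ∘ₗ TensorProduct.map Coalgebra.comul Γ.varpi

lemma formMap_codiag (t : A ⊗[ℂ] A) :
    Γ.formMap.rTensor A (codiag t) = Γ.formCoaction (Γ.formMap t) := by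
  induction t with
  | zero => simp
  | add x y hx hy => simp only [map_add, hx, hy]
  | tmul a b =>
    let M : (A ⊗[ℂ] A) ⊗[ℂ] (A ⊗[ℂ] (A ⊗[ℂ] A)) →ₗ[ℂ] (A ⊗[ℂ] Γ.Inv) ⊗[ℂ] A :=
      TensorProduct.map (TensorProduct.map (LinearMap.mul' ℂ A) Γ.pi
          ∘ₗ (TensorProduct.assoc ℂ A A A).symm.toLinearMap) (LinearMap.mul' ℂ A)
        ∘ₗ (TensorProduct.tensorTensorTensorComm ℂ A A (A ⊗[ℂ] A) A).toLinearMap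
        ∘ₗ (TensorProduct.assoc ℂ A A A).symm.toLinearMap.lTensor (A ⊗[ℂ] A)
    have hL : ∀ c s : A ⊗[ℂ] A,
        Γ.formMap.rTensor A ((LinearMap.mul' ℂ A).lTensor (A ⊗[ℂ] A)
          (TensorProduct.tensorTensorTensorComm ℂ A A A A (c ⊗ₜ s))) =
        M (c ⊗ₜ TensorProduct.assoc ℂ A A A ((Coalgebra.comul (R := ℂ)).rTensor A s)) := by
      intro c s
      induction c with
      | zero => simp
      | add x y hx hy => simp only [map_add, TensorProduct.add_tmul, hx, hy]
      | tmul p q =>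
        induction s with
        | zero => simp
        | add x y hx hy => simp only [map_add, TensorProduct.tmul_add, hx, hy]
        | tmul x y =>
          simp only [TensorProduct.tensorTensorTensorComm_tmul, LinearMap.lTensor_tmul,
            LinearMap.rTensor_tmul, LinearMap.mul'_apply, formMap, LinearMap.comp_apply]
          generalize Coalgebra.comul (R := ℂ) x = u
          induction u with
          | zero => simp
          | add x y hx hy =>
            simp only [map_add, TensorProduct.tmul_add, TensorProduct.add_tmul, hx, hy]
          | tmul x z => simp [M]
    have hR : ∀ (c w : A ⊗[ℂ] A) (y : A), (LinearMap.mul' ℂ A).lTensor (A ⊗[ℂ] Γ.Inv)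
        (TensorProduct.tensorTensorTensorComm ℂ A A Γ.Inv A ((c * w) ⊗ₜ Γ.pi.rTensor A (ad A y))) =
        M (c ⊗ₜ adTwist.lTensor A (TensorProduct.assoc ℂ A A A (w ⊗ₜ y))) := by
      intro c w y
      induction c with
      | zero => simp
      | add x y hx hy => simp only [map_add, TensorProduct.add_tmul, add_mul, hx, hy]
      | tmul p q =>
        induction w with
        | zero => simp
        | add x y hx hy => simp only [map_add, TensorProduct.add_tmul, TensorProduct.tmul_add,
            mul_add, hx, hy]
        | tmul x z =>
          simp only [TensorProduct.assoc_tmul, LinearMap.lTensor_tmul, adTwist,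
            TensorProduct.lift.tmul, LinearMap.mk₂_apply]
          generalize ad A y = v
          induction v with
          | zero => simp
          | add x y hx hy => simp only [map_add, TensorProduct.tmul_add, mul_add, hx, hy]
          | tmul x z => simp [M, mul_assoc]
    have hR' : ∀ s : A ⊗[ℂ] A, Γ.formCoaction (TensorProduct.map (LinearMap.mul' ℂ A) Γ.pi
        ((TensorProduct.assoc ℂ A A A).symm (a ⊗ₜ s))) =
        M (Coalgebra.comul (R := ℂ) a ⊗ₜ adTwist.lTensor A (TensorProduct.assoc ℂ A A A
          ((Coalgebra.comul (R := ℂ)).rTensor A s))) := by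
      intro s
      induction s with
      | zero => simp
      | add x y hx hy => simp only [map_add, TensorProduct.tmul_add, hx, hy]
      | tmul x y =>
        rw [LinearMap.rTensor_tmul, ← hR, ← varpi_pi, ← Bialgebra.comul_mul]
        simp [formCoaction]
    have hR'' : Γ.formCoaction (Γ.formMap (a ⊗ₜ b)) = M (Coalgebra.comul (R := ℂ) a ⊗ₜ
        adTwist.lTensor A (TensorProduct.assoc ℂ A A A
          ((Coalgebra.comul (R := ℂ)).rTensor A (Coalgebra.comul (R := ℂ) b)))) := hR' _
    have hA : (adTwist ∘ₗ Coalgebra.comul : A →ₗ[ℂ] A ⊗[ℂ] A) = Coalgebra.comul :=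
      LinearMap.ext adTwist_comul
    rw [hR'', Coalgebra.coassoc_apply, ← LinearMap.lTensor_comp_apply, hA,
      ← Coalgebra.coassoc_apply]
    exact hL _ _

lemma codiag_mem {t : A ⊗[ℂ] A} (ht : Γ.formMap t = 0) :
    codiag t ∈ LinearMap.range ((LinearMap.ker Γ.formMap).subtype.rTensor A) := by
  have h : Γ.formMap.rTensor A (codiag t) = 0 := by rw [formMap_codiag, ht, map_zero]
  exact (Module.Flat.rTensor_exact A (LinearMap.exact_subtype_ker_map Γ.formMap) _).1 h

lemma map_codiag_eq_zero {B : Type*} [Ring B] [Algebra ℂ B] (f g : A →ₗ[ℂ] B)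
    (h : ∀ t, Γ.formMap t = 0 → LinearMap.mul' ℂ B (TensorProduct.map f g t) = 0)
    {t : A ⊗[ℂ] A} (ht : Γ.formMap t = 0) :
    LinearMap.mul' ℂ (B ⊗[ℂ] A) (TensorProduct.map (f.rTensor A ∘ₗ Coalgebra.comul)
      (g.rTensor A ∘ₗ Coalgebra.comul) t) = 0 := by
  have h1 : ∀ t : A ⊗[ℂ] A, LinearMap.mul' ℂ (B ⊗[ℂ] A)
      (TensorProduct.map (f.rTensor A ∘ₗ Coalgebra.comul) (g.rTensor A ∘ₗ Coalgebra.comul) t) =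
      (LinearMap.mul' ℂ B ∘ₗ TensorProduct.map f g).rTensor A (codiag t) := by
    intro t
    induction t with
    | zero => simp
    | add x y hx hy => simp only [map_add, hx, hy]
    | tmul x y =>
      simp only [codiag, TensorProduct.map_tmul, LinearMap.comp_apply, LinearMap.mul'_apply]
      generalize Coalgebra.comul (R := ℂ) x = u
      generalize Coalgebra.comul (R := ℂ) y = v
      induction u with
      | zero => simp
      | add x y hx hy => simp only [map_add, TensorProduct.add_tmul, add_mul, hx, hy]
      | tmul p q =>
        induction v with
        | zero => simp
        | add x y hx hy => simp only [map_add, TensorProduct.tmul_add, mul_add, hx, hy]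
        | tmul x y => simp
  obtain ⟨s, hs⟩ := Γ.codiag_mem ht
  have h0 : (LinearMap.mul' ℂ B ∘ₗ TensorProduct.map f g) ∘ₗ (LinearMap.ker Γ.formMap).subtype
      = 0 := by
    ext x; exact h x.1 x.2
  rw [h1, ← hs, ← LinearMap.rTensor_comp_apply, h0, LinearMap.rTensor_zero,
    LinearMap.zero_apply]

/-- The right action `Γ^∧ → Γ^∧ ⊗ A` of the quantum group on its envelope. -/
def envCoaction : Γ.Env →ₐ[ℂ] Γ.Env ⊗[ℂ] A :=
  Γ.envLift ((Algebra.TensorProduct.map Γ.incA (AlgHom.id ℂ A)).comp (Bialgebra.comulAlgHom ℂ A))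
    (Γ.dA.rTensor A ∘ₗ Coalgebra.comul)
    (fun a b => by
      simp only [LinearMap.comp_apply, AlgHom.comp_apply, Bialgebra.comulAlgHom_apply,
        Bialgebra.comul_mul]
      generalize Coalgebra.comul (R := ℂ) a = u
      generalize Coalgebra.comul (R := ℂ) b = v
      induction u with
      | zero => simp
      | add x y hx hy => simp only [map_add, add_mul, hx, hy]; abel
      | tmul p q =>
        induction v with
        | zero => simp
        | add x y hx hy => simp only [map_add, mul_add, hx, hy]; abel
        | tmul x y => simp [dA_mul, TensorProduct.add_tmul])
    (fun t ht => Γ.map_codiag_eq_zero Γ.incA.toLinearMap Γ.dA (fun _ => Γ.env_form) ht)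
    (fun t ht => Γ.map_codiag_eq_zero Γ.dA Γ.dA (fun _ => Γ.env_dform) ht)

lemma envCoaction_incA (a : A) :
    Γ.envCoaction (Γ.incA a) = Γ.incA.toLinearMap.rTensor A (Coalgebra.comul (R := ℂ) a) :=
  Γ.envLift_incA _ _ _ _ _ a

lemma envCoaction_dA (a : A) :
    Γ.envCoaction (Γ.dA a) = Γ.dA.rTensor A (Coalgebra.comul (R := ℂ) a) :=
  Γ.envLift_dA _ _ _ _ _ a

lemma env_hom_ext {B : Type*} [Semiring B] [Algebra ℂ B] {f g : Γ.Env →ₐ[ℂ] B}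
    (h0 : ∀ a, f (Γ.incA a) = g (Γ.incA a)) (h1 : ∀ a, f (Γ.dA a) = g (Γ.dA a)) : f = g := by
  refine AlgHom.ext_of_adjoin_eq_top Γ.env_adjoin ?_
  rintro _ (⟨a, rfl⟩ | ⟨a, rfl⟩)
  · exact h0 a
  · exact h1 a

lemma pStar_eq_zero {n : ℕ} (hn : n ≠ 0) {x : Γ.Env} (hx : x ∈ Γ.envGrading n) :
    Γ.pStar x = 0 := by
  have h : (Polynomial.CAlgHom (R := ℂ)).comp Γ.pStar
      = (Polynomial.mapAlgHom Γ.pStar).comp Γ.degHom := by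
    refine Γ.env_hom_ext (fun a => ?_) (fun a => ?_)
    · simp [degHom, pStar_incA]
    · simp [degHom, pStar_dA]
  have h2 := DFunLike.congr_fun h x
  simp only [AlgHom.comp_apply, Γ.mem_envGrading.1 hx] at h2
  have h3 := congrArg (fun p => Polynomial.coeff p 0) h2
  simpa [Polynomial.coeff_monomial, hn] using h3

end BicovariantCalculus

end Calculus

/-! ## Graded algebras -/

section Graded

variable {W : Type*} [Ring W] [Algebra ℂ W] (gr : ℕ → Submodule ℂ W) [GradedAlgebra gr]

/-- The grading involution `w ↦ (-1)^∂w w` of a graded algebra. -/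
def gradeInv : W →ₗ[ℂ] W :=
  DirectSum.toModule ℂ ℕ W (fun n => (-1 : ℂ) ^ n • (gr n).subtype)
    ∘ₗ (DirectSum.decomposeLinearEquiv gr).toLinearMap

lemma gradeInv_of_mem {n : ℕ} {w : W} (hw : w ∈ gr n) : gradeInv gr w = (-1 : ℂ) ^ n • w := by
  lift w to gr n using hw
  simp [gradeInv]

lemma gradeInv_mul (v w : W) : gradeInv gr (v * w) = gradeInv gr v * gradeInv gr w := by
  induction v using DirectSum.Decomposition.inductionOn gr with
  | zero => simp
  | add x y hx hy => simp only [add_mul, map_add, hx, hy]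
  | @homogeneous i x =>
    induction w using DirectSum.Decomposition.inductionOn gr with
    | zero => simp
    | add x y hx hy => simp only [mul_add, map_add, hx, hy]
    | @homogeneous j y =>
      rw [gradeInv_of_mem gr x.2, gradeInv_of_mem gr y.2,
        gradeInv_of_mem gr (SetLike.mul_mem_graded x.2 y.2), smul_mul_smul_comm, pow_add]

/-- The grading involution as an algebra homomorphism. -/
def gradeInvHom : W →ₐ[ℂ] W :=
  AlgHom.ofLinearMap (gradeInv gr)
    (by simpa using gradeInv_of_mem gr (SetLike.one_mem_graded gr)) (gradeInv_mul gr)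

end Graded

/-! ## Quantum principal bundles and differential calculi on them -/

/-- A quantum principal bundle `P = (B, i, F)` over the quantum space represented by `V`: `i` is
injective and its image is the fixed-point algebra of the coaction `F`, and the action is free. -/
structure QuantumPrincipalBundle (V B A : Type*) [Ring V] [Algebra ℂ V] [StarRing V]
    [Ring B] [Algebra ℂ B] [StarRing B] [StarModule ℂ B]
    [Ring A] [HopfAlgebra ℂ A] [StarRing A] [StarModule ℂ A] where
  i : V →⋆ₐ[ℂ] B
  F : B →⋆ₐ[ℂ] B ⊗[ℂ] A
  coassoc : ∀ b, TensorProduct.assoc ℂ B A A (F.toAlgHom.toLinearMap.rTensor A (F b))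
    = (Coalgebra.comul (R := ℂ)).lTensor B (F b)
  counit : ∀ b, TensorProduct.rid ℂ B ((Coalgebra.counit (R := ℂ)).lTensor B (F b)) = b
  i_injective : Function.Injective i
  range_i : ∀ b, b ∈ Set.range i ↔ F b = b ⊗ₜ 1
  free : ∀ a : A, (1 : B) ⊗ₜ[ℂ] a ∈
    Submodule.span ℂ (Set.range fun p : B × B => (p.1 ⊗ₜ[ℂ] (1 : A)) * F p.2)

section GradedTensor

open scoped DirectSum

variable {A : Type*} [Ring A] [HopfAlgebra ℂ A] [StarRing A] (Γ : BicovariantCalculus A)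
variable {Ω : Type*} [Ring Ω] [Algebra ℂ Ω] (gr : ℕ → Submodule ℂ Ω) [GradedAlgebra gr]

/-- The graded tensor product `Ω ⊗̂ Γ^∧`. -/
abbrev GT : Type _ := GradedTensorProduct ℂ gr Γ.envGrading

/-- The differential `w ⊗ α ↦ dw ⊗ α + (-1)^∂w w ⊗ dα` of the graded tensor product of `(Ω, d)`
and `Γ^∧`. -/
def dGT (d : Ω →ₗ[ℂ] Ω) : GT Γ gr →ₗ[ℂ] GT Γ gr :=
  (GradedTensorProduct.of ℂ gr Γ.envGrading).toLinearMap
    ∘ₗ (TensorProduct.map d LinearMap.id + TensorProduct.map (gradeInv gr) Γ.dEnv)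
    ∘ₗ (GradedTensorProduct.of ℂ gr Γ.envGrading).symm.toLinearMap

lemma units_smul {M : Type*} [AddCommGroup M] [Module ℂ M] (n : ℕ) (x : M) :
    ((-1 : ℤˣ) ^ n) • x = (-1 : ℂ) ^ n • x := by
  rcases Nat.even_or_odd n with he | ho
  · rw [he.neg_one_pow, he.neg_one_pow, one_smul, one_smul]
  · rw [ho.neg_one_pow, ho.neg_one_pow, neg_smul, one_smul, Units.neg_smul, one_smul]

/-- The product of the graded tensor product. -/
lemma gt_mul {i k : ℕ} (v : Ω) {y : Γ.Env} (hy : y ∈ Γ.envGrading k) {w : Ω} (hw : w ∈ gr i)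
    (z : Γ.Env) :
    (GradedTensorProduct.tmul ℂ v y * GradedTensorProduct.tmul ℂ w z : GT Γ gr) =
      (-1 : ℂ) ^ (k * i) • (GradedTensorProduct.tmul ℂ (v * w) (y * z) : GT Γ gr) :=
  (GradedTensorProduct.tmul_coe_mul_coe_tmul (R := ℂ) gr Γ.envGrading
    v ⟨y, hy⟩ ⟨w, hw⟩ z).trans (units_smul _ _)

/-- The product of the two grading involutions. -/
def invTensor : GT Γ gr →ₐ[ℂ] GT Γ gr :=
  GradedTensorProduct.lift gr Γ.envGrading
    ((GradedTensorProduct.includeLeft gr Γ.envGrading).comp (gradeInvHom gr))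
    ((GradedTensorProduct.includeRight gr Γ.envGrading).comp (gradeInvHom Γ.envGrading))
    (fun i j a b => by
      have h1 : gradeInvHom gr a = (-1 : ℂ) ^ i • (a : Ω) := gradeInv_of_mem gr a.2
      have h2 : gradeInvHom Γ.envGrading b = (-1 : ℂ) ^ j • (b : Γ.Env) :=
        gradeInv_of_mem Γ.envGrading b.2
      rw [units_smul]
      simp only [AlgHom.comp_apply, h1, h2, map_smul, smul_mul_smul_comm]
      have h3 := gt_mul Γ gr 1 b.2 a.2 1
      rw [one_mul, mul_one] at h3
      simp only [GradedTensorProduct.includeLeft_apply, GradedTensorProduct.includeRight_apply]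
      rw [h3, GradedTensorProduct.tmul_one_mul_one_tmul, smul_comm, smul_smul ((-1 : ℂ) ^ (j * i)),
        ← mul_pow]
      simp [mul_comm])

lemma invTensor_of (z : Ω ⊗[ℂ] Γ.Env) : invTensor Γ gr (GradedTensorProduct.of ℂ gr Γ.envGrading z)
    = GradedTensorProduct.of ℂ gr Γ.envGrading
      (TensorProduct.map (gradeInv gr) (gradeInv Γ.envGrading) z) := by
  induction z with
  | zero => simp
  | add x y hx hy => simp only [map_add, hx, hy]
  | tmul x y =>
    exact GradedTensorProduct.tmul_one_mul_one_tmul gr Γ.envGrading _ _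

/-- The inclusion `Ω ⊗ A → Ω ⊗̂ Γ^∧`. -/
def incTensor : Ω ⊗[ℂ] A →ₐ[ℂ] GT Γ gr :=
  Algebra.TensorProduct.lift (GradedTensorProduct.includeLeft gr Γ.envGrading)
    ((GradedTensorProduct.includeRight gr Γ.envGrading).comp Γ.incA) (fun w a => by
      induction w using DirectSum.Decomposition.inductionOn gr with
      | zero => rw [map_zero]; exact Commute.zero_left _
      | add x y hx hy => rw [map_add]; exact hx.add_left hy
      | @homogeneous i x =>
        have h3 := gt_mul Γ gr 1 (Γ.incA_mem a) x.2 1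
        rw [one_mul, mul_one, zero_mul, pow_zero, one_smul] at h3
        exact (GradedTensorProduct.tmul_one_mul_one_tmul gr Γ.envGrading _ _).trans h3.symm)

lemma incTensor_eq (z : Ω ⊗[ℂ] A) : incTensor Γ gr z =
    GradedTensorProduct.of ℂ gr Γ.envGrading (Γ.incA.toLinearMap.lTensor Ω z) := by
  induction z with
  | zero => simp
  | add x y hx hy => simp only [map_add, hx, hy]
  | tmul x y => exact GradedTensorProduct.tmul_one_mul_one_tmul gr Γ.envGrading _ _

/-- The projection `id ⊗ p_* : Ω ⊗̂ Γ^∧ → Ω ⊗ A`. -/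
def projTensor : GT Γ gr →ₐ[ℂ] Ω ⊗[ℂ] A :=
  GradedTensorProduct.lift gr Γ.envGrading Algebra.TensorProduct.includeLeft
    (Algebra.TensorProduct.includeRight.comp Γ.pStar)
    (fun i j a b => by
      rw [units_smul]
      by_cases hj : j = 0
      · subst hj; simp
      · simp [Γ.pStar_eq_zero hj b.2])

lemma projTensor_of (z : Ω ⊗[ℂ] Γ.Env) :
    projTensor Γ gr (GradedTensorProduct.of ℂ gr Γ.envGrading z)
      = Γ.pStar.toLinearMap.lTensor Ω z := by
  induction z with
  | zero => simp
  | add x y hx hy => simp only [map_add, hx, hy]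
  | tmul x y =>
    refine (GradedTensorProduct.lift_tmul gr Γ.envGrading _ _ _ x y).trans ?_
    simp

lemma gradeInv_envCoaction (x : Γ.Env) : (gradeInv Γ.envGrading).rTensor A (Γ.envCoaction x)
    = Γ.envCoaction (gradeInv Γ.envGrading x) := by
  have h : (Algebra.TensorProduct.map (gradeInvHom Γ.envGrading) (AlgHom.id ℂ A)).comp
      Γ.envCoaction = Γ.envCoaction.comp (gradeInvHom Γ.envGrading) := by
    refine Γ.env_hom_ext (fun a => ?_) (fun a => ?_)
    · have h1 : gradeInvHom Γ.envGrading (Γ.incA a) = Γ.incA a :=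
        (gradeInv_of_mem _ (Γ.incA_mem a)).trans (by simp)
      rw [AlgHom.comp_apply, AlgHom.comp_apply, h1, Γ.envCoaction_incA]
      generalize Coalgebra.comul (R := ℂ) a = t
      induction t with
      | zero => simp
      | add x y hx hy => simp only [map_add, hx, hy]
      | tmul x y =>
        have h1 : gradeInvHom Γ.envGrading (Γ.incA x) = Γ.incA x :=
          (gradeInv_of_mem _ (Γ.incA_mem x)).trans (by simp)
        simp [h1]
    · have h1 : ∀ a, gradeInvHom Γ.envGrading (Γ.dA a) = -Γ.dA a := fun a =>
        (gradeInv_of_mem _ (Γ.dA_mem a)).trans (by simp)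
      rw [AlgHom.comp_apply, AlgHom.comp_apply, h1, map_neg, Γ.envCoaction_dA]
      generalize Coalgebra.comul (R := ℂ) a = t
      induction t with
      | zero => simp
      | add x y hx hy => simp only [map_add, hx, hy, neg_add]
      | tmul x y => simp [h1, TensorProduct.neg_tmul]
  exact DFunLike.congr_fun h x

lemma gradeInv_pow {i k : ℕ} {y : Γ.Env} (hy : y ∈ Γ.envGrading k) :
    ((gradeInv Γ.envGrading) ^ i) y = (-1 : ℂ) ^ (k * i) • y := by
  induction i with
  | zero => simp
  | succ i ih =>
    rw [pow_succ', Module.End.mul_apply, ih, map_smul, gradeInv_of_mem _ hy, smul_smul, ← pow_add,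
      Nat.mul_succ]

lemma gradeInv_pow_envCoaction (i : ℕ) (x : Γ.Env) :
    ((gradeInv Γ.envGrading) ^ i).rTensor A (Γ.envCoaction x)
    = Γ.envCoaction (((gradeInv Γ.envGrading) ^ i) x) := by
  induction i with
  | zero => simp [Module.End.one_eq_id]
  | succ i ih =>
    rw [pow_succ', Module.End.mul_eq_comp, LinearMap.rTensor_comp_apply, ih,
      gradeInv_envCoaction]; rfl

/-- The map `id ⊗ ρ : Ω ⊗̂ Γ^∧ → (Ω ⊗̂ Γ^∧) ⊗ A`, with `ρ` the right action on `Γ^∧`. -/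
def coactTensor : GT Γ gr →ₐ[ℂ] GT Γ gr ⊗[ℂ] A :=
  GradedTensorProduct.lift gr Γ.envGrading
    (Algebra.TensorProduct.includeLeft.comp (GradedTensorProduct.includeLeft gr Γ.envGrading))
    ((Algebra.TensorProduct.map (GradedTensorProduct.includeRight gr Γ.envGrading)
      (AlgHom.id ℂ A)).comp Γ.envCoaction)
    (fun i j a b => by
      have key : ∀ t : Γ.Env ⊗[ℂ] A, Algebra.TensorProduct.map
            (GradedTensorProduct.includeRight gr Γ.envGrading) (AlgHom.id ℂ A) t *
          ((GradedTensorProduct.includeLeft gr Γ.envGrading (a : Ω)) ⊗ₜ[ℂ] (1 : A)) =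
          ((GradedTensorProduct.includeLeft gr Γ.envGrading (a : Ω)) ⊗ₜ[ℂ] (1 : A)) *
          Algebra.TensorProduct.map (GradedTensorProduct.includeRight gr Γ.envGrading)
            (AlgHom.id ℂ A) (((gradeInv Γ.envGrading) ^ i).rTensor A t) := by
        intro t
        induction t with
        | zero => simp
        | add x y hx hy => simp only [map_add, add_mul, mul_add, hx, hy]
        | tmul y c =>
          induction y using DirectSum.Decomposition.inductionOn Γ.envGrading with
          | zero => simp
          | add x y hx hy =>
            simp only [map_add, TensorProduct.add_tmul, add_mul, mul_add, hx, hy]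
          | @homogeneous k y =>
            have h3 := gt_mul Γ gr 1 y.2 a.2 1
            rw [one_mul, mul_one] at h3
            simp only [LinearMap.rTensor_tmul, gradeInv_pow Γ y.2,
              Algebra.TensorProduct.map_tmul, Algebra.TensorProduct.tmul_mul_tmul, mul_one,
              one_mul, map_smul, AlgHom.id_apply, GradedTensorProduct.includeLeft_apply,
              GradedTensorProduct.includeRight_apply, mul_smul_comm]
            rw [h3, GradedTensorProduct.tmul_one_mul_one_tmul]
      rw [units_smul, AlgHom.comp_apply, AlgHom.comp_apply]
      refine Eq.trans ?_ (congrArg (fun x => (-1 : ℂ) ^ (j * i) • x) (key _).symm)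
      rw [gradeInv_pow_envCoaction, gradeInv_pow Γ b.2, map_smul, map_smul, mul_smul_comm,
        smul_smul, ← mul_pow]
      simp)

lemma coactTensor_of (z : Ω ⊗[ℂ] Γ.Env) :
    coactTensor Γ gr (GradedTensorProduct.of ℂ gr Γ.envGrading z) =
      (GradedTensorProduct.of ℂ gr Γ.envGrading).toLinearMap.rTensor A
        ((TensorProduct.assoc ℂ Ω Γ.Env A).symm (Γ.envCoaction.toLinearMap.lTensor Ω z)) := by
  induction z with
  | zero => simp
  | add x y hx hy => simp only [map_add, hx, hy]
  | tmul x y =>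
    refine (GradedTensorProduct.lift_tmul gr Γ.envGrading _ _ _ x y).trans ?_
    simp only [AlgHom.comp_apply, LinearMap.lTensor_tmul, AlgHom.toLinearMap_apply]
    generalize Γ.envCoaction y = t
    induction t with
    | zero => simp
    | add x y hx hy => simp only [map_add, TensorProduct.tmul_add, mul_add, hx, hy]
    | tmul p q => simp [GradedTensorProduct.tmul_one_mul_one_tmul]

end GradedTensor

/-- A differential calculus `Ω(P)` on a quantum principal bundle: a graded-differential `*`-algebra
with `Ω⁰(P) = B`, generated by `B`, such that `F` extends to a homomorphism
`F̂ : Ω(P) → Ω(P) ⊗̂ Γ^∧` of graded-differential algebras. (Such an extension is unique, and it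
automatically preserves the degree and the `*`-structure, because `B` generates `Ω(P)`.) -/
structure BundleCalculus {V B A : Type*} [Ring V] [Algebra ℂ V] [StarRing V]
    [Ring B] [Algebra ℂ B] [StarRing B] [StarModule ℂ B]
    [Ring A] [HopfAlgebra ℂ A] [StarRing A] [StarModule ℂ A]
    (P : QuantumPrincipalBundle V B A) (Γ : BicovariantCalculus A)
    {Ω : Type*} [Ring Ω] [Algebra ℂ Ω] (gr : ℕ → Submodule ℂ Ω) [GradedAlgebra gr] where
  inc : B →ₐ[ℂ] Ω
  inc_injective : Function.Injective inc
  range_inc : LinearMap.range inc.toLinearMap = gr 0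
  d : Ω →ₗ[ℂ] Ω
  d_mem : ∀ n, ∀ w ∈ gr n, d w ∈ gr (n + 1)
  d_d : ∀ w, d (d w) = 0
  d_mul : ∀ n, ∀ w ∈ gr n, ∀ v, d (w * v) = d w * v + (-1 : ℂ) ^ n • (w * d v)
  conj : Ω →ₛₗ[starRingEnd ℂ] Ω
  conj_mem : ∀ n, ∀ w ∈ gr n, conj w ∈ gr n
  conj_conj : ∀ w, conj (conj w) = w
  conj_mul : ∀ m n, ∀ w ∈ gr m, ∀ v ∈ gr n, conj (w * v) = (-1 : ℂ) ^ (m * n) • (conj v * conj w)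
  conj_inc : ∀ b, conj (inc b) = inc (star b)
  conj_d : ∀ w, conj (d w) = d (conj w)
  adjoin_eq_top : Algebra.adjoin ℂ (Set.range inc ∪ Set.range fun b => d (inc b)) = ⊤
  Fhat : Ω →ₐ[ℂ] GT Γ gr
  Fhat_inc : ∀ b, Fhat (inc b) = GradedTensorProduct.of ℂ gr Γ.envGrading
    (TensorProduct.map inc.toLinearMap Γ.incA.toLinearMap (P.F b))
  Fhat_d : ∀ w, Fhat (d w) = dGT Γ gr d (Fhat w)

namespace BundleCalculus

variable {V B A : Type*} [Ring V] [Algebra ℂ V] [StarRing V]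
    [Ring B] [Algebra ℂ B] [StarRing B] [StarModule ℂ B]
    [Ring A] [HopfAlgebra ℂ A] [StarRing A] [StarModule ℂ A]
    {P : QuantumPrincipalBundle V B A} {Γ : BicovariantCalculus A}
    {Ω : Type*} [Ring Ω] [Algebra ℂ Ω] {gr : ℕ → Submodule ℂ Ω} [GradedAlgebra gr]
    (C : BundleCalculus P Γ gr)

/-- `F̂` with values in the underlying space `Ω(P) ⊗ Γ^∧`. -/
def FhatLin : Ω →ₗ[ℂ] Ω ⊗[ℂ] Γ.Env :=
  (GradedTensorProduct.of ℂ gr Γ.envGrading).symm.toLinearMap ∘ₗ C.Fhat.toLinearMap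

/-- The right action `F^∧ = (id ⊗ p_*) F̂ : Ω(P) → Ω(P) ⊗ A`. -/
def Fwedge : Ω →ₗ[ℂ] Ω ⊗[ℂ] A := Γ.pStar.toLinearMap.lTensor Ω ∘ₗ C.FhatLin

lemma Fhat_eq (w : Ω) : C.Fhat w = GradedTensorProduct.of ℂ gr Γ.envGrading (C.FhatLin w) := rfl

lemma mem_range_iff (w : Ω) : C.FhatLin w ∈ LinearMap.range (Γ.incA.toLinearMap.lTensor Ω) ↔
    C.Fhat w ∈ (incTensor Γ gr).range := by
  constructor
  · rintro ⟨z, hz⟩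
    exact ⟨z, by rw [Fhat_eq, ← hz]; exact incTensor_eq Γ gr z⟩
  · rintro ⟨z, hz⟩
    refine ⟨z, (GradedTensorProduct.of ℂ gr Γ.envGrading).injective ?_⟩
    rw [← Fhat_eq, ← hz]
    exact (incTensor_eq Γ gr z).symm

/-- The algebra of horizontal forms, `hor(P) = F̂⁻¹(Ω(P) ⊗ A)`. -/
def hor : Subalgebra ℂ Ω where
  carrier := {w | C.FhatLin w ∈ LinearMap.range (Γ.incA.toLinearMap.lTensor Ω)}
  mul_mem' := by
    intro w v hw hv
    rw [Set.mem_ofPred_eq, mem_range_iff] at *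
    rw [map_mul]
    exact mul_mem hw hv
  add_mem' := by
    intro w v hw hv
    rw [Set.mem_ofPred_eq, mem_range_iff] at *
    rw [map_add]
    exact add_mem hw hv
  algebraMap_mem' := by
    intro r
    rw [Set.mem_ofPred_eq, mem_range_iff, AlgHom.commutes]
    exact Subalgebra.algebraMap_mem _ r

lemma mem_hor {w : Ω} :
    w ∈ C.hor ↔ C.FhatLin w ∈ LinearMap.range (Γ.incA.toLinearMap.lTensor Ω) := Iff.rfl

lemma FhatLin_inc (b : B) :
    C.FhatLin (C.inc b) = TensorProduct.map C.inc.toLinearMap Γ.incA.toLinearMap (P.F b) := by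
  apply (GradedTensorProduct.of ℂ gr Γ.envGrading).injective
  rw [← Fhat_eq, Fhat_inc]

lemma gradeInv_inc (b : B) : gradeInv gr (C.inc b) = C.inc b := by
  have h : C.inc b ∈ gr 0 := C.range_inc ▸ ⟨b, rfl⟩
  rw [gradeInv_of_mem gr h, pow_zero, one_smul]

lemma gradeInv_d_inc (b : B) : gradeInv gr (C.d (C.inc b)) = -C.d (C.inc b) := by
  have h : C.inc b ∈ gr 0 := C.range_inc ▸ ⟨b, rfl⟩
  rw [gradeInv_of_mem gr (C.d_mem 0 _ h), zero_add, pow_one, neg_smul, one_smul]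

lemma FhatLin_d_inc (b : B) :
    C.FhatLin (C.d (C.inc b)) =
      TensorProduct.map (C.d ∘ₗ C.inc.toLinearMap) Γ.incA.toLinearMap (P.F b)
      + TensorProduct.map C.inc.toLinearMap Γ.dA (P.F b) := by
  apply (GradedTensorProduct.of ℂ gr Γ.envGrading).injective
  rw [← Fhat_eq, Fhat_d, Fhat_eq, FhatLin_inc]
  simp only [dGT, LinearMap.comp_apply, LinearEquiv.coe_coe, LinearEquiv.symm_apply_apply,
    LinearMap.add_apply]
  congr 1
  generalize P.F b = t
  induction t with
  | zero => simp
  | add x y hx hy =>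
    simp only [map_add] at *
    rw [add_add_add_comm, hx, hy]; abel
  | tmul x y => simp [gradeInv_inc, Γ.dEnv_incA]

lemma hom_ext {D : Type*} [Semiring D] [Algebra ℂ D] {f g : Ω →ₐ[ℂ] D}
    (h0 : ∀ b, f (C.inc b) = g (C.inc b)) (h1 : ∀ b, f (C.d (C.inc b)) = g (C.d (C.inc b))) :
    f = g := by
  refine AlgHom.ext_of_adjoin_eq_top C.adjoin_eq_top ?_
  rintro _ (⟨a, rfl⟩ | ⟨a, rfl⟩)
  · exact h0 a
  · exact h1 a

/-- `F̂` commutes with the grading involutions. -/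
lemma FhatLin_gradeInv (w : Ω) : C.FhatLin (gradeInv gr w) =
    TensorProduct.map (gradeInv gr) (gradeInv Γ.envGrading) (C.FhatLin w) := by
  have h0 : ∀ a, gradeInv Γ.envGrading (Γ.incA a) = Γ.incA a := fun a =>
    (gradeInv_of_mem _ (Γ.incA_mem a)).trans (by simp)
  have h1 : ∀ a, gradeInv Γ.envGrading (Γ.dA a) = -Γ.dA a := fun a =>
    (gradeInv_of_mem _ (Γ.dA_mem a)).trans (by simp)
  have h : C.Fhat.comp (gradeInvHom gr) = (invTensor Γ gr).comp C.Fhat := by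
    refine C.hom_ext (fun b => ?_) (fun b => ?_)
    · have e : gradeInvHom gr (C.inc b) = C.inc b := C.gradeInv_inc b
      rw [AlgHom.comp_apply, AlgHom.comp_apply, e, Fhat_eq, invTensor_of, FhatLin_inc]
      congr 1
      generalize P.F b = t
      induction t with
      | zero => simp
      | add x y hx hy => simp only [map_add, ← hx, ← hy]
      | tmul x y => simp [gradeInv_inc, h0]
    · have e : gradeInvHom gr (C.d (C.inc b)) = -C.d (C.inc b) := C.gradeInv_d_inc b
      rw [AlgHom.comp_apply, AlgHom.comp_apply, e, map_neg, Fhat_eq, invTensor_of, FhatLin_d_inc,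
        ← map_neg]
      congr 1
      generalize P.F b = t
      induction t with
      | zero => simp
      | add x y hx hy =>
        simp only [map_add] at *
        rw [add_add_add_comm, neg_add, hx, hy]; abel
      | tmul x y =>
        simp [gradeInv_inc, gradeInv_d_inc, h0, h1, TensorProduct.neg_tmul,
          TensorProduct.tmul_neg, add_comm]
  have h2 := DFunLike.congr_fun h w
  rw [AlgHom.comp_apply, AlgHom.comp_apply, Fhat_eq, Fhat_eq, invTensor_of] at h2
  exact (GradedTensorProduct.of ℂ gr Γ.envGrading).injective h2

lemma Fwedge_eq (w : Ω) : C.Fwedge w = projTensor Γ gr (C.Fhat w) := by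
  rw [Fhat_eq, projTensor_of]; rfl

/-- `(F̂ ⊗ id) F^∧ = (id ⊗ ρ) F̂`, with `ρ` the right action on `Γ^∧`. -/
lemma FhatLin_coassoc (w : Ω) : TensorProduct.assoc ℂ Ω Γ.Env A
      (C.FhatLin.rTensor A (C.Fwedge w))
    = Γ.envCoaction.toLinearMap.lTensor Ω (C.FhatLin w) := by
  have h : (Algebra.TensorProduct.map C.Fhat (AlgHom.id ℂ A)).comp
      ((projTensor Γ gr).comp C.Fhat) = (coactTensor Γ gr).comp C.Fhat := by
    have gen : ∀ (f : B →ₗ[ℂ] Ω) (L : B ⊗[ℂ] A →ₗ[ℂ] Ω ⊗[ℂ] Γ.Env)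
        (hf : ∀ b, C.FhatLin (f b) = L (P.F b))
        (hL : ∀ t, Γ.pStar.toLinearMap.lTensor Ω (L t) = f.rTensor A t)
        (hc : ∀ x a, Γ.envCoaction.toLinearMap.lTensor Ω (L (x ⊗ₜ a)) = TensorProduct.assoc ℂ _ _ _
          (L.rTensor A ((TensorProduct.assoc ℂ B A A).symm (x ⊗ₜ Coalgebra.comul (R := ℂ) a))))
        (b : B), Algebra.TensorProduct.map C.Fhat (AlgHom.id ℂ A)
          (projTensor Γ gr (C.Fhat (f b))) = coactTensor Γ gr (C.Fhat (f b)) := by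
      intro f L hf hL hc b
      rw [Fhat_eq, projTensor_of, coactTensor_of, hf, hL]
      have e1 : ∀ t : B ⊗[ℂ] A, Algebra.TensorProduct.map C.Fhat (AlgHom.id ℂ A) (f.rTensor A t)
          = (GradedTensorProduct.of ℂ gr Γ.envGrading).toLinearMap.rTensor A
            (L.rTensor A (P.F.toAlgHom.toLinearMap.rTensor A t)) := by
        intro t
        induction t with
        | zero => simp
        | add x y hx hy => simp only [map_add, hx, hy]
        | tmul x y => simp [Fhat_eq, hf]
      have e2 : ∀ t : B ⊗[ℂ] A, Γ.envCoaction.toLinearMap.lTensor Ω (L t) =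
          TensorProduct.assoc ℂ _ _ _ (L.rTensor A ((TensorProduct.assoc ℂ B A A).symm
            ((Coalgebra.comul (R := ℂ)).lTensor B t))) := by
        intro t
        induction t with
        | zero => simp
        | add x y hx hy => simp only [map_add, hx, hy]
        | tmul x y => exact hc x y
      rw [e1, e2, ← P.coassoc, LinearEquiv.symm_apply_apply, LinearEquiv.symm_apply_apply]
    refine C.hom_ext (fun b => ?_) (fun b => ?_)
    · refine gen C.inc.toLinearMap (TensorProduct.map C.inc.toLinearMap Γ.incA.toLinearMap)
        C.FhatLin_inc (fun t => ?_) (fun x a => ?_) b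
      · induction t with
        | zero => simp
        | add x y hx hy => simp only [map_add, hx, hy]
        | tmul x y => simp [Γ.pStar_incA]
      · rw [TensorProduct.map_tmul, LinearMap.lTensor_tmul, AlgHom.toLinearMap_apply,
          AlgHom.toLinearMap_apply, AlgHom.toLinearMap_apply, Γ.envCoaction_incA]
        generalize Coalgebra.comul (R := ℂ) a = t
        induction t with
        | zero => simp
        | add x y hx hy => simp only [map_add, TensorProduct.tmul_add, hx, hy]
        | tmul x y => simp
    · refine gen (C.d ∘ₗ C.inc.toLinearMap)
        (TensorProduct.map (C.d ∘ₗ C.inc.toLinearMap) Γ.incA.toLinearMap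
          + TensorProduct.map C.inc.toLinearMap Γ.dA)
        C.FhatLin_d_inc (fun t => ?_) (fun x a => ?_) b
      · induction t with
        | zero => simp
        | add x y hx hy => simp only [map_add, hx, hy]
        | tmul x y => simp [Γ.pStar_incA, Γ.pStar_dA]
      · rw [LinearMap.add_apply, TensorProduct.map_tmul, TensorProduct.map_tmul, map_add,
          LinearMap.lTensor_tmul, LinearMap.lTensor_tmul, AlgHom.toLinearMap_apply,
          AlgHom.toLinearMap_apply, AlgHom.toLinearMap_apply, AlgHom.toLinearMap_apply,
          Γ.envCoaction_incA, Γ.envCoaction_dA]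
        generalize Coalgebra.comul (R := ℂ) a = t
        induction t with
        | zero => simp
        | add x y hx hy =>
          simp only [map_add, TensorProduct.tmul_add] at *
          rw [add_add_add_comm, hx, hy]
        | tmul x y => simp
  have h2 := DFunLike.congr_fun h w
  rw [AlgHom.comp_apply, AlgHom.comp_apply, AlgHom.comp_apply, ← Fwedge_eq, Fhat_eq,
    coactTensor_of] at h2
  have h3 : ∀ z : Ω ⊗[ℂ] A, Algebra.TensorProduct.map C.Fhat (AlgHom.id ℂ A) z =
      (GradedTensorProduct.of ℂ gr Γ.envGrading).toLinearMap.rTensor A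
        (C.FhatLin.rTensor A z) := by
    intro z
    induction z with
    | zero => simp
    | add x y hx hy => simp only [map_add, hx, hy]
    | tmul x y => simp [Fhat_eq]
  rw [h3] at h2
  have h4 : Function.Injective
      ((GradedTensorProduct.of ℂ gr Γ.envGrading).toLinearMap.rTensor A) :=
    ((GradedTensorProduct.of ℂ gr Γ.envGrading).rTensor A).injective
  rw [h4 h2, LinearEquiv.apply_symm_apply]

lemma gradeInv_mem_hor {w : Ω} (hw : w ∈ C.hor) : gradeInv gr w ∈ C.hor := by
  rw [mem_hor] at *
  obtain ⟨z, hz⟩ := hw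
  rw [FhatLin_gradeInv, ← hz]
  refine ⟨(gradeInv gr).rTensor A z, ?_⟩
  have h0 : ∀ a, gradeInv Γ.envGrading (Γ.incA a) = Γ.incA a := fun a =>
    (gradeInv_of_mem _ (Γ.incA_mem a)).trans (by simp)
  clear hz
  induction z with
  | zero => simp
  | add x y hx hy => simp only [map_add, hx, hy]
  | tmul x y => simp [h0]

lemma Fwedge_mem_hor {w : Ω} (hw : w ∈ C.hor) :
    C.Fwedge w ∈ LinearMap.range (C.hor.val.toLinearMap.rTensor A) := by
  let q := (LinearMap.range (Γ.incA.toLinearMap.lTensor Ω)).mkQ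
  have hex : Function.Exact C.hor.val.toLinearMap (q ∘ₗ C.FhatLin) := by
    intro v
    rw [LinearMap.comp_apply, Submodule.mkQ_apply, Submodule.Quotient.mk_eq_zero, ← mem_hor]
    exact ⟨fun h => ⟨⟨v, h⟩, rfl⟩, fun ⟨u, hu⟩ => hu ▸ u.2⟩
  refine (Module.Flat.rTensor_exact A hex _).1 ?_
  obtain ⟨z, hz⟩ := hw
  have h1 : C.Fwedge w = z := by
    rw [Fwedge, LinearMap.comp_apply, ← hz, ← LinearMap.lTensor_comp_apply]
    have : Γ.pStar.toLinearMap ∘ₗ Γ.incA.toLinearMap = LinearMap.id :=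
      LinearMap.ext Γ.pStar_incA
    rw [this, LinearMap.lTensor_id, LinearMap.id_apply]
  have h2 := C.FhatLin_coassoc w
  have h3 : ∀ z : Ω ⊗[ℂ] A, Γ.envCoaction.toLinearMap.lTensor Ω (Γ.incA.toLinearMap.lTensor Ω z) =
      TensorProduct.assoc ℂ _ _ _ ((Γ.incA.toLinearMap.lTensor Ω).rTensor A
        ((TensorProduct.assoc ℂ Ω A A).symm ((Coalgebra.comul (R := ℂ)).lTensor Ω z))) := by
    intro z
    induction z with
    | zero => simp
    | add x y hx hy => simp only [map_add, hx, hy]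
    | tmul x a =>
      simp only [LinearMap.lTensor_tmul, AlgHom.toLinearMap_apply, Γ.envCoaction_incA]
      generalize Coalgebra.comul (R := ℂ) a = t
      induction t with
      | zero => simp
      | add x y hx hy => simp only [map_add, TensorProduct.tmul_add, hx, hy]
      | tmul x y => simp
  rw [← hz, h3] at h2
  have h4 := (TensorProduct.assoc ℂ Ω Γ.Env A).injective h2
  rw [LinearMap.rTensor_comp_apply, h4, ← LinearMap.rTensor_comp_apply]
  have h5 : q ∘ₗ Γ.incA.toLinearMap.lTensor Ω = 0 :=
    LinearMap.range_mkQ_comp _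
  rw [h5, LinearMap.rTensor_zero, LinearMap.zero_apply]
end BundleCalculus

/-! ## Vertically-horizontally decomposed forms -/

section PiMul

variable {A : Type*} [Ring A] [HopfAlgebra ℂ A] [StarRing A] (Γ : BicovariantCalculus A)
variable {X : Type*} [AddCommGroup X] [Module ℂ X]

/-- The map `x ⊗ η ↦ ∑ xₖ ⊗ π(cₖ) η` on `X ⊗ Γ_inv^∧`, where `δ(x) = ∑ xₖ ⊗ cₖ`. -/
def piMul (δ : X →ₗ[ℂ] X ⊗[ℂ] A) : X ⊗[ℂ] Γ.InvExt →ₗ[ℂ] X ⊗[ℂ] Γ.InvExt :=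
  (LinearMap.mul' ℂ Γ.InvExt ∘ₗ (Γ.inc ∘ₗ Γ.pi).rTensor Γ.InvExt).lTensor X
    ∘ₗ (TensorProduct.assoc ℂ X A Γ.InvExt).toLinearMap ∘ₗ δ.rTensor Γ.InvExt

lemma piMul_tmul (δ : X →ₗ[ℂ] X ⊗[ℂ] A) (x : X) (η : Γ.InvExt) :
    piMul Γ δ (x ⊗ₜ η) =
      TensorProduct.map LinearMap.id (LinearMap.mulRight ℂ η ∘ₗ Γ.inc ∘ₗ Γ.pi) (δ x) := by
  simp only [piMul, LinearMap.comp_apply, LinearMap.rTensor_tmul, LinearEquiv.coe_coe]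
  generalize δ x = t
  induction t with
  | zero => simp
  | add x y hx hy => simp only [map_add, TensorProduct.add_tmul, hx, hy]
  | tmul x y => simp

/-- The space `Λ_u = H_u ⊗ Γ_inv^∧`. -/
abbrev Lam [StarModule ℂ A] {n : ℕ} (_u : UnitaryRep A n) : Type _ :=
  (Fin n → ℂ) ⊗[ℂ] Γ.InvExt

/-- The differential `d_u(e i ⊗ η) = e i ⊗ dη + ∑ j, e j ⊗ π(u j i) η` of `Λ_u`. -/
def dLam [StarModule ℂ A] {n : ℕ} (u : UnitaryRep A n) : Lam Γ u →ₗ[ℂ] Lam Γ u :=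
  Γ.dInv.lTensor (Fin n → ℂ) + piMul Γ u.coaction

end PiMul

/-- A complex `(X, d)` is acyclic if all its cohomology vanishes: `ker d = im d`. (For a graded
space and a differential of degree one this means exactness in each degree.) -/
def IsAcyclic {X : Type*} [AddCommGroup X] [Module ℂ X] (d : X →ₗ[ℂ] X) : Prop :=
  LinearMap.ker d = LinearMap.range d

namespace BundleCalculus

variable {V B A : Type*} [Ring V] [Algebra ℂ V] [StarRing V]
    [Ring B] [Algebra ℂ B] [StarRing B] [StarModule ℂ B]
    [Ring A] [HopfAlgebra ℂ A] [StarRing A] [StarModule ℂ A]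
    {P : QuantumPrincipalBundle V B A} {Γ : BicovariantCalculus A}
    {Ω : Type*} [Ring Ω] [Algebra ℂ Ω] {gr : ℕ → Submodule ℂ Ω} [GradedAlgebra gr]
    (C : BundleCalculus P Γ gr)

lemma horInc_injective : Function.Injective (C.hor.val.toLinearMap.rTensor A) :=
  Module.Flat.rTensor_preserves_injective_linearMap _ Subtype.val_injective

/-- The restriction `hor(P) → hor(P) ⊗ A` of the right action `F^∧` to horizontal forms. -/
def horCoaction : C.hor →ₗ[ℂ] C.hor ⊗[ℂ] A :=
  (LinearEquiv.ofInjective _ C.horInc_injective).symm.toLinearMap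
    ∘ₗ (C.Fwedge ∘ₗ C.hor.val.toLinearMap).codRestrict _ fun w => C.Fwedge_mem_hor w.2

lemma horCoaction_coe (w : C.hor) :
    C.hor.val.toLinearMap.rTensor A (C.horCoaction w) = C.Fwedge w :=
  congrArg Subtype.val ((LinearEquiv.ofInjective _ C.horInc_injective).apply_symm_apply
    ⟨C.Fwedge w, C.Fwedge_mem_hor w.2⟩)

/-- The map `φ ↦ (-1)^∂φ φ` on `hor(P)`. -/
def horInv : C.hor →ₗ[ℂ] C.hor :=
  (gradeInv gr ∘ₗ C.hor.val.toLinearMap).codRestrict (Subalgebra.toSubmodule C.hor)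
    fun w => C.gradeInv_mem_hor w.2

lemma horInv_of_mem {n : ℕ} {w : C.hor} (hw : (w : Ω) ∈ gr n) :
    C.horInv w = (-1 : ℂ) ^ n • w :=
  Subtype.ext (gradeInv_of_mem gr hw)

/-- The space `vh(P) = hor(P) ⊗ Γ_inv^∧` of vertically-horizontally decomposed forms. -/
abbrev vh : Type _ := C.hor ⊗[ℂ] Γ.InvExt

/-- The differential of `vh(P)`,
`d_vh(φ ⊗ ϑ) = (-1)^∂φ ∑ φₖ ⊗ π(cₖ) ϑ + (-1)^∂φ φ ⊗ dϑ`, where `F^∧(φ) = ∑ φₖ ⊗ cₖ`. -/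
def dvh : C.vh →ₗ[ℂ] C.vh :=
  (piMul Γ C.horCoaction + Γ.dInv.lTensor C.hor) ∘ₗ C.horInv.rTensor Γ.InvExt

/-- Tensorial forms of degree `p`: linear maps `λ : Γ_inv → Ω(P)` with values in the horizontal
forms of degree `p` that intertwine `ϖ` and `F^∧`. -/
structure TensorialForm (p : ℕ) where
  toFun : Γ.Inv →ₗ[ℂ] Ω
  mem_hor : ∀ x, toFun x ∈ C.hor
  mem_degree : ∀ x, toFun x ∈ gr p
  intertwines : ∀ x, C.Fwedge (toFun x) = toFun.rTensor A (Γ.varpi x)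

namespace TensorialForm

variable {C} {p : ℕ} (lam : C.TensorialForm p)

/-- `λ` as a map into `hor(P)`. -/
def toHor : Γ.Inv →ₗ[ℂ] C.hor :=
  lam.toFun.codRestrict (Subalgebra.toSubmodule C.hor) lam.mem_hor

/-- The operator `S_λ(φ ⊗ ϑ) = ∑ φₖ λπ(cₖ) ⊗ ϑ`, where `F^∧(φ) = ∑ φₖ ⊗ cₖ`. -/
def S : C.vh →ₗ[ℂ] C.vh :=
  (LinearMap.mul' ℂ C.hor ∘ₗ (lam.toHor ∘ₗ Γ.pi).lTensor C.hor ∘ₗ C.horCoaction).rTensor Γ.InvExt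

/-- The summand `∑ₗ φ λ(ϑᵢₗ) ⊗ ({ϑ₁ ⋯ ϑᵢ₋₁} ∘ cᵢₗ) {ϑᵢ₊₁ ⋯ ϑₙ}`, where
`ϖ(ϑᵢ) = ∑ₗ ϑᵢₗ ⊗ cᵢₗ`; here the product `ϑ₁ ⋯ ϑₙ` is given by a list, and the index `i` starts
at zero. -/
def termT (φ : C.hor) (l : List Γ.Inv) (i : Fin l.length) : C.vh :=
  TensorProduct.map (LinearMap.mulLeft ℂ φ ∘ₗ lam.toHor)
    (LinearMap.mulRight ℂ (Γ.word (l.drop (i + 1))) ∘ₗ Γ.act (Γ.word (l.take i)))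
    (Γ.varpi (l.get i))

/-- The defining property of `T_λ`: for all `φ ∈ hor(P)` and all `ϑ₁, …, ϑₙ ∈ Γ_inv`,
`T_λ(φ ⊗ ϑ₁ ⋯ ϑₙ)` is `(-1)^∂φ φ` times the sum over `i` of
`(-1)^(i - 1) λ(ϑᵢₗ) ⊗ ({ϑ₁ ⋯ ϑᵢ₋₁} ∘ cᵢₗ) {ϑᵢ₊₁ ⋯ ϑₙ}`. -/
def IsT (T : C.vh →ₗ[ℂ] C.vh) : Prop :=
  ∀ (φ : C.hor) (l : List Γ.Inv), T (φ ⊗ₜ Γ.word l) =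
    ∑ i : Fin l.length, (-1 : ℂ) ^ (i : ℕ) • lam.termT (C.horInv φ) l i

end TensorialForm

end BundleCalculus

end

end QPB

open QPB

namespace QPB

noncomputable section

/-! ## Matrix coefficients of unitary representations -/

namespace UnitaryRep

variable {A : Type*} [Ring A] [HopfAlgebra ℂ A] [StarRing A] {n : ℕ}

/-! For a comodule `X` with coaction `δ(x) = ∑ xₖ ⊗ cₖ`, the space `X ⊗ Γ_inv^∧` carries the
differential `D(x ⊗ ζ) = ∑ xₖ ⊗ π(cₖ) ζ + x ⊗ dζ` (`comodD`). It squares to zero by the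
Maurer-Cartan equation `dπ(a) = -π(a₁) π(a₂)`. Up to signs depending on the degree of the horizontal
factor, both `vh(P)` and `Λ_u` are of this kind, and `D` is natural in comodule maps. So everything
is proved once, for comodules.

The central object is the contraction `t : Γ_inv^∧ → Γ_inv ⊗ Γ_inv^∧`, the graded derivation with
`t(ϑ) = ϑ ⊗ 1`, where `Γ_inv^∧` acts on the target from the left by `ξ (ϑ ⊗ ζ) = ∑ ϑₖ ⊗ (ξ ∘ cₖ) ζ`,
`ϖ(ϑ) = ∑ ϑₖ ⊗ cₖ`. It exists because the value it must take on `π(a₁) π(a₂)` is `(π ⊗ π) ad(a)`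
(`braidMap_comul`), which depends only on `π(a)` (`pairMap_ad`) and hence vanishes for `a ∈ ℛ`. The
same computation, together with a Leibniz rule for the left action (`comodD_leftAct`), shows that
`t` anticommutes with the differentials (`contract_dInv`).

Tensoring with `X`, the coaction on `X` no longer cancels completely: the anticommutator of `id ⊗ t`
with the differentials of `X` and `X ⊗ Γ_inv` is `x ⊗ η ↦ ∑ xₖ ⊗ π(cₖ) ⊗ η` (`contractX_comodD`).
Composing with a comodule map `μ : X ⊗ Γ_inv → Y` gives the general `homotopy`.

For a tensorial form `λ`, the map `μ(φ ⊗ ϑ) = φ λ(ϑ)` is a comodule map. The resulting homotopy is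
`T_λ` up to signs: unfolding `t` on a product of one-forms gives the stated formula
(`contract_word`), so well-definedness comes from that of `t`.

For acyclicity, `x ↦ ∑ xₖ ⊗ π(cₖ)` is a comodule map `H_u → H_u ⊗ Γ_inv`. It is nonzero when `π(u) ≠
0`, hence injective by irreducibility, and complete reducibility provides a comodule retraction
(`exists_retraction`). Taking this retraction as `μ` makes the identity of `Λ_u` null-homotopic. -/

lemma sum_mul_star (u : UnitaryRep A n) (i j : Fin n) :
    ∑ k, u.mat i k * star (u.mat j k) = if i = j then 1 else 0 := by
  have h := congrFun (congrFun (Unitary.mem_iff.1 u.mem_unitary).2 i) j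
  simpa [Matrix.mul_apply, Matrix.star_apply, Matrix.one_apply] using h

lemma sum_star_mul (u : UnitaryRep A n) (i j : Fin n) :
    ∑ k, star (u.mat k i) * u.mat k j = if i = j then 1 else 0 := by
  have h := congrFun (congrFun (Unitary.mem_iff.1 u.mem_unitary).1 i) j
  simpa [Matrix.mul_apply, Matrix.star_apply, Matrix.one_apply] using h

/-- The antipode axiom makes `κ(u)` a left inverse of the matrix `u`, and unitarity makes `u*` a
right inverse, so the two coincide. -/
lemma antipode_mat (u : UnitaryRep A n) (i j : Fin n) :
    HopfAlgebra.antipode ℂ (u.mat i j) = star (u.mat j i) := by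
  have h1 : ∀ p q, ∑ k, HopfAlgebra.antipode ℂ (u.mat p k) * u.mat k q
      = if p = q then 1 else 0 := by
    intro p q
    have h := HopfAlgebra.mul_antipode_rTensor_comul_apply (R := ℂ) (u.mat p q)
    rw [u.comul_mat, u.counit_mat, map_sum, map_sum] at h
    simp only [LinearMap.rTensor_tmul, LinearMap.mul'_apply] at h
    rw [h]; split_ifs <;> simp
  calc HopfAlgebra.antipode ℂ (u.mat i j)
      = ∑ p, HopfAlgebra.antipode ℂ (u.mat i p) * ∑ q, u.mat p q * star (u.mat j q) := by
        simp [sum_mul_star]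
    _ = ∑ q, (∑ p, HopfAlgebra.antipode ℂ (u.mat i p) * u.mat p q) * star (u.mat j q) := by
        simp only [Finset.mul_sum, Finset.sum_mul, mul_assoc]
        exact Finset.sum_comm
    _ = star (u.mat j i) := by simp [h1]

/-- On matrix coefficients the antipode is traded for the star, so that later computations with `ad`
need only unitarity and `comul_star`. -/
lemma ad_mat (u : UnitaryRep A n) (i j : Fin n) :
    ad A (u.mat i j) = ∑ k, ∑ l, u.mat k l ⊗ₜ[ℂ] (star (u.mat k i) * u.mat l j) := by
  simp only [ad, LinearMap.comp_apply, u.comul_mat, map_sum, LinearMap.lTensor_tmul,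
    TensorProduct.tmul_sum, LinearEquiv.coe_coe, TensorProduct.leftComm_tmul,
    LinearMap.rTensor_tmul, LinearMap.mul'_apply, u.antipode_mat]

/-- The one-dimensional trivial representation. -/
def trivial : UnitaryRep A 1 where
  mat := 1
  comul_mat i j := by
    rw [Subsingleton.elim i j]
    simp [Algebra.TensorProduct.one_def, Matrix.one_apply, Subsingleton.elim j 0]
  counit_mat i j := by
    rw [Subsingleton.elim i j]; simp
  mem_unitary := one_mem _

/-- The tensor product of two unitary representations. -/
def tensor {m : ℕ} (u : UnitaryRep A m) (v : UnitaryRep A n) : UnitaryRep A (m * n) where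
  mat := Matrix.of fun i j =>
    u.mat (finProdFinEquiv.symm i).1 (finProdFinEquiv.symm j).1
      * v.mat (finProdFinEquiv.symm i).2 (finProdFinEquiv.symm j).2
  comul_mat i j := by
    rw [← finProdFinEquiv.sum_comp, Fintype.sum_prod_type]
    simp [-finProdFinEquiv_symm_apply, Bialgebra.comul_mul, u.comul_mat, v.comul_mat,
      Finset.sum_mul_sum]
  counit_mat i j := by
    simp only [Matrix.of_apply, Bialgebra.counit_mul, u.counit_mat, v.counit_mat,
      ← finProdFinEquiv.symm.injective.eq_iff (a := i), Prod.ext_iff, ← ite_and, mul_ite, mul_one,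
      mul_zero]
    split_ifs <;> simp_all
  mem_unitary := by
    have hu := u.sum_mul_star
    have hv := v.sum_mul_star
    have hu' := u.sum_star_mul
    have hv' := v.sum_star_mul
    refine Unitary.mem_iff.2 ⟨?_, ?_⟩
    · ext i j
      obtain ⟨⟨i, i'⟩, rfl⟩ := finProdFinEquiv.surjective i
      obtain ⟨⟨j, j'⟩, rfl⟩ := finProdFinEquiv.surjective j
      rw [Matrix.mul_apply, ← finProdFinEquiv.sum_comp, Fintype.sum_prod_type_right]
      simp only [Matrix.star_apply, Matrix.of_apply, Equiv.symm_apply_apply, star_mul, mul_assoc]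
      have : ∀ y x, star (v.mat y i') * (star (u.mat x i) * (u.mat x j * v.mat y j'))
          = star (v.mat y i') * ((star (u.mat x i) * u.mat x j) * v.mat y j') := by
        intros; simp only [mul_assoc]
      simp only [this, ← Finset.mul_sum, ← Finset.sum_mul, hu']
      rw [Matrix.one_apply]
      simp only [finProdFinEquiv.injective.eq_iff, Prod.mk.injEq]
      by_cases h : i = j
      · simp [h, hv']
      · simp [h]
    · ext i j
      obtain ⟨⟨i, i'⟩, rfl⟩ := finProdFinEquiv.surjective i
      obtain ⟨⟨j, j'⟩, rfl⟩ := finProdFinEquiv.surjective j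
      rw [Matrix.mul_apply, ← finProdFinEquiv.sum_comp, Fintype.sum_prod_type]
      simp only [Matrix.star_apply, Matrix.of_apply, Equiv.symm_apply_apply, star_mul, mul_assoc]
      have : ∀ x y, u.mat i x * (v.mat i' y * (star (v.mat j' y) * star (u.mat j x)))
          = u.mat i x * ((v.mat i' y * star (v.mat j' y)) * star (u.mat j x)) := by
        intros; simp only [mul_assoc]
      simp only [this, ← Finset.mul_sum, ← Finset.sum_mul, hv]
      rw [Matrix.one_apply]
      simp only [finProdFinEquiv.injective.eq_iff, Prod.mk.injEq]
      by_cases h : i' = j'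
      · simp [h, hu]
      · simp [h]

end UnitaryRep

/-! ### Spanning by matrix coefficients, and the adjoint coaction. -/

section Span

variable {A : Type*} [Ring A] [HopfAlgebra ℂ A] [StarRing A] [StarModule ℂ A]

/-- The polynomial functions are spanned by the matrix coefficients of unitary representations. -/
lemma span_matrixCoeff_eq_top [CompactMatrixQuantumGroup A] :
    Submodule.span ℂ {a : A | ∃ (n : ℕ) (u : UnitaryRep A n) (i j : Fin n), u.mat i j = a} = ⊤ := by
  set S := {a : A | ∃ (n : ℕ) (u : UnitaryRep A n) (i j : Fin n), u.mat i j = a}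
  obtain ⟨n, u, hu⟩ := CompactMatrixQuantumGroup.exists_fundamental (A := A)
  -- The coefficients form a submonoid, by the trivial representation and tensor products; hence the
  -- subalgebra they generate is merely their linear span.
  have h1 : (1 : A) ∈ S := ⟨1, UnitaryRep.trivial, 0, 0, by simp [UnitaryRep.trivial]⟩
  have hmul : ∀ a ∈ S, ∀ b ∈ S, a * b ∈ S := by
    rintro _ ⟨m, u, i, j, rfl⟩ _ ⟨n, v, k, l, rfl⟩
    exact ⟨m * n, u.tensor v, finProdFinEquiv (i, k), finProdFinEquiv (j, l), by
      simp [UnitaryRep.tensor, -finProdFinEquiv_symm_apply]⟩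
  let M : Submonoid A := ⟨⟨S, fun {a b} ha hb => hmul a ha b hb⟩, h1⟩
  have h : Submodule.span ℂ (M : Set A) = ⊤ := by
    rw [← Algebra.adjoin_eq_span_of_subset (R := ℂ) (s := (M : Set A)), eq_top_iff]
    · rw [← Algebra.top_toSubmodule, ← hu]
      refine Algebra.adjoin_mono ?_
      rintro _ ⟨p, rfl⟩
      exact ⟨n, u, p.1, p.2, rfl⟩
    · rw [Submonoid.closure_eq]
      exact Submodule.subset_span
  exact h

lemma matrixCoeff_induction [CompactMatrixQuantumGroup A] {p : A → Prop} (zero : p 0)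
    (add : ∀ a b, p a → p b → p (a + b)) (smul : ∀ (c : ℂ) a, p a → p (c • a))
    (coeff : ∀ (n : ℕ) (u : UnitaryRep A n) (i j : Fin n), p (u.mat i j)) (a : A) : p a := by
  have ha : a ∈ Submodule.span ℂ
      {a : A | ∃ (n : ℕ) (u : UnitaryRep A n) (i j : Fin n), u.mat i j = a} := by
    rw [span_matrixCoeff_eq_top]; trivial
  induction ha using Submodule.span_induction with
  | mem x h => obtain ⟨n, u, i, j, rfl⟩ := h; exact coeff n u i j
  | zero => exact zero
  | add x y _ _ hx hy => exact add x y hx hy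
  | smul c x _ hx => exact smul c x hx

lemma linearMap_ext_matrixCoeff [CompactMatrixQuantumGroup A] {M : Type*} [AddCommGroup M]
    [Module ℂ M] {f g : A →ₗ[ℂ] M}
    (h : ∀ (n : ℕ) (u : UnitaryRep A n) (i j : Fin n), f (u.mat i j) = g (u.mat i j)) : f = g :=
  LinearMap.ext fun a => matrixCoeff_induction (p := fun a => f a = g a) (by simp)
    (fun a b ha hb => by rw [map_add, map_add, ha, hb])
    (fun c a ha => by rw [map_smul, map_smul, ha]) h a

lemma comul_star_mat [CompactMatrixQuantumGroup A] {n : ℕ} (u : UnitaryRep A n) (i j : Fin n) :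
    Coalgebra.comul (R := ℂ) (star (u.mat i j))
      = ∑ k, star (u.mat i k) ⊗ₜ[ℂ] star (u.mat k j) := by
  rw [HopfStarAlgebra.comul_star, u.comul_mat, star_sum]
  simp

/-- The exchange of the index pairs `(k, l)` and `(p, q)`, by which the two sides of the
coassociativity of `ad` differ. -/
lemma sum_comm_pairs {ι M : Type*} [Fintype ι] [AddCommMonoid M] (f : ι → ι → ι → ι → M) :
    ∑ k, ∑ l, ∑ p, ∑ q, f p q k l = ∑ k, ∑ l, ∑ p, ∑ q, f k l p q := by
  simp only [← Fintype.sum_prod_type']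
  refine Fintype.sum_equiv ((Equiv.prodAssoc ι ι (ι × ι)).symm.trans
    ((Equiv.prodComm _ _).trans (Equiv.prodAssoc ι ι (ι × ι)))) _ _ fun _ => rfl

/-- The adjoint action is a coaction. -/
lemma ad_coassoc [CompactMatrixQuantumGroup A] (a : A) :
    TensorProduct.assoc ℂ A A A ((ad A).rTensor A (ad A a))
      = (Coalgebra.comul (R := ℂ)).lTensor A (ad A a) := by
  have : (TensorProduct.assoc ℂ A A A).toLinearMap ∘ₗ (ad A).rTensor A ∘ₗ ad A
      = (Coalgebra.comul (R := ℂ)).lTensor A ∘ₗ ad A := by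
    -- On a coefficient `u i j` both sides are the sum over `p, q, k, l` of `u p q ⊗ (u p k)* u q l
    -- ⊗ (u k i)* u l j`, up to naming the indices.
    refine linearMap_ext_matrixCoeff fun n u i j => ?_
    simp only [LinearMap.comp_apply, u.ad_mat, map_sum, LinearMap.rTensor_tmul,
      LinearMap.lTensor_tmul, LinearEquiv.coe_coe, Bialgebra.comul_mul, comul_star_mat,
      u.comul_mat, TensorProduct.sum_tmul, TensorProduct.tmul_sum, Finset.sum_mul_sum,
      Algebra.TensorProduct.tmul_mul_tmul, TensorProduct.assoc_tmul]
    exact sum_comm_pairs _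
  exact DFunLike.congr_fun this a

end Span

/-- In the form `ad(a) = (1 ⊗ κ(a₁)) Δ(a₂)` the multiplicative counit replaces `κ(a₁)` by `ε(a₁)`,
and the counit axioms finish. -/
lemma ad_counit {A : Type*} [Ring A] [HopfAlgebra ℂ A] (a : A) :
    TensorProduct.rid ℂ A ((Coalgebra.counit (R := ℂ)).lTensor A (ad A a)) = a := by
  have h : ∀ t : A ⊗[ℂ] A, TensorProduct.rid ℂ A ((Coalgebra.counit (R := ℂ)).lTensor A
      (TensorProduct.lift (LinearMap.mk₂ ℂ
        (fun p y : A => (1 ⊗ₜ[ℂ] HopfAlgebra.antipode ℂ p) * Coalgebra.comul (R := ℂ) y)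
        (by intros; simp [TensorProduct.tmul_add, add_mul]) (by intros; simp)
        (by intros; simp [mul_add]) (by intros; simp)) t))
      = TensorProduct.lid ℂ A ((Coalgebra.counit (R := ℂ)).rTensor A t) := by
    intro t
    induction t with
    | zero => simp
    | add x y hx hy => simp only [map_add, hx, hy]
    | tmul p y =>
      have e : ∀ s : A ⊗[ℂ] A, TensorProduct.rid ℂ A ((Coalgebra.counit (R := ℂ)).lTensor A
          ((1 ⊗ₜ[ℂ] HopfAlgebra.antipode ℂ p) * s)) = Coalgebra.counit (R := ℂ) p •
          TensorProduct.rid ℂ A ((Coalgebra.counit (R := ℂ)).lTensor A s) := by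
        intro s
        induction s with
        | zero => simp
        | add x y hx hy => simp only [map_add, mul_add, smul_add, hx, hy]
        | tmul x y => simp [mul_smul]
      simp only [TensorProduct.lift.tmul, LinearMap.mk₂_apply]
      rw [e, Coalgebra.lTensor_counit_comul]
      simp
  rw [ad_eq, h, Coalgebra.rTensor_counit_comul]
  simp

namespace BicovariantCalculus

variable {A : Type*} [Ring A] [HopfAlgebra ℂ A] [StarRing A] (Γ : BicovariantCalculus A)

/-! ## The algebra `Γ_inv^∧` -/

/-- The rules for `d`, `∘` and the contraction all describe the effect of one more one-form on the
left; this induction has the matching shape. -/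
lemma invExt_induction {p : Γ.InvExt → Prop} (one : p 1) (add : ∀ x y, p x → p y → p (x + y))
    (smul : ∀ (c : ℂ) x, p x → p (c • x)) (inc_mul : ∀ x η, p η → p (Γ.inc x * η))
    (η : Γ.InvExt) : p η := by
  -- Keeping an arbitrary right factor `η` lets a product be absorbed factor by factor.
  have h : ∀ (t : TensorAlgebra ℂ Γ.Inv) (η : Γ.InvExt), p η → p (Γ.invMk t * η) := by
    intro t
    induction t using TensorAlgebra.induction with
    | algebraMap r =>
      intro η hη
      rw [AlgHom.commutes, ← Algebra.smul_def]
      exact smul r η hη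
    | ι x => exact inc_mul x
    | mul a b ha hb =>
      intro η hη
      rw [map_mul, mul_assoc]
      exact ha _ (hb _ hη)
    | add a b ha hb =>
      intro η hη
      rw [map_add, add_mul]
      exact add _ _ (ha _ hη) (hb _ hη)
  obtain ⟨t, rfl⟩ := Γ.invMk_surjective η
  simpa using h t 1 one

lemma invExt_linearMap_ext {M : Type*} [AddCommGroup M] [Module ℂ M] {f g : Γ.InvExt →ₗ[ℂ] M}
    (one : f 1 = g 1) (inc_mul : ∀ x η, f η = g η → f (Γ.inc x * η) = g (Γ.inc x * η)) : f = g :=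
  LinearMap.ext <| Γ.invExt_induction one (fun x y hx hy => by rw [map_add, map_add, hx, hy])
    (fun c x hx => by rw [map_smul, map_smul, hx]) inc_mul

/-- This is why the prescribed values on products of one-forms determine `T_λ`. -/
lemma span_word : Submodule.span ℂ (Set.range Γ.word) = ⊤ := by
  rw [eq_top_iff]
  rintro η -
  refine Γ.invExt_induction (p := fun η => η ∈ Submodule.span ℂ (Set.range Γ.word))
    (Submodule.subset_span ⟨[], rfl⟩) (fun _ _ => add_mem)
    (fun c _ h => Submodule.smul_mem _ c h) (fun x η hη => ?_) η
  induction hη using Submodule.span_induction with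
  | mem y h => obtain ⟨l, rfl⟩ := h; exact Submodule.subset_span ⟨x :: l, by simp [word]⟩
  | zero => simp
  | add y z _ _ hy hz => rw [mul_add]; exact add_mem hy hz
  | smul c y _ hy => rw [mul_smul_comm]; exact Submodule.smul_mem _ c hy

lemma dMatrix_inc (x : Γ.Inv) : Γ.dMatrix (Γ.inc x) = Γ.dMatrixGen x := Γ.extLift_inc _ _ _

/-- The matrix of `η` is upper triangular with `η` in the lower right corner; this is what turns the
upper right entry of a matrix product into a Leibniz rule. -/
lemma dMatrix_lower (η : Γ.InvExt) : Γ.dMatrix η 1 0 = 0 ∧ Γ.dMatrix η 1 1 = η := by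
  refine Γ.invExt_induction
    (p := fun η => Γ.dMatrix η 1 0 = 0 ∧ Γ.dMatrix η 1 1 = η) (by simp) ?_ ?_ ?_ η
  · rintro x y ⟨hx, hx'⟩ ⟨hy, hy'⟩
    simp [hx, hx', hy, hy']
  · rintro c x ⟨hx, hx'⟩
    simp [hx, hx']
  · rintro x η ⟨h, h'⟩
    simp [Matrix.mul_apply, Fin.sum_univ_two, dMatrix_inc, dMatrixGen, h, h']

lemma dInv_one : Γ.dInv 1 = 0 := by simp [dInv]

lemma dInv_inc_mul (x : Γ.Inv) (η : Γ.InvExt) :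
    Γ.dInv (Γ.inc x * η) = Γ.dGen x * η - Γ.inc x * Γ.dInv η := by
  simp [dInv, Matrix.mul_apply, Fin.sum_univ_two, dMatrix_inc, dMatrixGen, (Γ.dMatrix_lower η).2]
  abel

lemma dGen_pi' (a : A) : Γ.dGen (Γ.pi a) = -Γ.quadExt (Coalgebra.comul (R := ℂ) a) := Γ.dGen_pi a

@[simp] lemma quadExt_tmul (a b : A) : Γ.quadExt (a ⊗ₜ b) = Γ.inc (Γ.pi a) * Γ.inc (Γ.pi b) := by
  simp [quadExt]

/-- `d (π(a) π(b) η) = dπ(a) π(b) η - π(a) dπ(b) η + π(a) π(b) dη`. -/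
lemma dInv_quadExt_mul (s : A ⊗[ℂ] A) (η : Γ.InvExt) :
    Γ.dInv (Γ.quadExt s * η) =
      LinearMap.mul' ℂ Γ.InvExt (TensorProduct.map (Γ.dGen ∘ₗ Γ.pi) (Γ.inc ∘ₗ Γ.pi) s) * η
      - LinearMap.mul' ℂ Γ.InvExt (TensorProduct.map (Γ.inc ∘ₗ Γ.pi) (Γ.dGen ∘ₗ Γ.pi) s) * η
      + Γ.quadExt s * Γ.dInv η := by
  induction s with
  | zero => simp
  | add x y hx hy => simp only [map_add, add_mul, hx, hy]; abel
  | tmul a b =>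
    simp [mul_assoc, dInv_inc_mul, mul_sub]; abel

/-- By coassociativity both sides are `-π(a₁) π(a₂) π(a₃)`. Their equality is the closedness of
`π(a₁) π(a₂)`. -/
lemma dGen_quad (a : A) :
    LinearMap.mul' ℂ Γ.InvExt (TensorProduct.map (Γ.dGen ∘ₗ Γ.pi) (Γ.inc ∘ₗ Γ.pi)
      (Coalgebra.comul (R := ℂ) a))
    = LinearMap.mul' ℂ Γ.InvExt (TensorProduct.map (Γ.inc ∘ₗ Γ.pi) (Γ.dGen ∘ₗ Γ.pi)
      (Coalgebra.comul (R := ℂ) a)) := by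
  let H : A ⊗[ℂ] (A ⊗[ℂ] A) →ₗ[ℂ] Γ.InvExt :=
    LinearMap.mul' ℂ Γ.InvExt ∘ₗ TensorProduct.map (Γ.inc ∘ₗ Γ.pi) (-Γ.quadExt)
  have h1 : ∀ t : A ⊗[ℂ] A, LinearMap.mul' ℂ Γ.InvExt
      (TensorProduct.map (Γ.dGen ∘ₗ Γ.pi) (Γ.inc ∘ₗ Γ.pi) t)
      = H (TensorProduct.assoc ℂ A A A ((Coalgebra.comul (R := ℂ)).rTensor A t)) := by
    intro t
    induction t with
    | zero => simp
    | add x y hx hy => simp only [map_add, hx, hy]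
    | tmul x y =>
      simp only [TensorProduct.map_tmul, LinearMap.comp_apply, LinearMap.mul'_apply, dGen_pi',
        LinearMap.rTensor_tmul]
      generalize Coalgebra.comul (R := ℂ) x = s
      induction s with
      | zero => simp
      | add x y hx hy =>
        simp only [map_add, TensorProduct.add_tmul, ← hx, ← hy, neg_add, add_mul]
      | tmul p q => simp [H, mul_assoc]
  have h2 : ∀ t : A ⊗[ℂ] A, LinearMap.mul' ℂ Γ.InvExt
      (TensorProduct.map (Γ.inc ∘ₗ Γ.pi) (Γ.dGen ∘ₗ Γ.pi) t)
      = H ((Coalgebra.comul (R := ℂ)).lTensor A t) := by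
    intro t
    induction t with
    | zero => simp
    | add x y hx hy => simp only [map_add, hx, hy]
    | tmul x y => simp [H, dGen_pi']
  rw [h1, h2, Coalgebra.coassoc_apply]

/-- The two terms that differentiate the factors of `π(a₁) π(a₂)` cancel; the remaining sign is `+`
because `dϑ` has degree two. -/
lemma dInv_dGen_mul (x : Γ.Inv) (η : Γ.InvExt) :
    Γ.dInv (Γ.dGen x * η) = Γ.dGen x * Γ.dInv η := by
  obtain ⟨a, rfl⟩ := Γ.pi_surjective x
  rw [dGen_pi', neg_mul, map_neg, dInv_quadExt_mul, dGen_quad, sub_self, zero_add, neg_mul]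

lemma dInv_dInv (η : Γ.InvExt) : Γ.dInv (Γ.dInv η) = 0 := by
  have h : Γ.dInv ∘ₗ Γ.dInv = 0 := by
    -- The two cross terms `dϑ dη` cancel, leaving `d²(ϑ η) = ϑ d²η`.
    refine Γ.invExt_linearMap_ext (by simp [dInv_one]) fun x η hη => ?_
    simp only [LinearMap.comp_apply, LinearMap.zero_apply] at hη ⊢
    rw [dInv_inc_mul, map_sub, dInv_dGen_mul, dInv_inc_mul, hη]
    simp
  exact DFunLike.congr_fun h η

lemma act_one (a : A) : Γ.act 1 a = Coalgebra.counit (R := ℂ) a • 1 := by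
  simp [act, LinearMap.convOne_def, Algebra.algebraMap_eq_smul_one]

lemma act_inc (x : Γ.Inv) (a : A) : Γ.act (Γ.inc x) a = Γ.inc (Γ.circ x a) := by
  simp [act, actHom, actGen]

lemma act_mul (x y : Γ.InvExt) (a : A) : Γ.act (x * y) a =
    LinearMap.mul' ℂ _ (TensorProduct.map (Γ.act x) (Γ.act y) (Coalgebra.comul (R := ℂ) a)) := by
  simp [act, LinearMap.convMul_def]

/-! ## The action of the convolution algebra -/

section ConvAct

variable {X : Type*} [AddCommGroup X] [Module ℂ X]

/-- The operator `x ⊗ ζ ↦ ∑ xₖ ⊗ ψ(cₖ) ζ` on `X ⊗ Γ_inv^∧`, where `δ(x) = ∑ xₖ ⊗ cₖ`. -/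
def convAct (δ : X →ₗ[ℂ] X ⊗[ℂ] A) :
    (A →ₗ[ℂ] Γ.InvExt) →ₗ[ℂ] Module.End ℂ (X ⊗[ℂ] Γ.InvExt) where
  toFun ψ := (LinearMap.mul' ℂ Γ.InvExt ∘ₗ ψ.rTensor Γ.InvExt).lTensor X
    ∘ₗ (TensorProduct.assoc ℂ X A Γ.InvExt).toLinearMap ∘ₗ δ.rTensor Γ.InvExt
  map_add' ψ χ := by
    simp only [LinearMap.rTensor_add, LinearMap.comp_add, LinearMap.lTensor_add,
      LinearMap.add_comp]
  map_smul' c ψ := by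
    simp only [LinearMap.rTensor_smul, LinearMap.comp_smul, LinearMap.lTensor_smul,
      LinearMap.smul_comp, RingHom.id_apply]

lemma convAct_tmul (δ : X →ₗ[ℂ] X ⊗[ℂ] A) (ψ : A →ₗ[ℂ] Γ.InvExt) (x : X) (ζ : Γ.InvExt) :
    Γ.convAct δ ψ (x ⊗ₜ ζ) =
      TensorProduct.map LinearMap.id (LinearMap.mulRight ℂ ζ ∘ₗ ψ) (δ x) := by
  simp only [convAct, LinearMap.coe_mk, AddHom.coe_mk, LinearMap.comp_apply,
    LinearMap.rTensor_tmul, LinearEquiv.coe_coe]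
  generalize δ x = t
  induction t with
  | zero => simp
  | add x y hx hy => simp only [map_add, TensorProduct.add_tmul, hx, hy]
  | tmul x y => simp

lemma piMul_eq_convAct (δ : X →ₗ[ℂ] X ⊗[ℂ] A) : piMul Γ δ = Γ.convAct δ (Γ.inc ∘ₗ Γ.pi) := rfl

/-- The convolution product of linear maps `A → Γ_inv^∧`. -/
def conv (ψ χ : A →ₗ[ℂ] Γ.InvExt) : A →ₗ[ℂ] Γ.InvExt :=
  LinearMap.mul' ℂ Γ.InvExt ∘ₗ TensorProduct.map ψ χ ∘ₗ Coalgebra.comul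

lemma act_mul' (x y : Γ.InvExt) : Γ.act (x * y) = Γ.conv (Γ.act x) (Γ.act y) :=
  LinearMap.ext (Γ.act_mul x y)

variable {δ : X →ₗ[ℂ] X ⊗[ℂ] A}

/-- Coassociativity of `δ` makes `convAct` a representation of the convolution algebra, so
identities between maps `A → Γ_inv^∧` become identities between operators. -/
lemma convAct_conv (hδ : ∀ x, TensorProduct.assoc ℂ X A A (δ.rTensor A (δ x))
      = (Coalgebra.comul (R := ℂ)).lTensor X (δ x)) (ψ χ : A →ₗ[ℂ] Γ.InvExt) :
    Γ.convAct δ (Γ.conv ψ χ) = Γ.convAct δ ψ * Γ.convAct δ χ := by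
  refine TensorProduct.ext' fun x ζ => ?_
  let H : X ⊗[ℂ] (A ⊗[ℂ] A) →ₗ[ℂ] X ⊗[ℂ] Γ.InvExt :=
    (LinearMap.mulRight ℂ ζ ∘ₗ LinearMap.mul' ℂ Γ.InvExt ∘ₗ TensorProduct.map ψ χ).lTensor X
  have h : ∀ t : X ⊗[ℂ] A, Γ.convAct δ ψ
      (TensorProduct.map LinearMap.id (LinearMap.mulRight ℂ ζ ∘ₗ χ) t)
      = H (TensorProduct.assoc ℂ X A A (δ.rTensor A t)) := by
    intro t
    induction t with
    | zero => simp
    | add x y hx hy => simp only [map_add, hx, hy]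
    | tmul x a =>
      rw [TensorProduct.map_tmul, LinearMap.id_apply, convAct_tmul, LinearMap.rTensor_tmul]
      generalize δ x = s
      induction s with
      | zero => simp
      | add x y hx hy => simp only [map_add, TensorProduct.add_tmul, hx, hy]
      | tmul y b => simp [H, mul_assoc]
  rw [Module.End.mul_apply, convAct_tmul, convAct_tmul, h, hδ]
  generalize δ x = t
  induction t with
  | zero => simp
  | add x y hx hy => simp only [map_add, hx, hy]
  | tmul x a => simp [H, conv]

/-- The unit of the convolution algebra is `a ↦ ε(a) 1`, which is `act 1`. -/
lemma convAct_counit (hδ : ∀ x, TensorProduct.rid ℂ X ((Coalgebra.counit (R := ℂ)).lTensor X (δ x))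
      = x) : Γ.convAct δ (Γ.act 1) = 1 := by
  refine TensorProduct.ext' fun x ζ => ?_
  rw [convAct_tmul, Module.End.one_apply]
  conv_rhs => rw [← hδ x]
  generalize δ x = t
  induction t with
  | zero => simp
  | add x y hx hy => simp only [map_add, TensorProduct.add_tmul, hx, hy]
  | tmul x a => simp [act_one, TensorProduct.smul_tmul]

/-- The differential commutes with `convAct` up to a graded Leibniz rule. -/
lemma lTensor_dInv_convAct (δ : X →ₗ[ℂ] X ⊗[ℂ] A) (θ : A →ₗ[ℂ] Γ.Inv) :
    Γ.dInv.lTensor X * Γ.convAct δ (Γ.inc ∘ₗ θ)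
      = Γ.convAct δ (Γ.dGen ∘ₗ θ) - Γ.convAct δ (Γ.inc ∘ₗ θ) * Γ.dInv.lTensor X := by
  refine TensorProduct.ext' fun x ζ => ?_
  simp only [LinearMap.sub_apply, Module.End.mul_apply, LinearMap.lTensor_tmul, convAct_tmul]
  generalize δ x = t
  induction t with
  | zero => simp
  | add x y hx hy => simp only [map_add, hx, hy]; abel
  | tmul x a => simp [dInv_inc_mul, TensorProduct.tmul_sub]

/-- The Maurer-Cartan equation, as an identity in the convolution algebra. -/
lemma dGen_comp_pi : Γ.dGen ∘ₗ Γ.pi = -Γ.conv (Γ.inc ∘ₗ Γ.pi) (Γ.inc ∘ₗ Γ.pi) :=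
  LinearMap.ext Γ.dGen_pi'

/-- The differential `x ⊗ ζ ↦ ∑ xₖ ⊗ π(cₖ) ζ + x ⊗ dζ` on `X ⊗ Γ_inv^∧`. -/
def comodD (δ : X →ₗ[ℂ] X ⊗[ℂ] A) : Module.End ℂ (X ⊗[ℂ] Γ.InvExt) :=
  piMul Γ δ + Γ.dInv.lTensor X

/-- The square of the coaction part is the action of `π * π` (convolution), and its anticommutator
with `d` is the action of `dπ = -π * π`. -/
lemma comodD_mul_self (hδ : ∀ x, TensorProduct.assoc ℂ X A A (δ.rTensor A (δ x))
      = (Coalgebra.comul (R := ℂ)).lTensor X (δ x)) : Γ.comodD δ * Γ.comodD δ = 0 := by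
  have h1 := Γ.convAct_conv hδ (Γ.inc ∘ₗ Γ.pi) (Γ.inc ∘ₗ Γ.pi)
  have h2 := Γ.lTensor_dInv_convAct δ Γ.pi
  have h3 : Γ.dInv.lTensor X * Γ.dInv.lTensor X = 0 := by
    refine TensorProduct.ext' fun x ζ => ?_
    simp [dInv_dInv]
  rw [dGen_comp_pi, map_neg, h1] at h2
  rw [comodD, piMul_eq_convAct, mul_add, add_mul, add_mul, h2, h3]
  abel

end ConvAct

end BicovariantCalculus

namespace BicovariantCalculus

/-! ### The adjoint coaction on `Γ_inv`, and the compatibility of `∘` with `d`. -/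

section

variable {A : Type*} [Ring A] [HopfAlgebra ℂ A] [StarRing A] (Γ : BicovariantCalculus A)

lemma varpi_counit (θ : Γ.Inv) :
    TensorProduct.rid ℂ Γ.Inv ((Coalgebra.counit (R := ℂ)).lTensor Γ.Inv (Γ.varpi θ)) = θ := by
  obtain ⟨a, rfl⟩ := Γ.pi_surjective θ
  conv_rhs => rw [← ad_counit a]
  rw [varpi_pi]
  generalize ad A a = t
  induction t with
  | zero => simp
  | add x y hx hy => simp only [map_add, hx, hy]
  | tmul x y => simp

/-- The coassociativity of `ad` descends along the surjection `π`. -/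
lemma varpi_coassoc [StarModule ℂ A] [CompactMatrixQuantumGroup A] (θ : Γ.Inv) :
    TensorProduct.assoc ℂ Γ.Inv A A (Γ.varpi.rTensor A (Γ.varpi θ))
      = (Coalgebra.comul (R := ℂ)).lTensor Γ.Inv (Γ.varpi θ) := by
  obtain ⟨a, rfl⟩ := Γ.pi_surjective θ
  have h1 : ∀ t : A ⊗[ℂ] A, TensorProduct.assoc ℂ Γ.Inv A A (Γ.varpi.rTensor A (Γ.pi.rTensor A t))
      = Γ.pi.rTensor (A ⊗[ℂ] A) (TensorProduct.assoc ℂ A A A ((ad A).rTensor A t)) := by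
    intro t
    induction t with
    | zero => simp
    | add x y hx hy => simp only [map_add, hx, hy]
    | tmul x y =>
      simp only [LinearMap.rTensor_tmul, varpi_pi]
      generalize ad A x = s
      induction s with
      | zero => simp
      | add x y hx hy => simp only [map_add, TensorProduct.add_tmul, hx, hy]
      | tmul p q => simp
  rw [varpi_pi, h1, ad_coassoc]
  generalize ad A a = t
  induction t with
  | zero => simp
  | add x y hx hy => simp only [map_add, hx, hy]
  | tmul x y => simp

lemma act_inc' (θ : Γ.Inv) : Γ.act (Γ.inc θ) = Γ.inc ∘ₗ Γ.circ θ :=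
  LinearMap.ext (Γ.act_inc θ)

/-- `ϑ ↦ (a ↦ ϑ ∘ a)` as a linear map. -/
def actLin : Γ.InvExt →ₗ[ℂ] A →ₗ[ℂ] Γ.InvExt :=
  (WithConv.linearEquiv ℂ (A →ₗ[ℂ] Γ.InvExt)).toLinearMap ∘ₗ Γ.actHom.toLinearMap

@[simp] lemma actLin_apply (x : Γ.InvExt) : Γ.actLin x = Γ.act x := rfl

/-- Each factor contributes `π(x) ∘ b = π(x b) - ε(x) π(b)`; the four terms are the four choices in
the product of two such differences. -/
lemma act_quadExt (s : A ⊗[ℂ] A) (a : A) : Γ.actLin (Γ.quadExt s) a =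
    Γ.quadExt (s * Coalgebra.comul (R := ℂ) a)
      - Γ.quadExt ((1 ⊗ₜ TensorProduct.lid ℂ A (Coalgebra.counit.rTensor A s))
        * Coalgebra.comul (R := ℂ) a)
      - Γ.quadExt ((TensorProduct.rid ℂ A (Coalgebra.counit.lTensor A s) ⊗ₜ 1)
        * Coalgebra.comul (R := ℂ) a)
      + Coalgebra.counit (R := ℂ) (TensorProduct.lid ℂ A (Coalgebra.counit.rTensor A s))
        • Γ.quadExt (Coalgebra.comul (R := ℂ) a) := by
  induction s with
  | zero => simp [-actLin_apply]
  | add x y hx hy =>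
    simp only [map_add, LinearMap.add_apply, hx, hy, add_mul, TensorProduct.tmul_add,
      TensorProduct.add_tmul, add_smul]
    abel
  | tmul x y =>
    rw [quadExt_tmul, actLin_apply, act_mul]
    generalize Coalgebra.comul (R := ℂ) a = t
    induction t with
    | zero => simp
    | add x y hx hy => simp only [map_add, hx, hy, mul_add, smul_add]; abel
    | tmul b c =>
      simp [act_inc, circ_pi, sub_mul, mul_sub]
      module

/-- For `s = Δ(b)` the counit axioms collapse the partial counits in `act_quadExt`. -/
lemma act_dGen_pi (b a : A) : Γ.act (Γ.dGen (Γ.pi b)) a =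
    -(Γ.quadExt (Coalgebra.comul (R := ℂ) b * Coalgebra.comul (R := ℂ) a)
      - Γ.quadExt ((1 ⊗ₜ b) * Coalgebra.comul (R := ℂ) a)
      - Γ.quadExt ((b ⊗ₜ 1) * Coalgebra.comul (R := ℂ) a)
      + Coalgebra.counit (R := ℂ) b • Γ.quadExt (Coalgebra.comul (R := ℂ) a)) := by
  have h := Γ.act_quadExt (Coalgebra.comul (R := ℂ) b) a
  rw [Coalgebra.rTensor_counit_comul, Coalgebra.lTensor_counit_comul] at h
  simp only [TensorProduct.lid_tmul, TensorProduct.rid_tmul, one_smul] at h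
  rw [← h, dGen_pi', ← actLin_apply, map_neg, LinearMap.neg_apply]

/-- `π(a₁) (ϑ ∘ a₂) + d(ϑ ∘ a) = dϑ ∘ a - (ϑ ∘ a₁) π(a₂)`. -/
lemma conv_pi_act (θ : Γ.Inv) :
    Γ.conv (Γ.inc ∘ₗ Γ.pi) (Γ.act (Γ.inc θ)) + Γ.dGen ∘ₗ Γ.circ θ
      = Γ.act (Γ.dGen θ) - Γ.conv (Γ.act (Γ.inc θ)) (Γ.inc ∘ₗ Γ.pi) := by
  obtain ⟨b, rfl⟩ := Γ.pi_surjective θ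
  ext a
  have h1 : ∀ t : A ⊗[ℂ] A, LinearMap.mul' ℂ Γ.InvExt
      (TensorProduct.map (Γ.inc ∘ₗ Γ.pi) (Γ.act (Γ.inc (Γ.pi b))) t)
      = Γ.quadExt ((1 ⊗ₜ b) * t) - Coalgebra.counit (R := ℂ) b • Γ.quadExt t := by
    intro t
    induction t with
    | zero => simp
    | add x y hx hy => simp only [map_add, hx, hy, mul_add, smul_add]; abel
    | tmul x y => simp [act_inc, circ_pi, mul_sub]
  have h2 : ∀ t : A ⊗[ℂ] A, LinearMap.mul' ℂ Γ.InvExt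
      (TensorProduct.map (Γ.act (Γ.inc (Γ.pi b))) (Γ.inc ∘ₗ Γ.pi) t)
      = Γ.quadExt ((b ⊗ₜ 1) * t) - Coalgebra.counit (R := ℂ) b • Γ.quadExt t := by
    intro t
    induction t with
    | zero => simp
    | add x y hx hy => simp only [map_add, hx, hy, mul_add, smul_add]; abel
    | tmul x y => simp [act_inc, circ_pi, sub_mul]
  -- Every term is now `quadExt` of one of `Δ(b) Δ(a)`, `(1 ⊗ b) Δ(a)`, `(b ⊗ 1) Δ(a)` and `Δ(a)`,
  -- and the coefficients agree.
  rw [LinearMap.sub_apply, act_dGen_pi]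
  simp only [conv, LinearMap.add_apply, LinearMap.comp_apply, h1, h2,
    circ_pi, map_sub, map_smul, dGen_pi', Bialgebra.comul_mul]
  module

/-! ## The contraction operator on `Γ_inv^∧` -/

/-- The left action `ξ (ϑ ⊗ ζ) = ∑ ϑₖ ⊗ (ξ ∘ cₖ) ζ` of `Γ_inv^∧` on `Γ_inv ⊗ Γ_inv^∧`, where
`ϖ(ϑ) = ∑ ϑₖ ⊗ cₖ`. -/
def leftAct : Γ.InvExt →ₗ[ℂ] Module.End ℂ (Γ.Inv ⊗[ℂ] Γ.InvExt) :=
  Γ.convAct Γ.varpi ∘ₗ Γ.actLin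

lemma leftAct_apply (ξ : Γ.InvExt) : Γ.leftAct ξ = Γ.convAct Γ.varpi (Γ.act ξ) := rfl

lemma leftAct_one : Γ.leftAct 1 = 1 := Γ.convAct_counit Γ.varpi_counit

/-- The map `a ⊗ b ↦ π(a) ⊗ π(b) ζ`. -/
def pairMap (ζ : Γ.InvExt) : A ⊗[ℂ] A →ₗ[ℂ] Γ.Inv ⊗[ℂ] Γ.InvExt :=
  TensorProduct.map Γ.pi (LinearMap.mulRight ℂ ζ ∘ₗ Γ.inc ∘ₗ Γ.pi)

@[simp] lemma pairMap_tmul (ζ : Γ.InvExt) (a b : A) :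
    Γ.pairMap ζ (a ⊗ₜ b) = Γ.pi a ⊗ₜ (Γ.inc (Γ.pi b) * ζ) := rfl

/-- The map `a ⊗ b ↦ π(a) (π(b) ⊗ ζ)`. -/
def braidMap (ζ : Γ.InvExt) : A ⊗[ℂ] A →ₗ[ℂ] Γ.Inv ⊗[ℂ] Γ.InvExt :=
  TensorProduct.lift ((Γ.leftAct ∘ₗ Γ.inc ∘ₗ Γ.pi).compl₂
    ((TensorProduct.mk ℂ Γ.Inv Γ.InvExt).flip ζ ∘ₗ Γ.pi))

@[simp] lemma braidMap_tmul (ζ : Γ.InvExt) (a b : A) :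
    Γ.braidMap ζ (a ⊗ₜ b) = Γ.leftAct (Γ.inc (Γ.pi a)) (Γ.pi b ⊗ₜ ζ) := rfl

/-- The point is that the left-hand side depends on `a` only through `π(a)`, so it vanishes on `ℛ`.
-/
lemma pairMap_ad (ζ : Γ.InvExt) (a : A) :
    Γ.pairMap ζ (ad A a) = piMul Γ Γ.varpi (Γ.pi a ⊗ₜ ζ) := by
  rw [piMul_tmul, varpi_pi]
  generalize ad A a = t
  induction t with
  | zero => simp
  | add x y hx hy => simp only [map_add, hx, hy]
  | tmul x y => simp

/-- Moving `π(x)` past `π(y)` produces `π(y₂) ⊗ (π(x κ(y₁) y₃) - ε(x) π(κ(y₁) y₃)) ζ`. For `x ⊗ y =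
Δ(a)` the first term is unchanged by `adTwist_comul`, and the counit turns the second into `ad(a)`.
-/
lemma braidMap_comul (ζ : Γ.InvExt) (a : A) :
    Γ.braidMap ζ (Coalgebra.comul (R := ℂ) a)
      = Γ.pairMap ζ (Coalgebra.comul (R := ℂ) a) - Γ.pairMap ζ (ad A a) := by
  have h : ∀ s : A ⊗[ℂ] A, Γ.braidMap ζ s = Γ.pairMap ζ (adTwist s)
      - Γ.pairMap ζ (ad A (TensorProduct.lid ℂ A (Coalgebra.counit.rTensor A s))) := by
    intro s
    induction s with
    | zero => simp
    | add x y hx hy => simp only [map_add, hx, hy]; abel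
    | tmul x y =>
      simp only [braidMap_tmul, adTwist, TensorProduct.lift.tmul, LinearMap.mk₂_apply,
        LinearMap.rTensor_tmul, TensorProduct.lid_tmul, map_smul, leftAct_apply, convAct_tmul,
        varpi_pi]
      generalize ad A y = t
      induction t with
      | zero => simp
      | add x y hx hy => simp only [map_add, mul_add, smul_add, hx, hy]; abel
      | tmul p q => simp [act_inc, circ_pi, sub_mul, TensorProduct.tmul_sub]
  rw [h, adTwist_comul, Coalgebra.rTensor_counit_comul, TensorProduct.lid_tmul, one_smul]

/-- The operators `(m, ζ) ↦ (ϑ ⊗ ζ - ϑ m, ϑ ζ)` on `(Γ_inv ⊗ Γ_inv^∧) × Γ_inv^∧`. -/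
def contractGen : Γ.Inv →ₗ[ℂ] Module.End ℂ ((Γ.Inv ⊗[ℂ] Γ.InvExt) × Γ.InvExt) where
  toFun θ := ((TensorProduct.mk ℂ Γ.Inv Γ.InvExt θ).comp (LinearMap.snd ℂ _ _)
      - (Γ.leftAct (Γ.inc θ)).comp (LinearMap.fst ℂ _ _)).prod
    ((LinearMap.mulLeft ℂ (Γ.inc θ)).comp (LinearMap.snd ℂ _ _))
  map_add' x y := by
    refine LinearMap.ext fun m => Prod.ext ?_ ?_
    · simp; abel
    · simp [add_mul]
  map_smul' c x := by
    refine LinearMap.ext fun m => Prod.ext ?_ ?_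
    · simp [TensorProduct.smul_tmul', smul_sub]
    · simp

lemma contractGen_apply (θ : Γ.Inv) (m : (Γ.Inv ⊗[ℂ] Γ.InvExt) × Γ.InvExt) :
    Γ.contractGen θ m = (θ ⊗ₜ m.2 - Γ.leftAct (Γ.inc θ) m.1, Γ.inc θ * m.2) := rfl

end

section

variable {A : Type*} [Ring A] [HopfAlgebra ℂ A] [StarRing A] [StarModule ℂ A]
  [CompactMatrixQuantumGroup A] (Γ : BicovariantCalculus A)

/-- Multiplicativity of `∘` is a convolution identity, and `ϖ` is coassociative. -/
lemma leftAct_mul (x y : Γ.InvExt) : Γ.leftAct (x * y) = Γ.leftAct x * Γ.leftAct y := by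
  rw [leftAct_apply, act_mul', Γ.convAct_conv Γ.varpi_coassoc]; rfl

/-- The composite of two generators expands as a twisted Leibniz rule: its obstruction to respecting
a quadratic relation is `pairMap - braidMap`. -/
lemma contractGen_quad (s : A ⊗[ℂ] A) (m : (Γ.Inv ⊗[ℂ] Γ.InvExt) × Γ.InvExt) :
    LinearMap.mul' ℂ _ (TensorProduct.map (Γ.contractGen ∘ₗ Γ.pi) (Γ.contractGen ∘ₗ Γ.pi) s) m
      = (Γ.pairMap m.2 s - Γ.braidMap m.2 s + Γ.leftAct (Γ.quadExt s) m.1,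
        Γ.quadExt s * m.2) := by
  induction s with
  | zero => simp; rfl
  | add x y hx hy =>
    simp only [map_add, LinearMap.add_apply, hx, hy, Prod.mk_add_mk, add_mul]
    congr 1; abel
  | tmul x y =>
    simp only [TensorProduct.map_tmul, LinearMap.mul'_apply, LinearMap.comp_apply,
      Module.End.mul_apply, contractGen_apply, pairMap_tmul, braidMap_tmul, quadExt_tmul,
      leftAct_mul, map_sub, mul_assoc]
    congr 1; abel

/-- A derivation into a left module is encoded as an algebra homomorphism into operators. For `r ∈
ℛ` the obstruction `pairMap - braidMap` on `Δ(r)` equals `pairMap` of `ad(r)`, which factors through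
`π(r) = 0`. -/
def contractHom : Γ.InvExt →ₐ[ℂ] Module.End ℂ ((Γ.Inv ⊗[ℂ] Γ.InvExt) × Γ.InvExt) :=
  Γ.extLift Γ.contractGen fun r hr => by
    refine LinearMap.ext fun m => ?_
    have h : Γ.quadExt (Coalgebra.comul (R := ℂ) r) = 0 := Γ.inc_quad hr
    rw [contractGen_quad, h, braidMap_comul, pairMap_ad, Γ.pi_eq_zero hr]
    simp

/-- The graded derivation `t : Γ_inv^∧ → Γ_inv ⊗ Γ_inv^∧` with `t(ϑ) = ϑ ⊗ 1`, so that
`t(ϑ η) = ϑ ⊗ η - ϑ t(η)`. -/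
def contract : Γ.InvExt →ₗ[ℂ] Γ.Inv ⊗[ℂ] Γ.InvExt :=
  LinearMap.fst ℂ _ _ ∘ₗ LinearMap.applyₗ ((0 : Γ.Inv ⊗[ℂ] Γ.InvExt), (1 : Γ.InvExt))
    ∘ₗ Γ.contractHom.toLinearMap

lemma contractHom_inc (θ : Γ.Inv) : Γ.contractHom (Γ.inc θ) = Γ.contractGen θ :=
  Γ.extLift_inc _ _ _

/-- The second coordinate merely remembers the element, so that the first satisfies the derivation
rule. -/
lemma contractHom_apply (η : Γ.InvExt) : Γ.contractHom η (0, 1) = (Γ.contract η, η) := by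
  refine Prod.ext rfl ?_
  have h : LinearMap.snd ℂ _ _ ∘ₗ LinearMap.applyₗ ((0 : Γ.Inv ⊗[ℂ] Γ.InvExt), (1 : Γ.InvExt))
    ∘ₗ Γ.contractHom.toLinearMap = LinearMap.id := by
    refine Γ.invExt_linearMap_ext (by simp) fun x η hη => ?_
    simp only [LinearMap.comp_apply, AlgHom.toLinearMap_apply, LinearMap.applyₗ_apply_apply,
      LinearMap.snd_apply, LinearMap.id_apply, map_mul, contractHom_inc, Module.End.mul_apply,
      contractGen_apply] at hη ⊢
    rw [hη]
  exact DFunLike.congr_fun h η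

lemma contract_one : Γ.contract 1 = 0 := by simp [contract]

lemma contract_inc_mul (θ : Γ.Inv) (η : Γ.InvExt) :
    Γ.contract (Γ.inc θ * η) = θ ⊗ₜ η - Γ.leftAct (Γ.inc θ) (Γ.contract η) := by
  have h := Γ.contractHom_apply (Γ.inc θ * η)
  rw [map_mul, Module.End.mul_apply, contractHom_apply, contractHom_inc, contractGen_apply] at h
  exact (congrArg Prod.fst h).symm

lemma contract_quadExt_mul (s : A ⊗[ℂ] A) (η : Γ.InvExt) :
    Γ.contract (Γ.quadExt s * η)
      = Γ.pairMap η s - Γ.braidMap η s + Γ.leftAct (Γ.quadExt s) (Γ.contract η) := by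
  induction s with
  | zero => simp
  | add x y hx hy => simp only [map_add, LinearMap.add_apply, hx, hy, add_mul]; abel
  | tmul x y =>
    simp only [quadExt_tmul, mul_assoc, contract_inc_mul, map_sub, pairMap_tmul, braidMap_tmul,
      leftAct_mul, Module.End.mul_apply]
    abel

/-- The part of the contraction that hits `dπ(a) = -π(a₁) π(a₂)` is `pairMap - braidMap` on `Δ(a)`,
that is, `ad(a)`; this is where `ϖ` enters. -/
lemma contract_dGen_mul (θ : Γ.Inv) (η : Γ.InvExt) :
    Γ.contract (Γ.dGen θ * η)
      = Γ.leftAct (Γ.dGen θ) (Γ.contract η) - piMul Γ Γ.varpi (θ ⊗ₜ η) := by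
  obtain ⟨a, rfl⟩ := Γ.pi_surjective θ
  rw [dGen_pi', neg_mul, map_neg, contract_quadExt_mul, braidMap_comul, pairMap_ad, map_neg,
    LinearMap.neg_apply]
  abel

/-- A graded Leibniz rule for `D` along the left action. It is `conv_pi_act` carried over to
operators, with the differential moved past by `lTensor_dInv_convAct`. -/
lemma comodD_leftAct (θ : Γ.Inv) : Γ.comodD Γ.varpi * Γ.leftAct (Γ.inc θ)
    = Γ.leftAct (Γ.dGen θ) - Γ.leftAct (Γ.inc θ) * Γ.comodD Γ.varpi := by
  have h1 := Γ.lTensor_dInv_convAct Γ.varpi (Γ.circ θ)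
  rw [← act_inc'] at h1
  have h2 := congrArg (Γ.convAct Γ.varpi) (Γ.conv_pi_act θ)
  rw [map_add, map_sub, Γ.convAct_conv Γ.varpi_coassoc, Γ.convAct_conv Γ.varpi_coassoc] at h2
  rw [comodD, piMul_eq_convAct, leftAct_apply, leftAct_apply, add_mul, mul_add, h1]
  refine LinearMap.ext fun m => ?_
  have h3 := DFunLike.congr_fun h2 m
  simp only [LinearMap.add_apply, LinearMap.sub_apply] at h3 ⊢
  rw [← add_sub_assoc, h3, sub_sub]

/-- The contraction anticommutes with the differentials. -/
lemma contract_dInv (η : Γ.InvExt) :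
    Γ.contract (Γ.dInv η) + Γ.comodD Γ.varpi (Γ.contract η) = 0 := by
  have h : Γ.contract ∘ₗ Γ.dInv = -(Γ.comodD Γ.varpi ∘ₗ Γ.contract) := by
    -- In the step for `ϑ η`, the term `-ϖ` in the contraction of `dϑ η` is exactly the coaction
    -- part of `-D(ϑ ⊗ η)`; the remaining terms match by the two Leibniz rules.
    refine Γ.invExt_linearMap_ext (by simp [dInv_one, contract_one]) fun x η hη => ?_
    simp only [LinearMap.comp_apply, LinearMap.neg_apply] at hη ⊢
    have h1 := DFunLike.congr_fun (Γ.comodD_leftAct x) (Γ.contract η)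
    simp only [Module.End.mul_apply, LinearMap.sub_apply] at h1
    rw [dInv_inc_mul, map_sub, contract_dGen_mul, contract_inc_mul, contract_inc_mul, hη, map_sub,
      h1, map_neg]
    simp only [comodD, LinearMap.add_apply, LinearMap.lTensor_tmul]
    abel
  have := DFunLike.congr_fun h η
  simp only [LinearMap.comp_apply, LinearMap.neg_apply] at this
  rw [this, neg_add_cancel]

end

end BicovariantCalculus

namespace BicovariantCalculus

/-! ## The homotopy for comodules -/

section Comodule

variable {A : Type*} [Ring A] [HopfAlgebra ℂ A] [StarRing A] (Γ : BicovariantCalculus A)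
variable {X : Type*} [AddCommGroup X] [Module ℂ X] {Y : Type*} [AddCommGroup Y] [Module ℂ Y]

/-- `comodD` is natural for comodule maps. -/
lemma comodD_comp_rTensor {δ : X →ₗ[ℂ] X ⊗[ℂ] A} {ε : Y →ₗ[ℂ] Y ⊗[ℂ] A} {f : X →ₗ[ℂ] Y}
    (hf : ∀ x, ε (f x) = f.rTensor A (δ x)) :
    Γ.comodD ε ∘ₗ f.rTensor Γ.InvExt = f.rTensor Γ.InvExt ∘ₗ Γ.comodD δ := by
  refine TensorProduct.ext' fun x ζ => ?_
  simp only [LinearMap.comp_apply, LinearMap.rTensor_tmul, comodD, LinearMap.add_apply, piMul_tmul,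
    LinearMap.lTensor_tmul, map_add, hf]
  congr 1
  generalize δ x = t
  induction t with
  | zero => simp
  | add x y hx hy => simp only [map_add, hx, hy]
  | tmul x y => simp

/-- The tensor product of the coaction `δ` on `X` with the adjoint action on `Γ_inv`. -/
def diagCoaction (δ : X →ₗ[ℂ] X ⊗[ℂ] A) : X ⊗[ℂ] Γ.Inv →ₗ[ℂ] (X ⊗[ℂ] Γ.Inv) ⊗[ℂ] A :=
  (LinearMap.mul' ℂ A).lTensor (X ⊗[ℂ] Γ.Inv)
    ∘ₗ (TensorProduct.tensorTensorTensorComm ℂ X A Γ.Inv A).toLinearMap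
    ∘ₗ TensorProduct.map δ Γ.varpi

/-- The contraction `x ⊗ η ↦ x ⊗ t(η)`. -/
def contractX [StarModule ℂ A] [CompactMatrixQuantumGroup A] (X : Type*) [AddCommGroup X]
    [Module ℂ X] : X ⊗[ℂ] Γ.InvExt →ₗ[ℂ] (X ⊗[ℂ] Γ.Inv) ⊗[ℂ] Γ.InvExt :=
  (TensorProduct.assoc ℂ X Γ.Inv Γ.InvExt).symm.toLinearMap ∘ₗ Γ.contract.lTensor X

/-- On the diagonal coaction the coefficients are products `c e`, and `π(c e) = π(c) ∘ e + ε(c)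
π(e)`. The first summand becomes the left action of `π(cₖ)` on `m`; in the second the counit removes
the coaction on `X`. -/
lemma piMul_diagCoaction {δ : X →ₗ[ℂ] X ⊗[ℂ] A}
    (hδ : ∀ x, TensorProduct.rid ℂ X ((Coalgebra.counit (R := ℂ)).lTensor X (δ x)) = x)
    (x : X) (m : Γ.Inv ⊗[ℂ] Γ.InvExt) :
    piMul Γ (Γ.diagCoaction δ) ((TensorProduct.assoc ℂ X Γ.Inv Γ.InvExt).symm (x ⊗ₜ m))
      = (TensorProduct.assoc ℂ X Γ.Inv Γ.InvExt).symm
        (((LinearMap.applyₗ m ∘ₗ Γ.leftAct) ∘ₗ Γ.inc ∘ₗ Γ.pi).lTensor X (δ x)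
          + x ⊗ₜ piMul Γ Γ.varpi m) := by
  induction m with
  | zero => simp
  | add m n hm hn =>
    simp only [TensorProduct.tmul_add, map_add, hm, hn, LinearMap.add_comp, LinearMap.lTensor_add,
      LinearMap.add_apply]
    abel
  | tmul θ ζ =>
    rw [TensorProduct.assoc_symm_tmul, piMul_tmul]
    -- Writing this `x` through the counit makes both sides linear in `δ(x)`, so that one can pass
    -- to simple tensors.
    nth_rw 3 [← hδ x]
    simp only [diagCoaction, LinearMap.comp_apply, TensorProduct.map_tmul, piMul_tmul]
    generalize δ x = t
    induction t with
    | zero => simp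
    | add x y hx hy =>
      simp only [map_add, TensorProduct.add_tmul, hx, hy]
      abel
    | tmul y c =>
      simp only [LinearMap.lTensor_tmul, LinearMap.comp_apply, LinearMap.applyₗ_apply_apply,
        leftAct_apply, convAct_tmul]
      generalize Γ.varpi θ = s
      induction s with
      | zero => simp
      | add p q hp hq =>
        simp only [map_add, TensorProduct.tmul_add, LinearEquiv.coe_coe] at hp hq ⊢
        rw [hp, hq]
        abel
      | tmul χ e =>
        simp [act_inc, circ_pi, sub_mul, TensorProduct.tmul_sub, TensorProduct.smul_tmul]

/-- From `t(π(c) η) = π(c) ⊗ η - π(c) t(η)`, the last term cancels the left action found in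
`piMul_diagCoaction`, and the terms with `x` untouched cancel by `contract_dInv`. Only `π(cₖ) ⊗ η`
survives. -/
lemma contractX_comodD [StarModule ℂ A] [CompactMatrixQuantumGroup A] {δ : X →ₗ[ℂ] X ⊗[ℂ] A}
    (hδ : ∀ x, TensorProduct.rid ℂ X ((Coalgebra.counit (R := ℂ)).lTensor X (δ x)) = x) :
    Γ.contractX X ∘ₗ Γ.comodD δ + Γ.comodD (Γ.diagCoaction δ) ∘ₗ Γ.contractX X
      = (Γ.pi.lTensor X ∘ₗ δ).rTensor Γ.InvExt := by
  refine TensorProduct.ext' fun x η => ?_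
  have h1 := Γ.contract_dInv η
  have h2 : ∀ z : X ⊗[ℂ] (Γ.Inv ⊗[ℂ] Γ.InvExt), Γ.dInv.lTensor (X ⊗[ℂ] Γ.Inv)
      ((TensorProduct.assoc ℂ X Γ.Inv Γ.InvExt).symm z)
      = (TensorProduct.assoc ℂ X Γ.Inv Γ.InvExt).symm ((Γ.dInv.lTensor Γ.Inv).lTensor X z) := by
    intro z
    have : Γ.dInv.lTensor (X ⊗[ℂ] Γ.Inv) ∘ₗ
        (TensorProduct.assoc ℂ X Γ.Inv Γ.InvExt).symm.toLinearMap
        = (TensorProduct.assoc ℂ X Γ.Inv Γ.InvExt).symm.toLinearMap ∘ₗ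
          (Γ.dInv.lTensor Γ.Inv).lTensor X := by
      ext; simp
    exact DFunLike.congr_fun this z
  simp only [LinearMap.add_apply, LinearMap.comp_apply, comodD, contractX, LinearEquiv.coe_coe,
    LinearMap.lTensor_tmul, map_add, piMul_diagCoaction Γ hδ, h2, LinearMap.rTensor_tmul]
  rw [comodD, LinearMap.add_apply] at h1
  have h3 : ∀ t : X ⊗[ℂ] A, Γ.contract.lTensor X (TensorProduct.map LinearMap.id
      (LinearMap.mulRight ℂ η ∘ₗ Γ.inc ∘ₗ Γ.pi) t)
      + ((LinearMap.applyₗ (Γ.contract η) ∘ₗ Γ.leftAct) ∘ₗ Γ.inc ∘ₗ Γ.pi).lTensor X t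
      = TensorProduct.assoc ℂ X Γ.Inv Γ.InvExt (Γ.pi.lTensor X t ⊗ₜ η) := by
    intro t
    induction t with
    | zero => simp
    | add x y hx hy =>
      simp only [map_add, TensorProduct.add_tmul, ← hx, ← hy]
      abel
    | tmul y a =>
      simp [contract_inc_mul, TensorProduct.tmul_sub]
  rw [← (TensorProduct.assoc ℂ X Γ.Inv Γ.InvExt).symm_apply_apply (_ ⊗ₜ η), ← h3]
  rw [piMul_tmul]
  have h4 : x ⊗ₜ[ℂ] Γ.contract (Γ.dInv η) + (x ⊗ₜ[ℂ] piMul Γ Γ.varpi (Γ.contract η)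
      + x ⊗ₜ[ℂ] Γ.dInv.lTensor Γ.Inv (Γ.contract η)) = 0 := by
    rw [← TensorProduct.tmul_add, ← TensorProduct.tmul_add, h1, TensorProduct.tmul_zero]
  simp only [← map_add]
  congr 1
  refine Eq.trans ?_ (add_zero _)
  rw [← h4]
  abel

/-- A comodule map `μ : X ⊗ Γ_inv → Y` gives a homotopy between `0` and
`x ⊗ η ↦ ∑ μ(xₖ ⊗ π(cₖ)) ⊗ η`. -/
lemma homotopy [StarModule ℂ A] [CompactMatrixQuantumGroup A] {δ : X →ₗ[ℂ] X ⊗[ℂ] A}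
    {ε : Y →ₗ[ℂ] Y ⊗[ℂ] A}
    (hδ : ∀ x, TensorProduct.rid ℂ X ((Coalgebra.counit (R := ℂ)).lTensor X (δ x)) = x)
    {μ : X ⊗[ℂ] Γ.Inv →ₗ[ℂ] Y} (hμ : ∀ z, ε (μ z) = μ.rTensor A (Γ.diagCoaction δ z)) :
    (μ.rTensor Γ.InvExt ∘ₗ Γ.contractX X) ∘ₗ Γ.comodD δ
      + Γ.comodD ε ∘ₗ (μ.rTensor Γ.InvExt ∘ₗ Γ.contractX X)
      = (μ ∘ₗ Γ.pi.lTensor X ∘ₗ δ).rTensor Γ.InvExt := by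
  rw [← LinearMap.comp_assoc (Γ.contractX X), Γ.comodD_comp_rTensor hμ, LinearMap.comp_assoc,
    LinearMap.comp_assoc, ← LinearMap.comp_add, Γ.contractX_comodD hδ, ← LinearMap.rTensor_comp]

/-- Multiplicativity of the coproduct makes the diagonal coaction coassociative; complete
reducibility is later applied to this comodule. -/
lemma diagCoaction_coassoc [StarModule ℂ A] [CompactMatrixQuantumGroup A] {δ : X →ₗ[ℂ] X ⊗[ℂ] A}
    (hδ : ∀ x, TensorProduct.assoc ℂ X A A (δ.rTensor A (δ x))
      = (Coalgebra.comul (R := ℂ)).lTensor X (δ x)) (z : X ⊗[ℂ] Γ.Inv) :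
    TensorProduct.assoc ℂ (X ⊗[ℂ] Γ.Inv) A A
      ((Γ.diagCoaction δ).rTensor A (Γ.diagCoaction δ z))
      = (Coalgebra.comul (R := ℂ)).lTensor (X ⊗[ℂ] Γ.Inv) (Γ.diagCoaction δ z) := by
  induction z with
  | zero => simp
  | add x y hx hy => simp only [map_add, hx, hy]
  | tmul x θ =>
    let H : (X ⊗[ℂ] (A ⊗[ℂ] A)) ⊗[ℂ] (Γ.Inv ⊗[ℂ] (A ⊗[ℂ] A)) →ₗ[ℂ]
        (X ⊗[ℂ] Γ.Inv) ⊗[ℂ] (A ⊗[ℂ] A) :=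
      (LinearMap.mul' ℂ (A ⊗[ℂ] A)).lTensor (X ⊗[ℂ] Γ.Inv)
        ∘ₗ (TensorProduct.tensorTensorTensorComm ℂ X (A ⊗[ℂ] A) Γ.Inv (A ⊗[ℂ] A)).toLinearMap
    have h1 : ∀ (t : X ⊗[ℂ] A) (s : Γ.Inv ⊗[ℂ] A), TensorProduct.assoc ℂ (X ⊗[ℂ] Γ.Inv) A A
        ((Γ.diagCoaction δ).rTensor A ((LinearMap.mul' ℂ A).lTensor (X ⊗[ℂ] Γ.Inv)
          (TensorProduct.tensorTensorTensorComm ℂ X A Γ.Inv A (t ⊗ₜ s))))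
        = H (TensorProduct.assoc ℂ X A A (δ.rTensor A t) ⊗ₜ
          TensorProduct.assoc ℂ Γ.Inv A A (Γ.varpi.rTensor A s)) := by
      intro t s
      induction t with
      | zero => simp
      | add x y hx hy => simp only [map_add, TensorProduct.add_tmul, hx, hy]
      | tmul x a =>
        induction s with
        | zero => simp
        | add x y hx hy => simp only [map_add, TensorProduct.tmul_add, hx, hy]
        | tmul θ b =>
          simp only [TensorProduct.tensorTensorTensorComm_tmul, LinearMap.lTensor_tmul,
            LinearMap.rTensor_tmul, diagCoaction, LinearMap.comp_apply, TensorProduct.map_tmul]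
          generalize δ x = t
          generalize Γ.varpi θ = s
          induction t with
          | zero => simp
          | add x y hx hy => simp only [map_add, TensorProduct.add_tmul, hx, hy]
          | tmul x p =>
            induction s with
            | zero => simp
            | add x y hx hy =>
              simp only [map_add, TensorProduct.tmul_add, TensorProduct.add_tmul, hx, hy]
            | tmul θ q => simp [H]
    have h2 : ∀ (t : X ⊗[ℂ] A) (s : Γ.Inv ⊗[ℂ] A),
        (Coalgebra.comul (R := ℂ)).lTensor (X ⊗[ℂ] Γ.Inv) ((LinearMap.mul' ℂ A).lTensor
          (X ⊗[ℂ] Γ.Inv) (TensorProduct.tensorTensorTensorComm ℂ X A Γ.Inv A (t ⊗ₜ s)))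
        = H ((Coalgebra.comul (R := ℂ)).lTensor X t ⊗ₜ
          (Coalgebra.comul (R := ℂ)).lTensor Γ.Inv s) := by
      intro t s
      induction t with
      | zero => simp
      | add x y hx hy => simp only [map_add, TensorProduct.add_tmul, hx, hy]
      | tmul x a =>
        induction s with
        | zero => simp
        | add x y hx hy => simp only [map_add, TensorProduct.tmul_add, hx, hy]
        | tmul θ b => simp [H, Bialgebra.comul_mul]
    have h3 : Γ.diagCoaction δ (x ⊗ₜ θ) = (LinearMap.mul' ℂ A).lTensor (X ⊗[ℂ] Γ.Inv)
          (TensorProduct.tensorTensorTensorComm ℂ X A Γ.Inv A (δ x ⊗ₜ Γ.varpi θ)) := rfl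
    rw [h3, h1, h2, hδ, varpi_coassoc]

lemma diagCoaction_counit {δ : X →ₗ[ℂ] X ⊗[ℂ] A}
    (hδ : ∀ x, TensorProduct.rid ℂ X ((Coalgebra.counit (R := ℂ)).lTensor X (δ x)) = x)
    (z : X ⊗[ℂ] Γ.Inv) : TensorProduct.rid ℂ (X ⊗[ℂ] Γ.Inv)
      ((Coalgebra.counit (R := ℂ)).lTensor (X ⊗[ℂ] Γ.Inv) (Γ.diagCoaction δ z)) = z := by
  induction z with
  | zero => simp
  | add x y hx hy => simp only [map_add, hx, hy]
  | tmul x θ =>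
    conv_rhs => rw [← hδ x, ← Γ.varpi_counit θ]
    simp only [diagCoaction, LinearMap.comp_apply, TensorProduct.map_tmul]
    generalize δ x = t
    generalize Γ.varpi θ = s
    induction t with
    | zero => simp
    | add x y hx hy => simp only [map_add, TensorProduct.add_tmul, hx, hy]
    | tmul x p =>
      induction s with
      | zero => simp
      | add x y hx hy => simp only [map_add, TensorProduct.tmul_add, hx, hy]
      | tmul θ q => simp [TensorProduct.smul_tmul', TensorProduct.tmul_smul, smul_smul, mul_comm]

end Comodule

end BicovariantCalculus

/-! ## Complete reducibility -/

section ComodModule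

variable {A : Type*} [Ring A] [HopfAlgebra ℂ A]
variable {X : Type*} [AddCommGroup X] [Module ℂ X] {Y : Type*} [AddCommGroup Y] [Module ℂ Y]

/-- The evaluation `x ⊗ a ↦ f(a) x` of the second factor. -/
def evalRight (X : Type*) [AddCommGroup X] [Module ℂ X] (f : A →ₗ[ℂ] ℂ) : X ⊗[ℂ] A →ₗ[ℂ] X :=
  (TensorProduct.rid ℂ X).toLinearMap ∘ₗ f.lTensor X

@[simp] lemma evalRight_tmul (f : A →ₗ[ℂ] ℂ) (x : X) (a : A) :
    evalRight X f (x ⊗ₜ a) = f a • x := by simp [evalRight]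

/-- The coordinates of a basis of `A` already separate elements. This is why commuting with all
functionals is the same as being a comodule map. -/
lemma evalRight_ext {z w : X ⊗[ℂ] A} (h : ∀ f, evalRight X f z = evalRight X f w) : z = w := by
  classical
  let b := Module.Basis.ofVectorSpace ℂ A
  refine (TensorProduct.equivFinsuppOfBasisRight b).injective (Finsupp.ext fun i => ?_)
  rw [TensorProduct.equivFinsuppOfBasisRight_apply, TensorProduct.equivFinsuppOfBasisRight_apply]
  exact h (b.coord i)

lemma evalRight_rTensor (f : A →ₗ[ℂ] ℂ) (g : X →ₗ[ℂ] Y) (z : X ⊗[ℂ] A) :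
    evalRight Y f (g.rTensor A z) = g (evalRight X f z) := by
  induction z with
  | zero => simp
  | add x y hx hy => simp only [map_add, hx, hy]
  | tmul x y => simp

/-- The space `X`, considered as a module over the free algebra on the linear functionals of `A`;
a functional `f` acts by `x ↦ ∑ f(cₖ) xₖ`, where `δ(x) = ∑ xₖ ⊗ cₖ`. -/
def ComodModule (_δ : X →ₗ[ℂ] X ⊗[ℂ] A) : Type _ := X

variable (δ : X →ₗ[ℂ] X ⊗[ℂ] A) (ε : Y →ₗ[ℂ] Y ⊗[ℂ] A)

instance : AddCommGroup (ComodModule δ) := inferInstanceAs (AddCommGroup X)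

/-- The identity map `X → X`, with values in the module. -/
def ComodModule.of : X ≃+ ComodModule δ := AddEquiv.refl X

/-- With a free algebra there are no relations to check, so neither coassociativity nor the counit
axiom is required of `δ`. -/
def comodRep : FreeAlgebra ℂ (A →ₗ[ℂ] ℂ) →ₐ[ℂ] Module.End ℂ X :=
  FreeAlgebra.lift ℂ fun f => evalRight X f ∘ₗ δ

instance : Module (FreeAlgebra ℂ (A →ₗ[ℂ] ℂ)) (ComodModule δ) :=
  Module.compHom X (comodRep δ).toRingHom

lemma ComodModule.smul_of (r : FreeAlgebra ℂ (A →ₗ[ℂ] ℂ)) (x : X) :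
    r • ComodModule.of δ x = ComodModule.of δ (comodRep δ r x) := rfl

lemma ComodModule.of_symm_smul (r : FreeAlgebra ℂ (A →ₗ[ℂ] ℂ)) (m : ComodModule δ) :
    (ComodModule.of δ).symm (r • m) = comodRep δ r ((ComodModule.of δ).symm m) := rfl

lemma comodRep_ι (f : A →ₗ[ℂ] ℂ) (x : X) :
    comodRep δ (FreeAlgebra.ι ℂ f) x = evalRight X f (δ x) := by
  simp [comodRep]

lemma comodRep_algebraMap (c : ℂ) (x : X) : comodRep δ (algebraMap ℂ _ c) x = c • x := by
  rw [AlgHom.commutes]; rfl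

variable {δ ε}

/-- A subspace that is invariant under all functionals, as a submodule. -/
def invariantSubmodule (S : Submodule ℂ X) (hS : ∀ f, ∀ x ∈ S, evalRight X f (δ x) ∈ S) :
    Submodule (FreeAlgebra ℂ (A →ₗ[ℂ] ℂ)) (ComodModule δ) where
  carrier := {m | (ComodModule.of δ).symm m ∈ S}
  add_mem' {a b} ha hb := by
    rw [Set.mem_ofPred_eq, map_add]; exact S.add_mem ha hb
  zero_mem' := by rw [Set.mem_ofPred_eq, map_zero]; exact S.zero_mem
  smul_mem' r m hm := by
    rw [Set.mem_ofPred_eq] at hm ⊢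
    rw [ComodModule.of_symm_smul]
    generalize (ComodModule.of δ).symm m = x at hm ⊢
    induction r using FreeAlgebra.induction generalizing x with
    | grade0 c => rw [comodRep_algebraMap]; exact S.smul_mem c hm
    | grade1 f => rw [comodRep_ι]; exact hS f x hm
    | mul a b ha hb => rw [map_mul]; exact ha _ (hb _ hm)
    | add a b ha hb => rw [map_add]; exact S.add_mem (ha _ hm) (hb _ hm)

/-- A submodule as a subspace. -/
def subspaceOf (W : Submodule (FreeAlgebra ℂ (A →ₗ[ℂ] ℂ)) (ComodModule δ)) : Submodule ℂ X where
  carrier := {x | ComodModule.of δ x ∈ W}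
  add_mem' {a b} ha hb := by
    rw [Set.mem_ofPred_eq, map_add]; exact W.add_mem ha hb
  zero_mem' := by rw [Set.mem_ofPred_eq, map_zero]; exact W.zero_mem
  smul_mem' c x hx := by
    rw [Set.mem_ofPred_eq] at hx ⊢
    have h := W.smul_mem (algebraMap ℂ _ c) hx
    rwa [ComodModule.smul_of, comodRep_algebraMap] at h

lemma evalRight_mem_subspaceOf (W : Submodule (FreeAlgebra ℂ (A →ₗ[ℂ] ℂ)) (ComodModule δ))
    (f : A →ₗ[ℂ] ℂ) {x : X} (hx : x ∈ subspaceOf W) : evalRight X f (δ x) ∈ subspaceOf W := by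
  have h : FreeAlgebra.ι ℂ f • ComodModule.of δ x ∈ W := W.smul_mem _ hx
  rwa [ComodModule.smul_of, comodRep_ι] at h

lemma comodRep_intertwines {g : X →ₗ[ℂ] Y} (hg : ∀ x, ε (g x) = g.rTensor A (δ x))
    (r : FreeAlgebra ℂ (A →ₗ[ℂ] ℂ)) (x : X) : g (comodRep δ r x) = comodRep ε r (g x) := by
  induction r using FreeAlgebra.induction generalizing x with
  | grade0 c => rw [comodRep_algebraMap, comodRep_algebraMap, map_smul]
  | grade1 f => rw [comodRep_ι, comodRep_ι, hg, evalRight_rTensor]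
  | mul a b ha hb =>
    rw [map_mul, map_mul, Module.End.mul_apply, Module.End.mul_apply, ← hb, ha]
  | add a b ha hb =>
    rw [map_add, map_add, LinearMap.add_apply, LinearMap.add_apply, map_add, ha, hb]

/-- A comodule map as a module map. -/
def moduleHom (g : X →ₗ[ℂ] Y) (hg : ∀ x, ε (g x) = g.rTensor A (δ x)) :
    ComodModule δ →ₗ[FreeAlgebra ℂ (A →ₗ[ℂ] ℂ)] ComodModule ε where
  toFun m := ComodModule.of ε (g ((ComodModule.of δ).symm m))
  map_add' a b := by simp only [map_add]
  map_smul' r m := by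
    rw [ComodModule.of_symm_smul, comodRep_intertwines hg, RingHom.id_apply, ComodModule.smul_of]

/-- A module map as a linear map. -/
def linearMapOf (h : ComodModule δ →ₗ[FreeAlgebra ℂ (A →ₗ[ℂ] ℂ)] ComodModule ε) : X →ₗ[ℂ] Y where
  toFun x := (ComodModule.of ε).symm (h (ComodModule.of δ x))
  map_add' a b := by simp only [map_add]
  map_smul' c x := by
    rw [RingHom.id_apply, ← comodRep_algebraMap δ, ← comodRep_algebraMap ε, ← ComodModule.smul_of,
      map_smul, ComodModule.of_symm_smul]

lemma linearMapOf_intertwines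
    (h : ComodModule δ →ₗ[FreeAlgebra ℂ (A →ₗ[ℂ] ℂ)] ComodModule ε) (x : X) :
    ε (linearMapOf h x) = (linearMapOf h).rTensor A (δ x) := by
  refine evalRight_ext fun f => ?_
  rw [evalRight_rTensor, ← comodRep_ι, ← comodRep_ι]
  simp only [linearMapOf, LinearMap.coe_mk, AddHom.coe_mk]
  rw [← ComodModule.smul_of, map_smul, ComodModule.of_symm_smul]

end ComodModule

/-! ### Unitary representations as semisimple comodules. -/

namespace UnitaryRep

variable {A : Type*} [Ring A] [HopfAlgebra ℂ A] [StarRing A] {n : ℕ}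

lemma coaction_single (u : UnitaryRep A n) (i : Fin n) :
    u.coaction (Pi.single i 1) = ∑ j, (Pi.single j (1 : ℂ)) ⊗ₜ[ℂ] u.mat j i := by
  have h := (Pi.basisFun ℂ (Fin n)).constr_basis ℂ
    (fun i => ∑ j, (Pi.single j (1 : ℂ) : Fin n → ℂ) ⊗ₜ[ℂ] u.mat j i) i
  rwa [Pi.basisFun_apply] at h

lemma coaction_apply (u : UnitaryRep A n) (x : Fin n → ℂ) :
    u.coaction x = ∑ i, ∑ j, x i • (Pi.single j (1 : ℂ)) ⊗ₜ[ℂ] u.mat j i := by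
  conv_lhs => rw [← Finset.univ_sum_single x]
  rw [map_sum]
  refine Finset.sum_congr rfl fun i _ => ?_
  have : (Pi.single i (x i) : Fin n → ℂ) = x i • Pi.single i 1 := by
    rw [← Pi.single_smul, smul_eq_mul, mul_one]
  rw [this, map_smul, coaction_single, Finset.smul_sum]

lemma evalRight_coaction (u : UnitaryRep A n) (f : A →ₗ[ℂ] ℂ) (x : Fin n → ℂ) (j : Fin n) :
    evalRight _ f (u.coaction x) j = ∑ i, x i * f (u.mat j i) := by
  rw [coaction_apply]
  simp [map_sum, Finset.sum_apply, Pi.single_apply, mul_comm]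

lemma coaction_coassoc (u : UnitaryRep A n) (x : Fin n → ℂ) :
    TensorProduct.assoc ℂ _ A A (u.coaction.rTensor A (u.coaction x))
      = (Coalgebra.comul (R := ℂ)).lTensor _ (u.coaction x) := by
  have : (TensorProduct.assoc ℂ _ A A).toLinearMap ∘ₗ u.coaction.rTensor A ∘ₗ u.coaction
      = (Coalgebra.comul (R := ℂ)).lTensor _ ∘ₗ u.coaction := by
    refine (Pi.basisFun ℂ (Fin n)).ext fun i => ?_
    simp only [Pi.basisFun_apply, LinearMap.comp_apply, coaction_single, map_sum,
      LinearMap.rTensor_tmul, LinearMap.lTensor_tmul, LinearEquiv.coe_coe, u.comul_mat,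
      TensorProduct.sum_tmul, TensorProduct.tmul_sum, TensorProduct.assoc_tmul]
    exact Finset.sum_comm
  exact DFunLike.congr_fun this x

lemma coaction_counit (u : UnitaryRep A n) (x : Fin n → ℂ) :
    TensorProduct.rid ℂ _ ((Coalgebra.counit (R := ℂ)).lTensor _ (u.coaction x)) = x := by
  have : (TensorProduct.rid ℂ _).toLinearMap ∘ₗ (Coalgebra.counit (R := ℂ)).lTensor _ ∘ₗ u.coaction
      = LinearMap.id := by
    refine (Pi.basisFun ℂ (Fin n)).ext fun i => ?_
    simp [coaction_single, u.counit_mat]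
  exact DFunLike.congr_fun this x

/-- The adjoint functional `a ↦ conj (f (κ(a)*))`. -/
def adjFunctional [StarModule ℂ A] (f : A →ₗ[ℂ] ℂ) : A →ₗ[ℂ] ℂ where
  toFun a := star (f (star (HopfAlgebra.antipode ℂ a)))
  map_add' a b := by simp
  map_smul' c a := by simp

/-- The matrix of the new functional is the conjugate transpose of that of `f`: adjoints of the
operators given by functionals are again given by functionals. -/
lemma adjFunctional_mat [StarModule ℂ A] (u : UnitaryRep A n) (f : A →ₗ[ℂ] ℂ) (i j : Fin n) :
    adjFunctional f (u.mat i j) = star (f (u.mat j i)) := by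
  simp [adjFunctional, u.antipode_mat]

/-- Unitary representations are completely reducible. -/
instance [StarModule ℂ A] (u : UnitaryRep A n) :
    IsSemisimpleModule (FreeAlgebra ℂ (A →ₗ[ℂ] ℂ)) (ComodModule u.coaction) := by
  refine (isSemisimpleModule_iff _ _).2 ⟨fun W => ?_⟩
  let e := (WithLp.linearEquiv 2 ℂ (Fin n → ℂ))
  let W' : Submodule ℂ (EuclideanSpace ℂ (Fin n)) := (subspaceOf W).comap e.toLinearMap
  let C : Submodule ℂ (Fin n → ℂ) := W'ᗮ.comap e.symm.toLinearMap
  -- The orthogonal complement is invariant because `W` is invariant under the adjoint of each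
  -- operator, namely that of `adjFunctional f`.
  have hC : ∀ f, ∀ x ∈ C, evalRight _ f (u.coaction x) ∈ C := by
    intro f x hx
    change e.symm x ∈ W'ᗮ at hx
    change e.symm _ ∈ W'ᗮ
    rw [Submodule.mem_orthogonal] at hx ⊢
    intro w hw
    have h := hx (e.symm (evalRight _ (adjFunctional f) (u.coaction (e w))))
      (evalRight_mem_subspaceOf W _ hw)
    rw [← h]
    simp only [PiLp.inner_apply, RCLike.inner_apply]
    have h1 : ∀ (y : Fin n → ℂ) (k : Fin n), e.symm y k = y k := fun _ _ => rfl
    have h2 : ∀ k : Fin n, e w k = w k := fun _ => rfl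
    simp only [h1, evalRight_coaction, adjFunctional_mat, h2, map_sum, map_mul, Finset.mul_sum,
      Finset.sum_mul]
    rw [Finset.sum_comm]
    refine Finset.sum_congr rfl fun i _ => Finset.sum_congr rfl fun j _ => ?_
    simp
    ring
  refine ⟨invariantSubmodule C hC, ?_, ?_⟩
  · rw [Submodule.disjoint_def]
    intro x hx hx'
    have h : inner ℂ (e.symm x) (e.symm x) = 0 :=
      Submodule.inner_right_of_mem_orthogonal (K := W') (u := e.symm x) hx hx'
    exact e.symm.injective ((inner_self_eq_zero.1 h).trans (map_zero _).symm)
  · rw [Submodule.codisjoint_iff_exists_add_eq]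
    intro x
    obtain ⟨y, hy, z, hz, h⟩ := W'.exists_add_mem_mem_orthogonal (e.symm x)
    exact ⟨e y, e z, hy, hz, (congrArg e h).symm⟩

end UnitaryRep

/-! ### Free comodules, and complete reducibility of all comodules. -/

section Semisimple

variable {A : Type*} [Ring A] [HopfAlgebra ℂ A] [StarRing A]
variable {X : Type*} [AddCommGroup X] [Module ℂ X] {Y : Type*} [AddCommGroup Y] [Module ℂ Y]

/-- The coaction `x ⊗ a ↦ (x ⊗ a₁) ⊗ a₂`. -/
def freeCoaction (X A : Type*) [Ring A] [HopfAlgebra ℂ A] [AddCommGroup X] [Module ℂ X] :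
    X ⊗[ℂ] A →ₗ[ℂ] (X ⊗[ℂ] A) ⊗[ℂ] A :=
  (TensorProduct.assoc ℂ X A A).symm.toLinearMap ∘ₗ (Coalgebra.comul (R := ℂ)).lTensor X

/-- The map `e i ↦ x ⊗ u j i`. -/
def rowMap {n : ℕ} (u : UnitaryRep A n) (x : X) (j : Fin n) : (Fin n → ℂ) →ₗ[ℂ] X ⊗[ℂ] A :=
  (Pi.basisFun ℂ (Fin n)).constr ℂ fun i => x ⊗ₜ[ℂ] u.mat j i

lemma rowMap_single {n : ℕ} (u : UnitaryRep A n) (x : X) (j i : Fin n) :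
    rowMap u x j (Pi.single i 1) = x ⊗ₜ[ℂ] u.mat j i := by
  have h := (Pi.basisFun ℂ (Fin n)).constr_basis ℂ (fun i => x ⊗ₜ[ℂ] u.mat j i) i
  rwa [Pi.basisFun_apply] at h

lemma freeCoaction_rowMap {n : ℕ} (u : UnitaryRep A n) (x : X) (j : Fin n) (v : Fin n → ℂ) :
    freeCoaction X A (rowMap u x j v) = (rowMap u x j).rTensor A (u.coaction v) := by
  have : freeCoaction X A ∘ₗ rowMap u x j = (rowMap u x j).rTensor A ∘ₗ u.coaction := by
    refine (Pi.basisFun ℂ (Fin n)).ext fun i => ?_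
    simp [rowMap_single, u.coaction_single, freeCoaction, u.comul_mat, TensorProduct.tmul_sum]
  exact DFunLike.congr_fun this v

variable [StarModule ℂ A] [CompactMatrixQuantumGroup A]

/-- The matrix coefficients span `A`, so `X ⊗ A` is the sum of the images of the maps `rowMap`, each
a quotient of a semisimple unitary representation. -/
instance : IsSemisimpleModule (FreeAlgebra ℂ (A →ₗ[ℂ] ℂ)) (ComodModule (freeCoaction X A)) := by
  let p : (Σ n : ℕ, UnitaryRep A n × X × Fin n) →
      Submodule (FreeAlgebra ℂ (A →ₗ[ℂ] ℂ)) (ComodModule (freeCoaction X A)) := fun q =>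
    LinearMap.range (moduleHom (rowMap q.2.1 q.2.2.1 q.2.2.2)
      (freeCoaction_rowMap q.2.1 q.2.2.1 q.2.2.2))
  refine isSemisimpleModule_of_isSemisimpleModule_submodule' (p := p)
    (fun q => IsSemisimpleModule.range _) ?_
  rw [eq_top_iff]
  rintro z -
  obtain ⟨z, rfl⟩ := (ComodModule.of (freeCoaction X A)).surjective z
  change z ∈ subspaceOf (⨆ i, p i)
  induction z with
  | zero => exact zero_mem _
  | add x y hx hy => exact add_mem hx hy
  | tmul x a =>
    refine matrixCoeff_induction
      (p := fun a => x ⊗ₜ[ℂ] a ∈ subspaceOf (δ := freeCoaction X A) (⨆ i, p i)) ?_ ?_ ?_ ?_ a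
    · rw [TensorProduct.tmul_zero]; exact zero_mem _
    · intro a b ha hb
      rw [TensorProduct.tmul_add]; exact add_mem ha hb
    · intro c a ha
      rw [TensorProduct.tmul_smul]; exact Submodule.smul_mem _ c ha
    · intro n u j i
      refine (le_iSup p ⟨n, u, x, j⟩) ?_
      exact ⟨ComodModule.of u.coaction (Pi.single i 1 : Fin n → ℂ), rowMap_single u x j i⟩

/-- Comodules are completely reducible. -/
lemma isSemisimpleModule_comodModule {δ : X →ₗ[ℂ] X ⊗[ℂ] A}
    (hδ : ∀ x, TensorProduct.assoc ℂ X A A (δ.rTensor A (δ x))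
      = (Coalgebra.comul (R := ℂ)).lTensor X (δ x))
    (hδ' : ∀ x, TensorProduct.rid ℂ X ((Coalgebra.counit (R := ℂ)).lTensor X (δ x)) = x) :
    IsSemisimpleModule (FreeAlgebra ℂ (A →ₗ[ℂ] ℂ)) (ComodModule δ) := by
  -- Coassociativity says that `δ` is a comodule map from `X` into the free comodule `X ⊗ A`; the
  -- counit is a left inverse of it, so `X` embeds.
  have h : ∀ x, freeCoaction X A (δ x) = δ.rTensor A (δ x) := fun x => by
    rw [freeCoaction, LinearMap.comp_apply, ← hδ, LinearEquiv.coe_coe,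
      LinearEquiv.symm_apply_apply]
  exact IsSemisimpleModule.of_injective (moduleHom δ h)
    (Function.LeftInverse.injective (g := fun z => TensorProduct.rid ℂ X
      ((Coalgebra.counit (R := ℂ)).lTensor X z)) hδ')

/-- An injective comodule map has a retraction that is a comodule map. -/
lemma exists_retraction {δ : X →ₗ[ℂ] X ⊗[ℂ] A} {ε : Y →ₗ[ℂ] Y ⊗[ℂ] A}
    (hε : ∀ x, TensorProduct.assoc ℂ Y A A (ε.rTensor A (ε x))
      = (Coalgebra.comul (R := ℂ)).lTensor Y (ε x))
    (hε' : ∀ x, TensorProduct.rid ℂ Y ((Coalgebra.counit (R := ℂ)).lTensor Y (ε x)) = x)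
    (s : X →ₗ[ℂ] Y) (hs : ∀ x, ε (s x) = s.rTensor A (δ x)) (hi : Function.Injective s) :
    ∃ r : Y →ₗ[ℂ] X, (∀ y, δ (r y) = r.rTensor A (ε y)) ∧ r ∘ₗ s = LinearMap.id := by
  have := isSemisimpleModule_comodModule hε hε'
  obtain ⟨h, hh⟩ := IsSemisimpleModule.extension_property (moduleHom s hs) hi LinearMap.id
  exact ⟨linearMapOf h, linearMapOf_intertwines h, LinearMap.ext fun x => DFunLike.congr_fun hh x⟩

end Semisimple

/-! ## Comodule maps out of irreducible representations -/

namespace UnitaryRep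

variable {A : Type*} [Ring A] [HopfAlgebra ℂ A] [StarRing A] {n : ℕ}
variable {X : Type*} [AddCommGroup X] [Module ℂ X]

/-- The kernel of a comodule map is invariant: `A` is flat over `ℂ`, so the kernel of `f ⊗ id` is
`ker f ⊗ A`. -/
lemma IsIrreducible.injective {u : UnitaryRep A n} (hu : u.IsIrreducible)
    {δ : X →ₗ[ℂ] X ⊗[ℂ] A} {f : (Fin n → ℂ) →ₗ[ℂ] X}
    (hf : ∀ x, δ (f x) = f.rTensor A (u.coaction x)) (h0 : f ≠ 0) : Function.Injective f := by
  rw [← LinearMap.ker_eq_bot]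
  refine (hu.2 (LinearMap.ker f) fun x hx => ?_).resolve_right fun h => h0 (LinearMap.ker_eq_top.1 h)
  refine (Module.Flat.rTensor_exact A (LinearMap.exact_subtype_ker_map f) _).1 ?_
  rw [← hf, LinearMap.mem_ker.1 hx, map_zero]

variable [StarModule ℂ A]

/-- The map `x ↦ ∑ xₖ ⊗ π(cₖ)` is a comodule map. -/
lemma diagCoaction_pi [CompactMatrixQuantumGroup A] (Γ : BicovariantCalculus A)
    (u : UnitaryRep A n) (x : Fin n → ℂ) :
    Γ.diagCoaction u.coaction ((Γ.pi.lTensor _ ∘ₗ u.coaction) x)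
      = (Γ.pi.lTensor _ ∘ₗ u.coaction).rTensor A (u.coaction x) := by
  have : Γ.diagCoaction u.coaction ∘ₗ (Γ.pi.lTensor _ ∘ₗ u.coaction)
      = (Γ.pi.lTensor _ ∘ₗ u.coaction).rTensor A ∘ₗ u.coaction := by
    refine (Pi.basisFun ℂ (Fin n)).ext fun i => ?_
    simp only [Pi.basisFun_apply, LinearMap.comp_apply, coaction_single, map_sum,
      LinearMap.rTensor_tmul, LinearMap.lTensor_tmul, BicovariantCalculus.diagCoaction,
      TensorProduct.map_tmul, Γ.varpi_pi, u.ad_mat, TensorProduct.sum_tmul,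
      TensorProduct.tmul_sum, LinearEquiv.coe_coe, TensorProduct.tensorTensorTensorComm_tmul,
      LinearMap.mul'_apply]
    -- Unitarity collapses the sum of `u p j (u k j)*` over `j`; this is how the diagonal coaction
    -- undoes the first factor of the adjoint action.
    have h : ∀ (p k l : Fin n), ∑ j, ((Pi.single p (1 : ℂ) : Fin n → ℂ) ⊗ₜ[ℂ] Γ.pi (u.mat k l)) ⊗ₜ[ℂ]
        (u.mat p j * (star (u.mat k j) * u.mat l i)) = if p = k then
          ((Pi.single p (1 : ℂ) : Fin n → ℂ) ⊗ₜ[ℂ] Γ.pi (u.mat k l)) ⊗ₜ[ℂ] u.mat l i else 0 := by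
      intro p k l
      simp only [← mul_assoc, ← TensorProduct.tmul_sum, ← Finset.sum_mul, u.sum_mul_star]
      split_ifs <;> simp
    rw [Finset.sum_comm]
    trans ∑ k, ∑ l, ∑ p, ∑ j, ((Pi.single p (1 : ℂ) : Fin n → ℂ) ⊗ₜ[ℂ] Γ.pi (u.mat k l)) ⊗ₜ[ℂ]
        (u.mat p j * (star (u.mat k j) * u.mat l i))
    · refine Finset.sum_congr rfl fun k _ => ?_
      rw [Finset.sum_comm]
      exact Finset.sum_congr rfl fun l _ => Finset.sum_comm
    · simp only [h, Finset.sum_ite_eq', Finset.mem_univ, if_true]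
      exact Finset.sum_comm
  exact DFunLike.congr_fun this x

/-- If `π(u) ≠ 0`, then `Λ_u` is acyclic. -/
theorem IsIrreducible.isAcyclic [CompactMatrixQuantumGroup A] (Γ : BicovariantCalculus A)
    {u : UnitaryRep A n} (hu : u.IsIrreducible) (h : ∃ i j, Γ.pi (u.mat i j) ≠ 0) :
    IsAcyclic (dLam Γ u) := by
  have hD : dLam Γ u = Γ.comodD u.coaction := add_comm _ _
  have h0 : Γ.pi.lTensor _ ∘ₗ u.coaction ≠ 0 := by
    obtain ⟨i, j, hij⟩ := h
    intro h
    apply hij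
    -- The `i`-th coordinate of the image of the `j`-th basis vector is `π(u i j)`.
    have h1 := DFunLike.congr_fun h (Pi.single j 1)
    rw [LinearMap.comp_apply, coaction_single, map_sum] at h1
    have h2 := congrArg (TensorProduct.lid ℂ Γ.Inv ∘
      (LinearMap.proj (R := ℂ) (φ := fun _ : Fin n => ℂ) i).rTensor Γ.Inv) h1
    simpa [Pi.single_apply] using h2
  -- The retraction of `x ↦ ∑ xₖ ⊗ π(cₖ)` is the map `μ` of the homotopy, whose right-hand side
  -- thereby becomes the identity.
  obtain ⟨r, hr, hr'⟩ := exists_retraction (Γ.diagCoaction_coassoc u.coaction_coassoc)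
    (Γ.diagCoaction_counit u.coaction_counit) _ (u.diagCoaction_pi Γ)
    (hu.injective (u.diagCoaction_pi Γ) h0)
  have h1 := Γ.homotopy u.coaction_counit hr
  rw [hr', LinearMap.rTensor_id] at h1
  have h2 := Γ.comodD_mul_self u.coaction_coassoc
  rw [IsAcyclic, hD]
  refine le_antisymm (fun z hz => ?_) ?_
  · have h3 := DFunLike.congr_fun h1 z
    rw [LinearMap.add_apply, LinearMap.comp_apply, LinearMap.mem_ker.1 hz, map_zero, zero_add] at h3
    exact ⟨_, h3⟩
  · rintro _ ⟨z, rfl⟩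
    exact DFunLike.congr_fun h2 z

end UnitaryRep

/-! ### The contraction of a product of one-forms. -/

namespace BicovariantCalculus

variable {A : Type*} [Ring A] [HopfAlgebra ℂ A] [StarRing A] (Γ : BicovariantCalculus A)

lemma word_cons (θ : Γ.Inv) (l : List Γ.Inv) : Γ.word (θ :: l) = Γ.inc θ * Γ.word l := by
  simp [word]
-- Iterating the derivation rule, each factor passed contributes a sign and joins the left action.
-- Since indices start at zero, exactly `i` factors precede the contracted one. This is the formula
-- behind `T_λ`.
lemma contract_word [StarModule ℂ A] [CompactMatrixQuantumGroup A] (l : List Γ.Inv) :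
    Γ.contract (Γ.word l) = ∑ i : Fin l.length,
    (-1 : ℂ) ^ (i : ℕ) • Γ.leftAct (Γ.word (l.take i)) (l.get i ⊗ₜ Γ.word (l.drop (i + 1))) := by
  induction l with
  | nil => simp [word, contract_one]
  | cons θ l ih =>
    have h : Γ.word [] = 1 := rfl
    rw [word_cons, contract_inc_mul, ih]
    refine Eq.trans ?_ (Fin.sum_univ_succ (n := l.length) _).symm
    simp [h, leftAct_one, word_cons, leftAct_mul, pow_succ, sub_eq_add_neg]
    exact (Finset.sum_neg_distrib _).symm.trans
      (Finset.sum_congr rfl fun i _ => (neg_smul _ _).symm)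

end BicovariantCalculus

namespace BundleCalculus

variable {V B A : Type*} [Ring V] [Algebra ℂ V] [StarRing V]
    [Ring B] [Algebra ℂ B] [StarRing B] [StarModule ℂ B]
    [Ring A] [HopfAlgebra ℂ A] [StarRing A] [StarModule ℂ A]
    {P : QuantumPrincipalBundle V B A} {Γ : BicovariantCalculus A}
    {Ω : Type*} [Ring Ω] [Algebra ℂ Ω] {gr : ℕ → Submodule ℂ Ω} [GradedAlgebra gr]
    (C : BundleCalculus P Γ gr)

/-! ## The coaction on horizontal forms -/

lemma Fwedge_inc (b : B) : C.Fwedge (C.inc b) = C.inc.toLinearMap.rTensor A (P.F b) := by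
  rw [Fwedge, LinearMap.comp_apply, FhatLin_inc]
  generalize P.F b = t
  induction t with
  | zero => simp
  | add x y hx hy => simp only [map_add, hx, hy]
  | tmul x y => simp [Γ.pStar_incA]

lemma Fwedge_d_inc (b : B) :
    C.Fwedge (C.d (C.inc b)) = (C.d ∘ₗ C.inc.toLinearMap).rTensor A (P.F b) := by
  rw [Fwedge, LinearMap.comp_apply, FhatLin_d_inc]
  generalize P.F b = t
  induction t with
  | zero => simp
  | add x y hx hy =>
    simp only [map_add] at hx hy ⊢
    rw [← hx, ← hy]; abel
  | tmul x y => simp [Γ.pStar_incA, Γ.pStar_dA]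

lemma Fwedge_mul (v w : Ω) : C.Fwedge (v * w) = C.Fwedge v * C.Fwedge w := by
  simp only [Fwedge_eq, map_mul]

/-- Both sides are algebra homomorphisms in `w`, so it suffices to compare them on `b` and `db`,
where the counit axiom of `F` applies. -/
lemma Fwedge_counit (w : Ω) :
    TensorProduct.rid ℂ Ω ((Coalgebra.counit (R := ℂ)).lTensor Ω (C.Fwedge w)) = w := by
  let e : Ω ⊗[ℂ] A →ₐ[ℂ] Ω := (Algebra.TensorProduct.rid ℂ ℂ Ω).toAlgHom.comp
    (Algebra.TensorProduct.map (AlgHom.id ℂ Ω) (Bialgebra.counitAlgHom ℂ A))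
  have he : ∀ z, e z = TensorProduct.rid ℂ Ω ((Coalgebra.counit (R := ℂ)).lTensor Ω z) := by
    intro z
    induction z with
    | zero => simp
    | add x y hx hy => simp only [map_add, hx, hy]
    | tmul x y => simp [e]
  have gen : ∀ (f : B →ₗ[ℂ] Ω) (b : B), C.Fwedge (f b) = f.rTensor A (P.F b) →
      e (C.Fwedge (f b)) = f b := by
    intro f b h
    rw [h, he]
    conv_rhs => rw [← P.counit b]
    generalize P.F b = t
    induction t with
    | zero => simp
    | add x y hx hy => simp only [map_add, hx, hy]
    | tmul x y => simp
  have h : e.comp ((projTensor Γ gr).comp C.Fhat) = AlgHom.id ℂ Ω := by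
    refine C.hom_ext (fun b => ?_) (fun b => ?_)
    · exact (congrArg e (C.Fwedge_eq _).symm).trans (gen C.inc.toLinearMap b (C.Fwedge_inc b))
    · exact (congrArg e (C.Fwedge_eq _).symm).trans
        (gen (C.d ∘ₗ C.inc.toLinearMap) b (C.Fwedge_d_inc b))
  rw [← he, Fwedge_eq]
  exact DFunLike.congr_fun h w

/-- `F̂` respects the total grading involution, and `p_*` does not see the sign on `Γ^∧` because it
kills the generators `da`. -/
lemma Fwedge_gradeInv (w : Ω) : C.Fwedge (gradeInv gr w) = (gradeInv gr).rTensor A (C.Fwedge w) := by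
  have h : ∀ x, Γ.pStar (gradeInv Γ.envGrading x) = Γ.pStar x := by
    have : Γ.pStar.comp (gradeInvHom Γ.envGrading) = Γ.pStar := by
      refine Γ.env_hom_ext (fun a => ?_) (fun a => ?_)
      · have h0 : gradeInvHom Γ.envGrading (Γ.incA a) = Γ.incA a :=
          (gradeInv_of_mem _ (Γ.incA_mem a)).trans (by simp)
        rw [AlgHom.comp_apply, h0]
      · have h1 : gradeInvHom Γ.envGrading (Γ.dA a) = -Γ.dA a :=
          (gradeInv_of_mem _ (Γ.dA_mem a)).trans (by simp)
        rw [AlgHom.comp_apply, h1, map_neg, Γ.pStar_dA, neg_zero]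
    exact DFunLike.congr_fun this
  rw [Fwedge, LinearMap.comp_apply, FhatLin_gradeInv, LinearMap.comp_apply]
  generalize C.FhatLin w = t
  induction t with
  | zero => simp
  | add x y hx hy => simp only [map_add, hx, hy]
  | tmul x y => simp [h]

lemma horCoaction_counit (w : C.hor) :
    TensorProduct.rid ℂ C.hor ((Coalgebra.counit (R := ℂ)).lTensor C.hor (C.horCoaction w)) = w := by
  apply Subtype.ext
  have h := C.Fwedge_counit w
  rw [← horCoaction_coe] at h
  refine Eq.trans ?_ h
  generalize C.horCoaction w = t
  induction t with
  | zero => simp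
  | add x y hx hy => simp only [map_add, Subalgebra.coe_add, hx, hy]
  | tmul x y => simp

lemma horCoaction_mul (v w : C.hor) : C.horCoaction (v * w) = C.horCoaction v * C.horCoaction w := by
  apply C.horInc_injective
  have h : ∀ s t : C.hor ⊗[ℂ] A, C.hor.val.toLinearMap.rTensor A (s * t)
      = C.hor.val.toLinearMap.rTensor A s * C.hor.val.toLinearMap.rTensor A t :=
    map_mul (Algebra.TensorProduct.map C.hor.val (AlgHom.id ℂ A))
  rw [h, horCoaction_coe, horCoaction_coe, horCoaction_coe, ← Fwedge_mul]
  rfl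

/-- Thus the sign operator is a comodule map, and by naturality it commutes with `D`. -/
lemma horCoaction_horInv (w : C.hor) :
    C.horCoaction (C.horInv w) = C.horInv.rTensor A (C.horCoaction w) := by
  apply C.horInc_injective
  rw [horCoaction_coe, ← LinearMap.rTensor_comp_apply]
  refine (C.Fwedge_gradeInv w).trans ?_
  rw [← horCoaction_coe, ← LinearMap.rTensor_comp_apply]
  rfl

lemma horInv_horInv (w : C.hor) : C.horInv (C.horInv w) = w := by
  have h : ∀ w : Ω, gradeInv gr (gradeInv gr w) = w := by
    intro w
    induction w using DirectSum.Decomposition.inductionOn gr with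
    | zero => simp
    | add x y hx hy => simp only [map_add, hx, hy]
    | @homogeneous i x =>
      rw [gradeInv_of_mem gr x.2, map_smul, gradeInv_of_mem gr x.2, smul_smul, ← mul_pow]
      simp
  exact Subtype.ext (h w)

lemma dvh_eq : C.dvh = Γ.comodD C.horCoaction ∘ₗ C.horInv.rTensor Γ.InvExt := rfl

/-! ### The operators `S_λ` and `T_λ`. -/

namespace TensorialForm

variable {C} {p : ℕ} (lam : C.TensorialForm p)

/-- The map `φ ⊗ ϑ ↦ φ λ(ϑ)`. -/
def mulMap : C.hor ⊗[ℂ] Γ.Inv →ₗ[ℂ] C.hor :=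
  LinearMap.mul' ℂ C.hor ∘ₗ lam.toHor.lTensor C.hor

@[simp] lemma mulMap_tmul (φ : C.hor) (θ : Γ.Inv) : lam.mulMap (φ ⊗ₜ θ) = φ * lam.toHor θ := by
  simp [mulMap]

lemma horCoaction_toHor (θ : Γ.Inv) :
    C.horCoaction (lam.toHor θ) = lam.toHor.rTensor A (Γ.varpi θ) := by
  apply C.horInc_injective
  rw [horCoaction_coe, ← LinearMap.rTensor_comp_apply]
  exact lam.intertwines θ

/-- Multiplicativity of `F^∧` and the intertwining property of `λ` combine into the comodule
hypothesis of `homotopy`. -/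
lemma horCoaction_mulMap (z : C.hor ⊗[ℂ] Γ.Inv) :
    C.horCoaction (lam.mulMap z) = lam.mulMap.rTensor A (Γ.diagCoaction C.horCoaction z) := by
  induction z with
  | zero => simp
  | add x y hx hy => simp only [map_add, hx, hy]
  | tmul φ θ =>
    rw [mulMap_tmul, horCoaction_mul, horCoaction_toHor]
    simp only [BicovariantCalculus.diagCoaction, LinearMap.comp_apply, TensorProduct.map_tmul]
    generalize C.horCoaction φ = s
    generalize Γ.varpi θ = t
    induction s with
    | zero => simp
    | add x y hx hy => simp only [map_add, add_mul, TensorProduct.add_tmul, hx, hy]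
    | tmul φ a =>
      induction t with
      | zero => simp
      | add x y hx hy => simp only [map_add, mul_add, TensorProduct.tmul_add, hx, hy]
      | tmul θ b => simp

/-- The source of the sign `(-1)^∂λ`: multiplication by a value of `λ` raises the horizontal degree
by `p`. -/
lemma horInv_mulMap : C.horInv ∘ₗ lam.mulMap
    = (-1 : ℂ) ^ p • (lam.mulMap ∘ₗ C.horInv.rTensor Γ.Inv) := by
  refine TensorProduct.ext' fun φ θ => ?_
  simp only [LinearMap.comp_apply, LinearMap.smul_apply, mulMap_tmul, LinearMap.rTensor_tmul]
  have h1 : C.horInv (lam.toHor θ) = (-1 : ℂ) ^ p • lam.toHor θ :=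
    C.horInv_of_mem (lam.mem_degree θ)
  rw [← mul_smul_comm, ← h1]
  exact Subtype.ext (gradeInv_mul gr _ _)

lemma S_eq : lam.S = (lam.mulMap ∘ₗ Γ.pi.lTensor C.hor ∘ₗ C.horCoaction).rTensor Γ.InvExt := by
  rw [S, mulMap, LinearMap.lTensor_comp]; rfl

lemma IsT.unique {T T' : C.vh →ₗ[ℂ] C.vh} (h : lam.IsT T) (h' : lam.IsT T') : T = T' := by
  refine TensorProduct.ext (LinearMap.ext fun φ => ?_)
  refine LinearMap.ext_on Γ.span_word ?_
  rintro _ ⟨l, rfl⟩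
  exact (h φ l).trans (h' φ l).symm

variable [CompactMatrixQuantumGroup A]

/-- The operator `φ ⊗ η ↦ ∑ φ λ(ϑ) ⊗ ζ`, where `t(η) = ∑ ϑ ⊗ ζ`. -/
def contractMap : C.vh →ₗ[ℂ] C.vh := lam.mulMap.rTensor Γ.InvExt ∘ₗ Γ.contractX C.hor

/-- The operator `T_λ`. -/
def T : C.vh →ₗ[ℂ] C.vh := lam.contractMap ∘ₗ C.horInv.rTensor Γ.InvExt

/-- `T` is already a linear map, built from the contraction, so nothing about relations between
products is left: only its values on words are to be read off from `contract_word`. -/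
lemma isT_T : lam.IsT lam.T := by
  intro φ l
  simp only [T, contractMap, LinearMap.comp_apply, LinearMap.rTensor_tmul,
    BicovariantCalculus.contractX, LinearMap.lTensor_tmul, LinearEquiv.coe_coe, Γ.contract_word,
    TensorProduct.tmul_sum, map_sum, TensorProduct.tmul_smul, map_smul]
  refine Finset.sum_congr rfl fun i _ => ?_
  congr 1
  rw [termT, BicovariantCalculus.leftAct_apply, BicovariantCalculus.convAct_tmul]
  generalize Γ.varpi (l.get i) = t
  induction t with
  | zero => simp
  | add x y hx hy => simp only [map_add, TensorProduct.tmul_add, hx, hy]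
  | tmul θ a => simp

lemma horInv_contractMap : C.horInv.rTensor Γ.InvExt ∘ₗ lam.contractMap
    = (-1 : ℂ) ^ p • lam.T := by
  have h : Γ.contractX C.hor ∘ₗ C.horInv.rTensor Γ.InvExt
      = (C.horInv.rTensor Γ.Inv).rTensor Γ.InvExt ∘ₗ Γ.contractX C.hor := by
    refine TensorProduct.ext' fun φ η => ?_
    simp only [LinearMap.comp_apply, BicovariantCalculus.contractX, LinearMap.rTensor_tmul,
      LinearMap.lTensor_tmul, LinearEquiv.coe_coe]
    generalize Γ.contract η = t
    induction t with
    | zero => simp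
    | add x y hx hy => simp only [map_add, TensorProduct.tmul_add, hx, hy]
    | tmul θ a => simp
  rw [T, contractMap, LinearMap.comp_assoc, h, ← LinearMap.comp_assoc, ← LinearMap.rTensor_comp,
    horInv_mulMap, LinearMap.rTensor_smul, LinearMap.smul_comp, LinearMap.rTensor_comp,
    LinearMap.comp_assoc]

/-- `S_λ = T_λ d_vh + (-1)^∂λ d_vh T_λ`. -/
lemma S_eq_homotopy : lam.S = lam.T ∘ₗ C.dvh + (-1 : ℂ) ^ p • (C.dvh ∘ₗ lam.T) := by
  have h1 := Γ.homotopy C.horCoaction_counit lam.horCoaction_mulMap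
  have h2 : Γ.comodD C.horCoaction ∘ₗ C.horInv.rTensor Γ.InvExt
      = C.horInv.rTensor Γ.InvExt ∘ₗ Γ.comodD C.horCoaction :=
    Γ.comodD_comp_rTensor C.horCoaction_horInv
  have h3 : C.horInv.rTensor Γ.InvExt ∘ₗ C.horInv.rTensor Γ.InvExt = LinearMap.id := by
    have h : C.horInv ∘ₗ C.horInv = LinearMap.id := LinearMap.ext C.horInv_horInv
    rw [← LinearMap.rTensor_comp, h, LinearMap.rTensor_id]
  -- The sign operators in `T_λ` and in `d_vh` meet and cancel, because the operator commutes with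
  -- `D` and is an involution.
  have h4 : lam.T ∘ₗ C.dvh = lam.contractMap ∘ₗ Γ.comodD C.horCoaction := by
    rw [dvh_eq, h2, T, LinearMap.comp_assoc,
      ← LinearMap.comp_assoc _ (C.horInv.rTensor Γ.InvExt) (C.horInv.rTensor Γ.InvExt), h3,
      LinearMap.id_comp]
  -- In the other order the sign operator must cross `φ ↦ φ λ(ϑ)`; the factor `(-1)^p` compensates
  -- for this.
  have h5 : (-1 : ℂ) ^ p • (C.dvh ∘ₗ lam.T) = Γ.comodD C.horCoaction ∘ₗ lam.contractMap := by
    rw [← LinearMap.comp_smul, ← horInv_contractMap, dvh_eq, LinearMap.comp_assoc,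
      ← LinearMap.comp_assoc _ (C.horInv.rTensor Γ.InvExt) (C.horInv.rTensor Γ.InvExt), h3,
      LinearMap.id_comp]
  rw [h4, h5, S_eq]
  exact h1.symm

end TensorialForm

/-- The sign operator is the scalar `(-1)^m` on the image of `f`, and what remains is the naturality
of `D` for comodule maps. -/
lemma dvh_comp_rTensor {n m : ℕ} (u : UnitaryRep A n) {f : (Fin n → ℂ) →ₗ[ℂ] C.hor}
    (hf : ∀ x, C.horCoaction (f x) = f.rTensor A (u.coaction x)) (hm : ∀ x, (f x : Ω) ∈ gr m) :
    C.dvh ∘ₗ f.rTensor Γ.InvExt = (-1 : ℂ) ^ m • (f.rTensor Γ.InvExt ∘ₗ dLam Γ u) := by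
  have hD : dLam Γ u = Γ.comodD u.coaction := add_comm _ _
  have h1 : C.horInv ∘ₗ f = (-1 : ℂ) ^ m • f := LinearMap.ext fun x => C.horInv_of_mem (hm x)
  rw [dvh_eq, LinearMap.comp_assoc, ← LinearMap.rTensor_comp, h1, LinearMap.rTensor_smul,
    LinearMap.comp_smul, hD, Γ.comodD_comp_rTensor hf]

end BundleCalculus

end

end QPB

/-! ### The three statements together. -/

theorem mainTheorem8 {A : Type*} [Ring A] [HopfAlgebra ℂ A] [StarRing A] [StarModule ℂ A]
    [CompactMatrixQuantumGroup A] (Γ : BicovariantCalculus A) :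
    (∀ {V B Ω : Type*} [Ring V] [Algebra ℂ V] [StarRing V]
        [Ring B] [Algebra ℂ B] [StarRing B] [StarModule ℂ B]
        [Ring Ω] [Algebra ℂ Ω] (gr : ℕ → Submodule ℂ Ω) [GradedAlgebra gr]
        (P : QuantumPrincipalBundle V B A) (C : BundleCalculus P Γ gr),
      (∀ (p : ℕ) (lam : C.TensorialForm p),
        (∃! T : C.vh →ₗ[ℂ] C.vh, lam.IsT T) ∧
        ∀ T : C.vh →ₗ[ℂ] C.vh, lam.IsT T →
          lam.S = T ∘ₗ C.dvh + (-1 : ℂ) ^ p • (C.dvh ∘ₗ T)) ∧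
      (∀ (n : ℕ) (u : UnitaryRep A n), u.IsIrreducible →
        ∀ (m : ℕ) (φ : (Fin n → ℂ) →ₗ[ℂ] C.hor),
          (∀ x, C.horCoaction (φ x) = φ.rTensor A (u.coaction x)) →
          (∀ x, (φ x : Ω) ∈ gr m) → φ ≠ 0 →
          Function.Injective (φ.rTensor Γ.InvExt) ∧
          C.dvh ∘ₗ φ.rTensor Γ.InvExt = (-1 : ℂ) ^ m • (φ.rTensor Γ.InvExt ∘ₗ dLam Γ u))) ∧
    (∀ (n : ℕ) (u : UnitaryRep A n), u.IsIrreducible → (∃ i j, Γ.pi (u.mat i j) ≠ 0) →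
      IsAcyclic (dLam Γ u)) := by
  refine ⟨fun gr _ P C => ⟨fun p lam => ⟨⟨lam.T, lam.isT_T, fun T hT => hT.unique lam lam.isT_T⟩,
    fun T hT => ?_⟩, fun n u hu m φ hφ hm h0 => ⟨?_, C.dvh_comp_rTensor u hφ hm⟩⟩,
    fun n u hu h => hu.isAcyclic Γ h⟩
  · rw [hT.unique lam lam.isT_T]
    exact lam.S_eq_homotopy
  -- Irreducibility makes `φ` injective, and tensoring over a field preserves this.
  · exact Module.Flat.rTensor_preserves_injective_linearMap _ (hu.injective hφ h0)
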